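/- Graphs are finite and may have parallel edges, but no loops. For integers $p\ge q\ge 1$, a $(p,q)$-coloring of a graph with vertex set $V$ is a map $f:V\to\{0,1,\dots,p-1\}$ such that $q\le |f(x)-f(y)|\le p-q$ for every edge $xy$. The circular chromatic number $\chi_c$ of a graph is the infimum of the ratios $p/q$ for which it has a $(p,q)$-coloring. The circular chromatic index of a graph $G$ is $\chi'_c(G)=\chi_c(L(G))$, where the line graph $L(G)$ has the edges of $G$ as its vertices, two distinct edges being adjacent if they have an end vertex in common. Let $H_1$ be the graph obtained from the graph with two vertices and three parallel edges between them by subdividing one edge, and let $H_2$ be the graph obtained from the complete graph $K_4$ by subdividing one edge. **Theorem.** If $G$ is a $2$-edge-connected graph of maximum degree $3$ that is isomorphic neither to $H_1$ nor to $H_2$, then $\chi'_c(G)\le \tfrac{11}{3}$. -/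

import Mathlib

open scoped ENNReal

/-- A `(p, q)`-coloring of a graph: a map `f : V → {0, …, p - 1}` such that
`q ≤ |f x - f y| ≤ p - q` for every edge `xy`. -/
def SimpleGraph.IsCircularColoring {V : Type*} (G : SimpleGraph V) (p q : ℕ)
    (f : V → Fin p) : Prop :=
  ∀ x y : V, G.Adj x y →
    (q : ℤ) ≤ |((f x : ℕ) : ℤ) - ((f y : ℕ) : ℤ)| ∧
      |((f x : ℕ) : ℤ) - ((f y : ℕ) : ℤ)| ≤ (p : ℤ) - (q : ℤ)

/-- The circular chromatic number: the infimum of all `p / q`, with `p ≥ q ≥ 1`, such that the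
graph has a `(p, q)`-coloring. It is taken in `[0, ∞]`, so that it is `∞` (and not a junk value)
if there is no such coloring. -/
noncomputable def SimpleGraph.circularChromaticNumber {V : Type*} (G : SimpleGraph V) : ℝ≥0∞ :=
  sInf {r : ℝ≥0∞ | ∃ p q : ℕ, 1 ≤ q ∧ q ≤ p ∧ (∃ f : V → Fin p, G.IsCircularColoring p q f) ∧
    r = (p : ℝ≥0∞) / (q : ℝ≥0∞)}

namespace Graph

/-- The line graph of a multigraph: its vertices are the edges of `G`, and two distinct edges are
adjacent if they have an end in common (in particular, parallel edges are adjacent). -/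
def lineSimpleGraph {α β : Type*} (G : Graph α β) : SimpleGraph E(G) where
  Adj e f := e ≠ f ∧ ∃ x, G.Inc e x ∧ G.Inc f x
  symm := ⟨fun _ _ h => ⟨h.1.symm, h.2.imp fun _ hx => ⟨hx.2, hx.1⟩⟩⟩
  loopless := ⟨fun _ h => h.1 rfl⟩

/-- The circular chromatic index: the circular chromatic number of the line graph. -/
noncomputable def circularChromaticIndex {α β : Type*} (G : Graph α β) : ℝ≥0∞ :=
  G.lineSimpleGraph.circularChromaticNumber

/-- The degree of `x`: the number of edges incident with `x`, loops counted twice. -/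
noncomputable def edegree {α β : Type*} (G : Graph α β) (x : α) : ℕ∞ :=
  (G.incidenceSet x).encard + (G.loopSet x).encard

/-- The maximum degree of a multigraph. -/
noncomputable def maxEDegree {α β : Type*} (G : Graph α β) : ℕ∞ :=
  ⨆ x ∈ V(G), G.edegree x

/-- A multigraph is connected if it has a vertex and any two vertices are joined by a walk. -/
def IsConnected {α β : Type*} (G : Graph α β) : Prop :=
  V(G).Nonempty ∧ ∀ x ∈ V(G), ∀ y ∈ V(G), Relation.ReflTransGen G.Adj x y

/-- A multigraph is `2`-edge-connected if it has at least two vertices, is connected, and stays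
connected when any one edge is deleted. -/
def IsTwoEdgeConnected {α β : Type*} (G : Graph α β) : Prop :=
  V(G).Nontrivial ∧ G.IsConnected ∧ ∀ e ∈ E(G), (G.deleteEdges {e}).IsConnected

/-- Two multigraphs are isomorphic if there are bijections between their vertices and between
their edges that preserve and reflect incidence. -/
def IsIsomorphic {α β α' β' : Type*} (G : Graph α β) (H : Graph α' β') : Prop :=
  ∃ (φ : V(G) ≃ V(H)) (ψ : E(G) ≃ E(H)), ∀ (e : E(G)) (x y : V(G)),
    G.IsLink e x y ↔ H.IsLink (ψ e) (φ x) (φ y)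

/-- The multigraph with vertex set `α` and edge set `β` in which the edge `e` has the ends
`ends e`. -/
def ofEnds {α β : Type*} (ends : β → Sym2 α) : Graph α β where
  vertexSet := Set.univ
  edgeSet := Set.univ
  IsLink e x y := ends e = s(x, y)
  isLink_symm _ _ := ⟨fun _ _ h => h.trans Sym2.eq_swap⟩
  eq_or_eq_of_isLink_of_isLink := by
    intro e x y v w h h'
    have := h.symm.trans h'
    rw [Sym2.eq_iff] at this
    tauto
  edge_mem_iff_exists_isLink := by
    intro e
    refine ⟨fun _ => ?_, fun _ => Set.mem_univ e⟩
    induction h : ends e with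
    | h x y => exact ⟨x, y, rfl⟩
  left_mem_of_isLink := fun _ x _ _ => Set.mem_univ x

/-- The graph `H₁`: three parallel edges between the vertices `0` and `1`, one of which is
subdivided by the new vertex `2`. -/
def H₁ : Graph (Fin 3) (Fin 4) :=
  ofEnds ![s(0, 1), s(0, 1), s(0, 2), s(2, 1)]

/-- The graph `H₂`: the complete graph on the vertices `0, 1, 2, 3`, whose edge between `2` and `3`
is subdivided by the new vertex `4`. -/
def H₂ : Graph (Fin 5) (Fin 7) :=
  ofEnds ![s(0, 1), s(0, 2), s(0, 3), s(1, 2), s(1, 3), s(2, 4), s(4, 3)]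

end Graph

/-!
Colours are taken modulo `11`, with adjacent edges at circular distance at least `3`.

A triangle with three vertices of degree `3` can be contracted. A colouring of the smaller multigraph
extends, since an edge of the triangle can repeat the colour of the edge leaving the opposite vertex
(`IsCubicTriangle.hasColoring_of_contract`). The contracted multigraph may be one of the two exceptions:
from `H₁` only `H₂` arises (`IsCubicTriangle.models_tableH₂`), and the two multigraphs that arise from `H₂`
are coloured explicitly (`IsCubicTriangle.hasColoring_of_models_tableH₂`).

If there is no such triangle, Tutte's theorem gives a matching that covers all vertices of degree `3`
(`IsSubcubic.exists_matching`). Its edges get colours `-1`, `0`, `1`, called labels. What remains consists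
of paths and cycles. Paths and even cycles are coloured by `4` and `7` alternately, which fits all
labels. An odd cycle cannot be coloured in this way, but it can be coloured by `9, 6, 3, 7, 4, …, 7, 4` if
the labels at four consecutive vertices are `1`, `1`, not `1`, not `1`, or similarly with `-1`
(`IsGood.exists_isCycleColoring`). So it remains to label the matching edges such that every odd cycle has
such a window (`CycleSystem.hasLabels`). A remaining triangle has a vertex of degree `2`, and there it
suffices that the labels at the other two vertices differ.

For this, the cycles are treated one after the other (`exists_lists_of_rank`). A cycle chooses a window,
which leaves lists of possible labels at its vertices: a single nonzero label, a nonzero label or `0`, or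
all labels. Each cycle in advance demands a sign at each of its vertices, and neighbours treated earlier
must not enforce the opposite label. There are patterns of demands that allow a window to be chosen in
any case, provided that one of the neighbours is treated later and has the same demand or a suitable
list (`wins_of_alternating`). If some cycle needs no such help, because a chord or a vertex whose
matching edge does not lead to another odd cycle is available, all cycles can be treated in an order
towards it, with the demands chosen in the opposite order (`CycleSystem.exists_labels_of_root`).

Otherwise take the first cycle of a longest path in the graph of cycles, so that all its neighbours are
on the path. Its window is fixed in advance, and the other cycles are treated towards neighbours of its
unrestricted vertices. The two demands at the vertices where the window has a fixed label have to be
met. This is possible if the two neighbours belong to different trees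
(`CycleSystem.RootPath.hasLabels_of_split`), or if the pattern at the median, the cycle of the path where the
branches of the tree meet, can be chosen suitably (`CycleSystem.RootPath.hasLabels_of_median`). If neither
ever happens, the positions of the vertices involved are so restricted that there are two pentagons
joined by three edges (`CycleSystem.hasLabels_of_noRoot`). These two are treated last and choose their
windows simultaneously (`CycleSystem.hasLabels_of_ladder`, `CycleSystem.Twisted.hasLabels`).
-/

/-! ### Lists of labels -/

/-- The lists of labels that occur in the argument. A label is an element of `Option Bool`, where
`some true`, `none`, `some false` stand for `1`, `0`, `-1`. The list `hard s` consists of the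
nonzero label `s`, the list `soft s` of `s` and `0`, and `full` contains all three labels. -/
inductive LabelList where
  | hard (s : Bool)
  | soft (s : Bool)
  | full

namespace LabelList

/-- Membership of a label in a list. -/
def Mem : LabelList → Option Bool → Prop
  | hard s, l => l = some s
  | soft s, l => l = none ∨ l = some s
  | full, _ => True

/-- Two lists are compatible if they have a common label. -/
def Compat (L K : LabelList) : Prop := ∃ l, L.Mem l ∧ K.Mem l

theorem Compat.symm {L K : LabelList} (h : L.Compat K) : K.Compat L := by
  obtain ⟨l, h1, h2⟩ := h
  exact ⟨l, h2, h1⟩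

@[simp] theorem compat_full (L : LabelList) : L.Compat full := by
  cases L with
  | hard s => exact ⟨some s, rfl, trivial⟩
  | soft s => exact ⟨none, Or.inl rfl, trivial⟩
  | full => exact ⟨none, trivial, trivial⟩

@[simp] theorem full_compat (L : LabelList) : full.Compat L := (compat_full L).symm

@[simp] theorem hard_compat_hard {s t : Bool} : (hard s).Compat (hard t) ↔ s = t := by
  constructor
  · rintro ⟨l, h1, h2⟩
    simp only [Mem] at h1 h2
    simpa using h1.symm.trans h2
  · rintro rfl
    exact ⟨some s, rfl, rfl⟩

@[simp] theorem hard_compat_soft {s t : Bool} : (hard s).Compat (soft t) ↔ s = t := by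
  constructor
  · rintro ⟨l, h1, h2⟩
    simp only [Mem] at h1 h2
    simpa [h1] using h2
  · rintro rfl
    exact ⟨some s, rfl, Or.inr rfl⟩

@[simp] theorem soft_compat_hard {s t : Bool} : (soft s).Compat (hard t) ↔ s = t := by
  rw [show (soft s).Compat (hard t) ↔ (hard t).Compat (soft s) from ⟨Compat.symm, Compat.symm⟩,
    hard_compat_soft, eq_comm]

@[simp] theorem soft_compat_soft {s t : Bool} : (soft s).Compat (soft t) :=
  ⟨none, Or.inl rfl, Or.inl rfl⟩

/-- A common label of two lists that depends only on the unordered pair of lists. -/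
theorem exists_symmetric_choice : ∃ p : LabelList → LabelList → Option Bool,
    (∀ L K, p L K = p K L) ∧ ∀ L K : LabelList, L.Compat K → L.Mem (p L K) := by
  classical
  refine ⟨fun L K => if L.Mem none ∧ K.Mem none then none else
    if L.Mem (some true) ∧ K.Mem (some true) then some true else some false, ?_, ?_⟩
  · intro L K
    simp only [and_comm]
  · rintro L K ⟨l, h1, h2⟩
    dsimp only
    split_ifs with h h'
    · exact h.1
    · exact h'.1
    · rcases l with _ | _ | _
      · exact absurd ⟨h1, h2⟩ h
      · exact h1
      · exact absurd ⟨h1, h2⟩ h'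

end LabelList

/-! ### Choosing lists vertex by vertex -/

/-- The greedy principle. The places of the vertex `v` are the elements of `P v`, and `mate` joins
some of the places in pairs. The vertices are treated in the order of the ranks. When the turn of
`v` comes, the lists at the mates of smaller rank are known and are compatible with the demand `B`
at `v`, while at the mates of larger rank only the demand has to be met. If `v` can
always choose an admissible family of lists (`G v`), then there are admissible families at all
vertices of rank less than `N` that fit together. -/
theorem exists_lists_of_rank {κ : Type*} {P : κ → Type*}
    (mate : (Σ v, P v) → Option (Σ v, P v)) (hmate : ∀ x y, mate x = some y → mate y = some x)
    (r : κ → ℕ) (hr : Function.Injective r) (B : (Σ v, P v) → LabelList)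
    (G : ∀ v, (P v → LabelList) → Prop) (N : ℕ)
    (hloc : ∀ v, r v < N → ∀ Av : P v → LabelList,
      (∀ x, mate ⟨v, x⟩ = none → Av x = .full) →
      (∀ x y, mate ⟨v, x⟩ = some y → y.1 = v → Av x = .full) →
      (∀ x y, mate ⟨v, x⟩ = some y → r v < r y.1 → Av x = B y) →
      (∀ x y, mate ⟨v, x⟩ = some y → r y.1 < r v → (Av x).Compat (B ⟨v, x⟩)) →
      ∃ p, G v p ∧ (∀ x, (p x).Compat (Av x)) ∧
        ∀ x y, mate ⟨v, x⟩ = some ⟨v, y⟩ → (p x).Compat (p y)) :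
    ∃ p : ∀ v, P v → LabelList, (∀ v, r v < N → G v (p v)) ∧
      ∀ x y, mate x = some y → r x.1 < N →
        (r y.1 < N → (p x.1 x.2).Compat (p y.1 y.2)) ∧ (N ≤ r y.1 → (p x.1 x.2).Compat (B y)) := by
  classical
  induction N with
  | zero => exact ⟨fun _ _ => .full, by simp, by simp⟩
  | succ N ih =>
    obtain ⟨p, hp, hc⟩ := ih fun v hv => hloc v (by omega)
    by_cases hN : ∃ v, r v = N
    swap
    · have key : ∀ v, r v < N + 1 ↔ r v < N := fun v => by
        have : r v ≠ N := fun h => hN ⟨v, h⟩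
        omega
      refine ⟨p, fun v hv => hp v ((key v).1 hv), fun x y hxy hx => ?_⟩
      have := hc x y hxy ((key _).1 hx)
      exact ⟨fun h => this.1 ((key _).1 h), fun h => this.2 (by omega)⟩
    obtain ⟨v, rfl⟩ := hN
    obtain ⟨q, hq, hqc, hqm⟩ := hloc v (by omega)
      (fun x => match mate ⟨v, x⟩ with
        | none => .full
        | some y => if y.1 = v then .full else if r y.1 < r v then p y.1 y.2 else B y)
      (fun x h => by simp [h]) (fun x y h h' => by simp [h, h'])
      (fun x y h h' => by
        have : y.1 ≠ v := fun e => by rw [e] at h'; exact lt_irrefl _ h'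
        simp [h, this, not_lt.2 h'.le])
      (fun x y h h' => by
        have : y.1 ≠ v := fun e => by rw [e] at h'; exact lt_irrefl _ h'
        simp only [h, this, h', if_true, if_false]
        exact (hc y ⟨v, x⟩ (hmate _ _ h) h').2 le_rfl)
    have key : ∀ u, u ≠ v → (r u < r v + 1 ↔ r u < r v) := fun u hu => by
      have : r u ≠ r v := fun h => hu (hr h)
      omega
    have hother : ∀ u, u ≠ v → Function.update p v q u = p u := fun u hu =>
      Function.update_of_ne hu _ _
    have hself : Function.update p v q v = q := Function.update_self ..
    refine ⟨Function.update p v q, fun u hu => ?_, ?_⟩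
    · by_cases h : u = v
      · subst h; rwa [hself]
      · rw [hother u h]; exact hp u ((key u h).1 hu)
    -- the new vertex `v` against any other vertex
    have hnew : ∀ (x : P v) y, mate ⟨v, x⟩ = some y → y.1 ≠ v →
        (r y.1 < r v → (q x).Compat (p y.1 y.2)) ∧ (r v < r y.1 → (q x).Compat (B y)) := by
      intro x y h hy
      have := hqc x
      simp only [h, hy, if_false] at this
      exact ⟨fun h' => by simpa [h'] using this, fun h' => by simpa [not_lt.2 h'.le] using this⟩
    rintro ⟨u, x⟩ ⟨u', y⟩ hxy hx
    simp only at hx ⊢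
    by_cases hu : u = v
    · subst hu
      rw [hself]
      by_cases hu' : u' = u
      · subst hu'
        rw [hself]
        exact ⟨fun _ => hqm x y hxy, fun h => by omega⟩
      · rw [hother u' hu']
        obtain ⟨h1, h2⟩ := hnew x _ hxy hu'
        exact ⟨fun h => h1 ((key _ hu').1 h), fun h => h2 (by simp only at h ⊢; omega)⟩
    · rw [hother u hu]
      have hx' := (key u hu).1 hx
      obtain ⟨h1, h2⟩ := hc _ _ hxy hx'
      by_cases hu' : u' = v
      · subst hu'
        rw [hself]
        exact ⟨fun _ => ((hnew y _ (hmate _ _ hxy) hu).1 hx').symm, fun h => by omega⟩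
      · rw [hother u' hu']
        exact ⟨fun h => h1 ((key _ hu').1 h), fun h => h2 (by simp only at h ⊢; omega)⟩

/-! ### Winning patterns of demands on an odd cycle -/

/-- A labelling of the places of an odd cycle of length `n` is good if it has a window: four
consecutive places (in one of the two directions) with labels `s`, `s`, not `s`, not `s`, where
`s = ±1`. A triangle has no room for a window. It is good if one of its vertices is virtual, which
means that it is not an end of a matching edge, and the labels at the other two differ. -/
def IsGood (n : ℕ) (virt : ZMod n → Prop) (w : ZMod n → Option Bool) : Prop :=
  (5 ≤ n ∧ ∃ (a d : ZMod n) (s : Bool), (d = 1 ∨ d = -1) ∧ w a = some s ∧ w (a + d) = some s ∧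
    w (a + 2 * d) ≠ some s ∧ w (a + 3 * d) ≠ some s) ∨
  (n = 3 ∧ ∃ i, virt i ∧ w (i + 1) ≠ w (i + 2))

/-- The lists that enforce a window: `hard s` at two consecutive places, `soft (!s)` at the next
two, and no restriction elsewhere. -/
def windowLists (n : ℕ) (a d : ZMod n) (s : Bool) (x : ZMod n) : LabelList :=
  open Classical in
  if x = a ∨ x = a + d then .hard s else if x = a + 2 * d ∨ x = a + 3 * d then .soft (!s) else .full

/-- Lists that force every labelling chosen from them to be good. -/
def IsGoodLists (n : ℕ) (virt : ZMod n → Prop) (p : ZMod n → LabelList) : Prop :=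
  ∀ w : ZMod n → Option Bool, (∀ x, (p x).Mem (w x)) → IsGood n virt w

theorem ZMod.natCast_ne_zero_of_lt {n k : ℕ} (h0 : 0 < k) (h : k < n) : (k : ZMod n) ≠ 0 := by
  rw [Ne, ZMod.natCast_eq_zero_iff]
  exact Nat.not_dvd_of_pos_of_lt h0 h

theorem isGoodLists_window {n : ℕ} (hn : 5 ≤ n) (virt : ZMod n → Prop) (a d : ZMod n) (s : Bool)
    (hd : d = 1 ∨ d = -1) : IsGoodLists n virt (windowLists n a d s) := by
  intro w hw
  have h1 := ZMod.natCast_ne_zero_of_lt (n := n) (k := 1) (by omega) (by omega)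
  have h2 := ZMod.natCast_ne_zero_of_lt (n := n) (k := 2) (by omega) (by omega)
  have h3 := ZMod.natCast_ne_zero_of_lt (n := n) (k := 3) (by omega) (by omega)
  push_cast at h1 h2 h3
  have m1 : d ≠ 0 := by rcases hd with rfl | rfl <;> simpa using h1
  have m2 : 2 * d ≠ 0 := by rcases hd with rfl | rfl <;> simpa using h2
  have m3 : 3 * d ≠ 0 := by rcases hd with rfl | rfl <;> simpa using h3
  have e21 : a + 2 * d ≠ a + d := fun h => m1 (by linear_combination h)
  have e31 : a + 3 * d ≠ a + d := fun h => m2 (by linear_combination h)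
  refine Or.inl ⟨hn, a, d, s, hd, ?_, ?_, ?_, ?_⟩
  · simpa [windowLists, LabelList.Mem] using hw a
  · simpa [windowLists, LabelList.Mem] using hw (a + d)
  · have := hw (a + 2 * d)
    simp only [windowLists, e21, m2, add_eq_left, or_self, if_false, true_or, if_true,
      LabelList.Mem] at this
    rcases this with h | h <;> simp [h]
  · have := hw (a + 3 * d)
    simp only [windowLists, e31, m3, add_eq_left, or_self, if_false, or_true, if_true,
      LabelList.Mem] at this
    rcases this with h | h <;> simp [h]

/-- The pattern `e` of demands wins on a cycle of length `n` with soft place `z`, if good lists can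
be chosen against all available lists that meet the demand: these lists may be anything but
`hard (!e x)` at a place `x ≠ z`, while at `z` both labels `0` and `e z` are available. -/
def Wins (n : ℕ) (z : ZMod n) (e : ZMod n → Bool) : Prop :=
  ∀ Av : ZMod n → LabelList, (∀ x, x ≠ z → Av x ≠ .hard (!e x)) → (∀ s, Av z ≠ .hard s) →
    Av z ≠ .soft (!e z) → ∃ (a d : ZMod n) (s : Bool), (d = 1 ∨ d = -1) ∧
      ∀ x, (windowLists n a d s x).Compat (Av x)

/-- A window fits the available lists if `s` is available at its first two places, and a label other than
`s` at the next two. -/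
theorem windowLists_compat {n : ℕ} {a d : ZMod n} {s : Bool} {Av : ZMod n → LabelList}
    (h0 : Av a ≠ .hard (!s)) (h0' : Av a ≠ .soft (!s))
    (h1 : Av (a + d) ≠ .hard (!s)) (h1' : Av (a + d) ≠ .soft (!s))
    (h2 : Av (a + 2 * d) ≠ .hard s) (h3 : Av (a + 3 * d) ≠ .hard s) (x : ZMod n) :
    (windowLists n a d s x).Compat (Av x) := by
  have key1 : ∀ L : LabelList, L ≠ .hard (!s) → L ≠ .soft (!s) → (LabelList.hard s).Compat L := by
    intro L hL hL'
    cases L with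
    | hard t => cases s <;> cases t <;> simp_all
    | soft t => cases s <;> cases t <;> simp_all
    | full => simp
  have key2 : ∀ L : LabelList, L ≠ .hard s → (LabelList.soft (!s)).Compat L := by
    intro L hL
    cases L with
    | hard t => cases s <;> cases t <;> simp_all
    | soft t => simp
    | full => simp
  unfold windowLists
  split_ifs with h h'
  · rcases h with rfl | rfl
    · exact key1 _ h0 h0'
    · exact key1 _ h1 h1'
  · rcases h' with rfl | rfl
    · exact key2 _ h2
    · exact key2 _ h3
  · simp

/-- If every pair of equal neighbouring values is blocked on both sides, the values alternate around the
soft place `0`, which cannot block any pair. -/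
theorem values_near_zero_of_blocked {n : ℕ} (hn : 5 ≤ n) (e O : ℕ → Bool) (H : ℕ → Prop)
    (hO : ∀ k, O (k + n) = O k) (hHper : ∀ k, H (k + n) ↔ H k)
    (h1 : ∀ k, O k = O (k + 1) → (H (k + 2) ∧ O (k + 2) = O k) ∨ (H (k + 3) ∧ O (k + 3) = O k))
    (h2 : ∀ k, O (k + 2) = O (k + 3) →
      (H (k + 1) ∧ O (k + 1) = O (k + 2)) ∨ (H k ∧ O k = O (k + 2)))
    (hH : ∀ k, k < n → H k → O k = e k) (hH0 : ¬ H 0) (hO0 : O 0 = true)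
    (e1 : e 1 = true) (e2 : e 2 = false) (e3 : e 3 = false) (em1 : e (n - 1) = true) :
    O (n - 1) = false ∧ O 1 = false ∧ O 2 = true ∧ O 3 = false ∧ O 4 = true ∧ O 5 = false := by
  have Hn : ¬ H n := by simpa using (hHper 0).not.2 hH0
  have On : O n = true := by simpa [hO0] using hO 0
  have On1 : O (n + 1) = O 1 := by rw [add_comm]; exact hO 1
  have On2 : O (n + 2) = O 2 := by rw [add_comm]; exact hO 2
  have Hn1 : H (n + 1) ↔ H 1 := by rw [add_comm]; exact hHper 1
  have Hn2 : H (n + 2) ↔ H 2 := by rw [add_comm]; exact hHper 2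
  have q1 := hH 1 (by omega)
  have q2 := hH 2 (by omega)
  have q3 := hH 3 (by omega)
  have qm1 := hH (n - 1) (by omega)
  rw [e1] at q1; rw [e2] at q2; rw [e3] at q3; rw [em1] at qm1
  have O1 : O 1 = false := by
    have := h1 0
    simp only [zero_add] at this
    clear h1 h2 hH hO hHper
    grind
  have Om1 : O (n - 1) = false := by
    have := h1 (n - 1)
    rw [show n - 1 + 1 = n by omega, show n - 1 + 2 = n + 1 by omega,
      show n - 1 + 3 = n + 2 by omega] at this
    clear h1 h2 hH hO hHper
    grind
  have O2 : O 2 = true := by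
    have := h2 (n - 1)
    rw [show n - 1 + 1 = n by omega, show n - 1 + 2 = n + 1 by omega,
      show n - 1 + 3 = n + 2 by omega] at this
    clear h1 h2 hH hO hHper
    grind
  have O3 : O 3 = false := by
    have := h2 0
    simp only [zero_add] at this
    clear h1 h2 hH hO hHper
    grind
  have O4 : O 4 = true := by
    have := h2 1
    simp only [Nat.reduceAdd] at this
    clear h1 h2 hH hO hHper
    grind
  have O5 : O 5 = false := by
    have := h2 2
    simp only [Nat.reduceAdd] at this
    clear h1 h2 hH hO hHper
    grind
  exact ⟨Om1, O1, O2, O3, O4, O5⟩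

/-- The combinatorial core: `O k` is the nonzero label that is available at the `k`-th place, and
`H k` says that `0` is not available there. If every pair of equal neighbouring values is blocked
on both sides, the alternating pattern `e`, flipped at some places, leads to a
contradiction: walking away from `0` in either direction, `O` has to alternate, and the two walks
do not fit together as `n` is odd. -/
theorem false_of_blocked {n : ℕ} (hodd : Odd n) (hn : 5 ≤ n) (e O : ℕ → Bool) (H : ℕ → Prop)
    (hO : ∀ k, O (k + n) = O k) (hHper : ∀ k, H (k + n) ↔ H k)
    (h1 : ∀ k, O k = O (k + 1) → (H (k + 2) ∧ O (k + 2) = O k) ∨ (H (k + 3) ∧ O (k + 3) = O k))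
    (h2 : ∀ k, O (k + 2) = O (k + 3) →
      (H (k + 1) ∧ O (k + 1) = O (k + 2)) ∨ (H k ∧ O k = O (k + 2)))
    (hH : ∀ k, k < n → H k → O k = e k) (hH0 : ¬ H 0) (hO0 : O 0 = true)
    (e1 : e 1 = true) (e2 : e 2 = false) (e3 : e 3 = false) (em1 : e (n - 1) = true)
    (hflip : ∀ y, 8 ≤ y → y < n → (e y = true ↔ Odd y) →
      (e (y - 5) = true ↔ Odd (y - 5)) ∧ (e (y - 4) = true ↔ Even (y - 4))) : False := by
  have Hn : ¬ H n := by simpa using (hHper 0).not.2 hH0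
  have On : O n = true := by simpa [hO0] using hO 0
  have On1 : O (n + 1) = O 1 := by rw [add_comm]; exact hO 1
  have Hn1 : H (n + 1) ↔ H 1 := by rw [add_comm]; exact hHper 1
  have q1 := hH 1 (by omega)
  rw [e1] at q1
  obtain ⟨Om1, O1, O2, O3, O4, O5⟩ :=
    values_near_zero_of_blocked hn e O H hO hHper h1 h2 hH hH0 hO0 e1 e2 e3 em1
  obtain ⟨t, ht⟩ := hodd
  have hn7 : 7 ≤ n := by
    by_contra h
    have : n = 5 := by omega
    subst this
    rw [On] at O5
    exact absurd O5 (by simp)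
  -- the walk from `n` downwards
  have main : ∀ j, 1 ≤ j → j < n → ∀ i, 1 ≤ i → i ≤ j → (O (n - i) = true ↔ Even i) := by
    intro j hj
    induction j, hj using Nat.le_induction with
    | base =>
      intro _ i hi1 hi2
      obtain rfl : i = 1 := by omega
      simp [Om1]
    | succ j hj ih =>
      intro hjn i hi1 hi2
      have ih := ih (by omega)
      rcases Nat.lt_or_ge i (j + 1) with h | h
      · exact ih i hi1 (by omega)
      obtain rfl : i = j + 1 := by omega
      have oj := ih j hj le_rfl
      by_contra hcon
      have heq : O (n - (j + 1)) = O (n - j) := by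
        rw [Nat.even_add_one] at hcon
        rw [Bool.eq_iff_iff]
        tauto
      obtain ⟨z, hz⟩ : ∃ z, n = z + 1 + j := ⟨n - j - 1, by omega⟩
      rw [show n - (j + 1) = z by omega, show n - j = z + 1 by omega] at heq
      rw [show n - j = z + 1 by omega] at oj
      -- the pair `z`, `z + 1` can only be blocked from the right at a flipped place `z + 3`
      have hright : 3 ≤ j ∧ (e (z + 3) = true ↔ Odd (z + 3)) := by
        rcases h1 z heq with ⟨ha, hb⟩ | ⟨ha, hb⟩
        · exfalso
          rcases Nat.lt_or_ge j 2 with hj2 | hj2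
          · obtain rfl : j = 1 := by omega
            rw [show z + 2 = n by omega] at ha
            exact Hn ha
          · have := ih (j - 1) (by omega) (by omega)
            rw [show n - (j - 1) = z + 2 by omega] at this
            rw [hb, heq, oj] at this
            clear h1 h2 hH hO hHper hflip ih
            grind
        · rcases Nat.lt_or_ge j 3 with hj2 | hj2
          · exfalso
            interval_cases j
            · rw [show z + 3 = n + 1 by omega] at ha hb
              rw [Hn1] at ha
              rw [On1, O1, heq] at hb
              simp [O1] at q1
              exact q1 ha
            · rw [show z + 3 = n by omega] at ha
              exact Hn ha
          · refine ⟨hj2, ?_⟩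
            rw [← hH _ (by omega) ha, hb, heq, oj]
            clear h1 h2 hH hO hHper hflip ih
            grind
      obtain ⟨hj3, hf⟩ := hright
      rcases Nat.lt_or_ge z 5 with hz5 | hz5
      · clear h1 h2 hH hO hHper hflip ih
        interval_cases z <;> grind
      · obtain ⟨f5, f4⟩ := hflip (z + 3) (by omega) (by omega) hf
        rw [show z + 3 - 5 = z - 2 by omega] at f5
        rw [show z + 3 - 4 = z - 1 by omega] at f4
        have hblock := h2 (z - 2)
        rw [show z - 2 + 1 = z - 1 by omega, show z - 2 + 2 = z by omega,
          show z - 2 + 3 = z + 1 by omega] at hblock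
        rcases hblock heq with ⟨ha, hb⟩ | ⟨ha, hb⟩
        · rw [← hH _ (by omega) ha, hb, heq, oj] at f4
          clear h1 h2 hH hO hHper hflip ih hblock
          grind
        · rw [← hH _ (by omega) ha, hb, heq, oj] at f5
          clear h1 h2 hH hO hHper hflip ih hblock
          grind
  have := main (n - 1) (by omega) (by omega) (n - 1) (by omega) le_rfl
  rw [show n - (n - 1) = 1 by omega, O1] at this
  grind

/-- Demands that alternate around the cycle, read from the soft place `z` in the direction `d`,
win. Here `q k` says whether the demand at the `k`-th place differs from the one at `z`. The
pattern may deviate from the alternating one at places far from `z` as long as the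
deviations are closed under steps of `5` towards `z` and isolated at distance `4`. -/
theorem wins_of_alternating {n : ℕ} (hodd : Odd n) (hn : 5 ≤ n) (z d : ZMod n)
    (hd : d = 1 ∨ d = -1) (e : ZMod n → Bool) (q : ℕ → Bool)
    (he : ∀ k : ℕ, 1 ≤ k → k < n → e (z + k * d) = (e z ^^ q k))
    (q1 : q 1 = false) (q2 : q 2 = true) (q3 : q 3 = true) (qm1 : q (n - 1) = false)
    (hflip : ∀ y, 8 ≤ y → y < n → (q y = true ↔ Even y) →
      (q (y - 5) = true ↔ Even (y - 5)) ∧ (q (y - 4) = true ↔ Odd (y - 4))) : Wins n z e := by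
  intro Av hAv hz hz'
  by_contra hcon
  let o : ZMod n → Bool := fun x => match Av x with
    | .hard s => s
    | .soft s => s
    | .full => e z
  have ho : ∀ x s, Av x = .hard s → o x = s := fun x s h => by simp [o, h]
  have ho' : ∀ x, Av x ≠ .hard (!(o x)) ∧ Av x ≠ .soft (!(o x)) := by
    intro x
    cases h : Av x with
    | hard s => simp [o, h]
    | soft s => simp [o, h]
    | full => simp
  have hoz : o z = e z := by
    cases h : Av z with
    | hard s => exact absurd h (hz s)
    | soft s =>
      have : s ≠ !e z := fun h' => hz' (by rw [h, h'])
      simp only [o, h]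
      cases s <;> cases h2 : e z <;> simp_all
    | full => simp [o, h]
  have hblock : ∀ a d' : ZMod n, (d' = 1 ∨ d' = -1) → o a = o (a + d') →
      ((∃ s, Av (a + 2 * d') = .hard s) ∧ o (a + 2 * d') = o a) ∨
      ((∃ s, Av (a + 3 * d') = .hard s) ∧ o (a + 3 * d') = o a) := by
    intro a d' hd' hoo
    by_contra h
    push Not at h
    refine hcon ⟨a, d', o a, hd', windowLists_compat (ho' a).1 (ho' a).2 ?_ ?_ ?_ ?_⟩
    · rw [hoo]; exact (ho' _).1
    · rw [hoo]; exact (ho' _).2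
    · exact fun hs => h.1 ⟨_, hs⟩ (ho _ _ hs)
    · exact fun hs => h.2 ⟨_, hs⟩ (ho _ _ hs)
  have hcast : ∀ k : ℕ, z + ((k + n : ℕ) : ZMod n) * d = z + (k : ZMod n) * d := fun k => by
    push_cast; simp
  have hd' : -d = 1 ∨ -d = -1 := by rcases hd with rfl | rfl <;> simp
  refine false_of_blocked hodd hn (fun k => !q k) (fun k => o (z + (k : ZMod n) * d) ^^ !e z)
    (fun k => ∃ s, Av (z + (k : ZMod n) * d) = .hard s) ?_ ?_ ?_ ?_ ?_ ?_ ?_ ?_ ?_ ?_ ?_ ?_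
  · intro k; simp only [hcast]
  · intro k; simp only [hcast]
  · intro k hk
    have := hblock (z + (k : ZMod n) * d) d hd (by
      simpa [add_mul, add_assoc] using hk)
    rw [show z + (k : ZMod n) * d + 2 * d = z + ((k + 2 : ℕ) : ZMod n) * d by push_cast; ring,
      show z + (k : ZMod n) * d + 3 * d = z + ((k + 3 : ℕ) : ZMod n) * d by push_cast; ring] at this
    simpa using this
  · intro k hk
    have e3 : z + ((k + 3 : ℕ) : ZMod n) * d + -d = z + ((k + 2 : ℕ) : ZMod n) * d := by
      push_cast; ring
    have hk' : o (z + ((k + 2 : ℕ) : ZMod n) * d) = o (z + ((k + 3 : ℕ) : ZMod n) * d) := by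
      simpa using hk
    have := hblock (z + ((k + 3 : ℕ) : ZMod n) * d) (-d) hd' (by rw [e3, hk'])
    rw [show z + ((k + 3 : ℕ) : ZMod n) * d + 2 * -d = z + ((k + 1 : ℕ) : ZMod n) * d by
        push_cast; ring,
      show z + ((k + 3 : ℕ) : ZMod n) * d + 3 * -d = z + (k : ZMod n) * d by
        push_cast; ring, ← hk'] at this
    simpa using this
  · rintro k hk ⟨s, hs⟩
    rcases Nat.eq_zero_or_pos k with rfl | hk0
    · simp only [Nat.cast_zero, zero_mul, add_zero] at hs
      exact absurd hs (hz s)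
    · have hne : z + (k : ZMod n) * d ≠ z := by
        have := ZMod.natCast_ne_zero_of_lt hk0 hk
        rcases hd with rfl | rfl <;> simpa using this
      have h1 := ho _ _ hs
      have h2 := hAv _ hne
      rw [hs, he k hk0 hk] at h2
      simp only [h1]
      revert h2
      cases s <;> cases e z <;> cases q k <;> simp
  · rintro ⟨s, hs⟩
    simp only [Nat.cast_zero, zero_mul, add_zero] at hs
    exact hz s hs
  · simp [hoz]
  · simp [q1]
  · simp [q2]
  · simp [q3]
  · simp [qm1]
  · intro y h8 hy h
    have := hflip y h8 hy (by
      rw [← Nat.not_odd_iff_even, ← h]; simp)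
    constructor
    · rw [← Nat.not_even_iff_odd, ← this.1]; simp
    · rw [← Nat.not_odd_iff_even, ← this.2]; simp

/-! ### Relative patterns and flexible pairs of places -/

/-- A relative pattern of demands that wins whatever the sign `g` at the soft place `z` is. -/
def WinsRel (n : ℕ) (z : ZMod n) (pat : ZMod n → Bool) : Prop :=
  pat z = false ∧ ∀ g, Wins n z fun x => (g ^^ pat x)

theorem exists_winsRel {n : ℕ} (hodd : Odd n) (hn : 5 ≤ n) (z d : ZMod n)
    (hd : d = 1 ∨ d = -1) (q : ℕ → Bool)
    (q1 : q 1 = false) (q2 : q 2 = true) (q3 : q 3 = true) (qm1 : q (n - 1) = false)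
    (hflip : ∀ y, 8 ≤ y → y < n → (q y = true ↔ Even y) →
      (q (y - 5) = true ↔ Even (y - 5)) ∧ (q (y - 4) = true ↔ Odd (y - 4))) :
    ∃ pat, WinsRel n z pat ∧ ∀ k : ℕ, 1 ≤ k → k < n → pat (z + k * d) = q k := by
  have : NeZero n := ⟨by omega⟩
  have hval : ∀ k : ℕ, k < n → ((d * (z + k * d - z)).val) = k := by
    intro k hk
    have : d * (z + k * d - z) = (k : ZMod n) := by
      rcases hd with rfl | rfl <;> ring
    rw [this, ZMod.val_natCast_of_lt hk]
  let pat : ZMod n → Bool := fun x => if x = z then false else q ((d * (x - z)).val)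
  have hpat : ∀ k : ℕ, 1 ≤ k → k < n → pat (z + k * d) = q k := by
    intro k h1 hk
    have hne : z + (k : ZMod n) * d ≠ z := by
      have := ZMod.natCast_ne_zero_of_lt h1 hk
      rcases hd with rfl | rfl <;> simpa using this
    simp only [pat, hne, if_false, hval k hk]
  refine ⟨pat, ⟨by simp [pat], fun g => ?_⟩, hpat⟩
  refine wins_of_alternating hodd hn z d hd _ q (fun k h1 hk => ?_) q1 q2 q3 qm1 hflip
  simp only [hpat k h1 hk]
  simp [pat]

/-- The alternating relative pattern, with a single defect at the place `2`. -/
def altPattern (k : ℕ) : Bool := decide (k = 2 ∨ (3 ≤ k ∧ Odd k))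

theorem exists_winsRel_alt {n : ℕ} (hodd : Odd n) (hn : 5 ≤ n) (z d : ZMod n)
    (hd : d = 1 ∨ d = -1) :
    ∃ pat, WinsRel n z pat ∧ ∀ k : ℕ, 1 ≤ k → k < n → pat (z + k * d) = altPattern k := by
  obtain ⟨t, ht⟩ := hodd
  refine exists_winsRel ⟨t, ht⟩ hn z d hd altPattern ?_ ?_ ?_ ?_ ?_
  · simp [altPattern]
  · simp [altPattern]
  · simp [altPattern]; decide
  · simp [altPattern, Nat.odd_iff]; omega
  · intro y h1 h2 h
    simp only [altPattern, decide_eq_true_eq, Nat.odd_iff, Nat.even_iff] at h ⊢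
    omega

/-- The alternating pattern still wins after being flipped at the places `j`, `j - 5`, `j - 10`, and so
on down to `4`. -/
theorem exists_winsRel_flip {n : ℕ} (hodd : Odd n) (hn : 7 ≤ n) (z d : ZMod n)
    (hd : d = 1 ∨ d = -1) (j : ℕ) (hj : j + 3 ≤ n) (hj3 : j % 5 ≠ 3) :
    ∃ pat, WinsRel n z pat ∧ ∀ k : ℕ, 1 ≤ k → k < n →
      pat (z + k * d) = (altPattern k ^^ decide (4 ≤ k ∧ k ≤ j ∧ k % 5 = j % 5)) := by
  obtain ⟨t, ht⟩ := hodd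
  refine exists_winsRel ⟨t, ht⟩ (by omega) z d hd
    (fun k => altPattern k ^^ decide (4 ≤ k ∧ k ≤ j ∧ k % 5 = j % 5)) ?_ ?_ ?_ ?_ ?_
  · simp [altPattern]
  · simp [altPattern]
  · simp [altPattern]; decide
  · have h1 : ¬ (4 ≤ n - 1 ∧ n - 1 ≤ j ∧ (n - 1) % 5 = j % 5) := by omega
    have h2 : ¬ (n - 1 = 2 ∨ (3 ≤ n - 1 ∧ Odd (n - 1))) := by rw [Nat.odd_iff]; omega
    simp only [altPattern, h1, h2, decide_false, Bool.xor_false]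
  · intro y h1 h2 h
    simp only [altPattern, Nat.odd_iff, Nat.even_iff, bne_iff_ne, ne_eq, decide_eq_decide] at h ⊢
    omega

/-- Two distinct places of a cycle are far apart if their distance is at least `3`. -/
def IsFar (n : ℕ) (z b : ZMod n) : Prop := 3 ≤ (b - z).val ∧ (b - z).val + 3 ≤ n

/-- The sign relation between two places: `true` (change of sign) at distance `2`, and `false`
otherwise. -/
def signChange (n : ℕ) (z b : ZMod n) : Bool :=
  decide ((b - z).val = 2 ∨ (b - z).val + 2 = n)

/-- Whatever the demand at `z` is, the demands at `b` and `c` can be given any prescribed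
relation by a winning pattern. -/
def IsFlexible (n : ℕ) (z b c : ZMod n) : Prop :=
  ∀ s, ∃ pat, WinsRel n z pat ∧ (pat b ^^ pat c) = s

theorem ZMod.eq_add_val_mul {n : ℕ} [NeZero n] (z b : ZMod n) :
    b = z + ((b - z).val : ZMod n) * 1 := by
  simp

theorem ZMod.eq_add_sub_val_mul {n : ℕ} [NeZero n] (z b : ZMod n) :
    b = z + ((n - (b - z).val : ℕ) : ZMod n) * (-1) := by
  rw [Nat.cast_sub (ZMod.val_lt _).le]
  simp

theorem ZMod.val_sub_pos {n : ℕ} [NeZero n] {z b : ZMod n} (h : b ≠ z) : 1 ≤ (b - z).val := by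
  rw [Nat.one_le_iff_ne_zero, Ne, ZMod.val_eq_zero, sub_eq_zero]
  exact h

theorem ZMod.val_sub_comm {n : ℕ} [NeZero n] {z b : ZMod n} (h : b ≠ z) :
    (z - b).val = n - (b - z).val := by
  rw [← neg_sub b z, ZMod.neg_val, if_neg (sub_ne_zero.2 h)]

theorem isFar_comm {n : ℕ} [NeZero n] {z b : ZMod n} : IsFar n z b ↔ IsFar n b z := by
  by_cases h : b = z
  · rw [h]
  · have := ZMod.val_lt (b - z)
    rw [IsFar, IsFar, ZMod.val_sub_comm h]
    omega

theorem signChange_comm {n : ℕ} [NeZero n] (z b : ZMod n) :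
    signChange n z b = signChange n b z := by
  by_cases h : b = z
  · rw [h]
  · have := ZMod.val_lt (b - z)
    rw [signChange, signChange, ZMod.val_sub_comm h, decide_eq_decide]
    omega

/-- There is a winning pattern that follows `signChange` at all places not far from `z`. -/
theorem exists_winsRel_near {n : ℕ} (hodd : Odd n) (hn : 5 ≤ n) (z : ZMod n) :
    ∃ pat, WinsRel n z pat ∧ ∀ b, b ≠ z → ¬ IsFar n z b → pat b = signChange n z b := by
  have : NeZero n := ⟨by omega⟩
  obtain ⟨pat, hpat, h⟩ := exists_winsRel_alt hodd hn z 1 (Or.inl rfl)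
  refine ⟨pat, hpat, fun b hb hfar => ?_⟩
  have h1 := ZMod.val_sub_pos hb
  have h2 := ZMod.val_lt (b - z)
  obtain ⟨t, ht⟩ := hodd
  conv_lhs => rw [ZMod.eq_add_val_mul z b]
  rw [h _ h1 h2, altPattern, signChange, decide_eq_decide, Nat.odd_iff]
  unfold IsFar at hfar
  omega

/-- A single place can be made to follow `signChange`. -/
theorem exists_winsRel_single {n : ℕ} (hodd : Odd n) (hn : 5 ≤ n) (z b : ZMod n) (hb : b ≠ z) :
    ∃ pat, WinsRel n z pat ∧ pat b = signChange n z b := by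
  have : NeZero n := ⟨by omega⟩
  have h1 := ZMod.val_sub_pos hb
  have h2 := ZMod.val_lt (b - z)
  obtain ⟨t, ht⟩ := id hodd
  by_cases hcase : IsFar n z b ∧ Odd (b - z).val
  · obtain ⟨pat, hpat, h⟩ := exists_winsRel_alt hodd hn z (-1) (Or.inr rfl)
    refine ⟨pat, hpat, ?_⟩
    conv_lhs => rw [ZMod.eq_add_sub_val_mul z b]
    rw [h _ (by omega) (by omega), altPattern, signChange, decide_eq_decide]
    rw [IsFar, Nat.odd_iff] at hcase
    rw [Nat.odd_iff]
    omega
  · obtain ⟨pat, hpat, h⟩ := exists_winsRel_alt hodd hn z 1 (Or.inl rfl)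
    refine ⟨pat, hpat, ?_⟩
    conv_lhs => rw [ZMod.eq_add_val_mul z b]
    rw [h _ h1 h2, altPattern, signChange, decide_eq_decide]
    rw [IsFar, Nat.odd_iff] at hcase
    rw [Nat.odd_iff]
    omega

theorem IsFlexible.symm {n : ℕ} {z b c : ZMod n} (h : IsFlexible n z b c) :
    IsFlexible n z c b := fun s => by
  obtain ⟨p, hp, e⟩ := h s
  exact ⟨p, hp, by rw [Bool.xor_comm, e]⟩

theorem isFlexible_of_two {n : ℕ} {z b c : ZMod n} {p p' : ZMod n → Bool} (h : WinsRel n z p)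
    (h' : WinsRel n z p') (hne : (p b ^^ p c) ≠ (p' b ^^ p' c)) : IsFlexible n z b c := by
  intro s
  by_cases hs : (p b ^^ p c) = s
  · exact ⟨p, h, hs⟩
  · refine ⟨p', h', ?_⟩
    revert hs hne
    cases (p b ^^ p c) <;> cases (p' b ^^ p' c) <;> cases s <;> simp

/-- One near and one far place: read the alternating pattern in both directions. -/
theorem isFlexible_of_near_of_far {n : ℕ} (hodd : Odd n) (hn : 5 ≤ n) {z b c : ZMod n}
    (hb : b ≠ z) (hnear : ¬ IsFar n z b) (hfar : IsFar n z c) : IsFlexible n z b c := by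
  have : NeZero n := ⟨by omega⟩
  obtain ⟨t, ht⟩ := id hodd
  obtain ⟨p, hp, h⟩ := exists_winsRel_alt hodd hn z 1 (Or.inl rfl)
  obtain ⟨p', hp', h'⟩ := exists_winsRel_alt hodd hn z (-1) (Or.inr rfl)
  have hb1 := ZMod.val_sub_pos hb
  have hb2 := ZMod.val_lt (b - z)
  unfold IsFar at hnear hfar
  have e1 : p b = p' b := by
    conv_lhs => rw [ZMod.eq_add_val_mul z b]
    conv_rhs => rw [ZMod.eq_add_sub_val_mul z b]
    rw [h _ hb1 hb2, h' _ (by omega) (by omega), altPattern, altPattern, decide_eq_decide,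
      Nat.odd_iff, Nat.odd_iff]
    omega
  have e2 : p c ≠ p' c := by
    conv_lhs => rw [ZMod.eq_add_val_mul z c]
    conv_rhs => rw [ZMod.eq_add_sub_val_mul z c]
    rw [h _ (by omega) (by omega), h' _ (by omega) (by omega), altPattern, altPattern, Ne,
      decide_eq_decide, Nat.odd_iff, Nat.odd_iff]
    omega
  refine isFlexible_of_two hp hp' ?_
  rw [e1]
  simpa using e2

/-- The alternating pattern and its flip at `j`, `j - 5`, … agree at `b` and differ at `c`. -/
theorem isFlexible_of_flip {n : ℕ} (hodd : Odd n) (hn : 7 ≤ n) {z b c d : ZMod n}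
    (hd : d = 1 ∨ d = -1) (i j : ℕ) (hb : b = z + i * d) (hc : c = z + j * d) (hi : 3 ≤ i)
    (hi' : i + 3 ≤ n) (hj : 3 ≤ j) (hj' : j + 3 ≤ n) (hj3 : j % 5 ≠ 3)
    (hij : j < i ∨ i % 5 ≠ j % 5) : IsFlexible n z b c := by
  obtain ⟨p, hp, h⟩ := exists_winsRel_alt hodd (by omega) z d hd
  obtain ⟨p', hp', h'⟩ := exists_winsRel_flip hodd hn z d hd j hj' hj3
  refine isFlexible_of_two hp hp' ?_
  rw [hb, hc, h _ (by omega) (by omega), h _ (by omega) (by omega), h' _ (by omega) (by omega),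
    h' _ (by omega) (by omega)]
  have h1 : ¬ (4 ≤ i ∧ i ≤ j ∧ i % 5 = j % 5) := by omega
  have h2 : 4 ≤ j ∧ j ≤ j ∧ j % 5 = j % 5 := by omega
  simp only [h1, h2, decide_false]
  cases altPattern i <;> cases altPattern j <;> simp

/-- Two far places are flexible, with the exception of one residue class modulo `5`. -/
theorem isFlexible_of_far_of_far {n : ℕ} (hodd : Odd n) (hn : 7 ≤ n) {z b c : ZMod n}
    (hbc : b ≠ c) (hb : IsFar n z b) (hc : IsFar n z c)
    (hbad : ¬ (n % 5 = 1 ∧ (b - z).val % 5 = 3 ∧ (c - z).val % 5 = 3)) : IsFlexible n z b c := by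
  have : NeZero n := ⟨by omega⟩
  have b1 := ZMod.eq_add_val_mul z b
  have b2 := ZMod.eq_add_sub_val_mul z b
  have c1 := ZMod.eq_add_val_mul z c
  have c2 := ZMod.eq_add_sub_val_mul z c
  have hne : (b - z).val ≠ (c - z).val := fun h => hbc (by
    have := ZMod.val_injective n h
    simpa using this)
  unfold IsFar at hb hc
  generalize (b - z).val = i at *
  generalize (c - z).val = j at *
  by_cases h1 : j % 5 ≠ 3 ∧ (j < i ∨ i % 5 ≠ j % 5)
  · exact isFlexible_of_flip hodd hn (Or.inl rfl) i j b1 c1 hb.1 hb.2 hc.1 hc.2 h1.1 h1.2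
  by_cases h2 : i % 5 ≠ 3 ∧ (i < j ∨ j % 5 ≠ i % 5)
  · exact (isFlexible_of_flip hodd hn (Or.inl rfl) j i c1 b1 hc.1 hc.2 hb.1 hb.2 h2.1 h2.2).symm
  by_cases h3 : n - j < n - i
  · exact isFlexible_of_flip hodd hn (Or.inr rfl) (n - i) (n - j) b2 c2 (by omega) (by omega)
      (by omega) (by omega) (by omega) (by omega)
  · exact (isFlexible_of_flip hodd hn (Or.inr rfl) (n - j) (n - i) c2 b2 (by omega) (by omega)
      (by omega) (by omega) (by omega) (by omega)).symm

/-- On a long cycle, three places are flexible as seen from the first or from the last of them,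
unless they are pairwise near. -/
theorem isFlexible_or_isFlexible_or_near {n : ℕ} (hodd : Odd n) (hn : 7 ≤ n) {u v w : ZMod n}
    (huv : v ≠ u) (huw : w ≠ u) (hvw : v ≠ w) :
    IsFlexible n u v w ∨ IsFlexible n w v u ∨
      (¬ IsFar n u v ∧ ¬ IsFar n u w ∧ ¬ IsFar n v w) := by
  have : NeZero n := ⟨by omega⟩
  by_cases h1 : IsFar n u v <;> by_cases h2 : IsFar n u w
  · by_cases hbad : n % 5 = 1 ∧ (v - u).val % 5 = 3 ∧ (w - u).val % 5 = 3
    swap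
    · exact Or.inl (isFlexible_of_far_of_far hodd hn hvw h1 h2 hbad)
    refine Or.inr (Or.inl ?_)
    obtain ⟨b0, b1, b2⟩ := hbad
    have hv := ZMod.val_lt (v - w)
    have key : ((v - w).val + (w - u).val) % n = (v - u).val := by
      rw [← ZMod.val_add]; congr 1; ring
    have h12 := h1
    have h22 := h2
    unfold IsFar at h12 h22
    have hsum : (v - w).val + (w - u).val = (v - u).val ∨
        (v - w).val + (w - u).val = (v - u).val + n := by
      rcases Nat.lt_or_ge ((v - w).val + (w - u).val) n with h | h
      · rw [Nat.mod_eq_of_lt h] at key; exact Or.inl key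
      · rw [Nat.mod_eq_sub_mod h, Nat.mod_eq_of_lt (by omega)] at key
        right; omega
    have hpos := ZMod.val_sub_pos hvw
    refine isFlexible_of_far_of_far hodd hn huv (by unfold IsFar; omega)
      (isFar_comm.1 h2) (by omega)
  · exact Or.inl (isFlexible_of_near_of_far hodd (by omega) huw h2 h1).symm
  · exact Or.inl (isFlexible_of_near_of_far hodd (by omega) huv h1 h2)
  · by_cases h3 : IsFar n v w
    · exact Or.inr (Or.inl (isFlexible_of_near_of_far hodd (by omega) huw.symm
        (fun h => h2 (isFar_comm.1 h)) (isFar_comm.1 h3)).symm)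
    · exact Or.inr (Or.inr ⟨h1, h2, h3⟩)

/-! ### Systems of odd cycles joined by a matching -/

/-- The odd cycles that remain when a matching is removed from a multigraph of maximum degree `3`,
together with the matching edges between their vertices. The cycle `c` has length `n c`, its places are the
elements of `ZMod (n c)`, and `mate` joins places in pairs; it is `none` at a vertex
that is virtual (not an end of a matching edge) or joined to a vertex outside of the system. -/
structure CycleSystem (κ : Type*) where
  /-- The length of a cycle. -/
  n : κ → ℕ
  odd : ∀ c, Odd (n c)
  three_le : ∀ c, 3 ≤ n c
  /-- The other end of the matching edge at a place. -/
  mate : (Σ c, ZMod (n c)) → Option (Σ c, ZMod (n c))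
  mate_symm : ∀ x y, mate x = some y → mate y = some x
  mate_ne : ∀ x, mate x ≠ some x
  /-- The places that are not ends of matching edges. -/
  virt : (Σ c, ZMod (n c)) → Prop
  mate_of_virt : ∀ x, virt x → mate x = none
  triangle : ∀ c, n c = 3 → ∃ i, virt ⟨c, i⟩ ∧ mate ⟨c, i + 1⟩ ≠ some ⟨c, i + 2⟩
  chord_two : ∀ c i, 5 ≤ n c → mate ⟨c, i⟩ = some ⟨c, i + 2⟩ → mate ⟨c, i + 1⟩ = none
  connected : ∀ S : Set κ, S.Nonempty → (∀ x, x.1 ∈ S → ∃ y, mate x = some y ∧ y.1 ∈ S) →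
    S = Set.univ

namespace CycleSystem

variable {κ : Type*} (S : CycleSystem κ)

/-- Lists for the places of the cycle `v` that force a good labelling. -/
def Good (v : κ) (p : ZMod (S.n v) → LabelList) : Prop :=
  IsGoodLists (S.n v) (fun i => S.virt ⟨v, i⟩) p

/-- The demands `e` at the places of `v` can be met without any help from other cycles. -/
def FreeWins (v : κ) (e : ZMod (S.n v) → Bool) : Prop :=
  ∀ Av : ZMod (S.n v) → LabelList, (∀ x, S.mate ⟨v, x⟩ = none → Av x = .full) →
    (∀ x y, S.mate ⟨v, x⟩ = some ⟨v, y⟩ → Av x = .full) → (∀ x, Av x ≠ .hard (!e x)) →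
    ∃ p, S.Good v p ∧ (∀ x, (p x).Compat (Av x)) ∧
      ∀ x y, S.mate ⟨v, x⟩ = some ⟨v, y⟩ → (p x).Compat (p y)

/-- A cycle is a root if one of its places has no mate or is joined to a place of the same
cycle. -/
def IsRoot (v : κ) : Prop :=
  ∃ x, S.mate ⟨v, x⟩ = none ∨ ∃ y, S.mate ⟨v, x⟩ = some ⟨v, y⟩

theorem five_le {v : κ} (h : S.n v ≠ 3) : 5 ≤ S.n v := by
  obtain ⟨t, ht⟩ := S.odd v
  have := S.three_le v
  omega

end CycleSystem

theorem LabelList.compat_soft_iff {L : LabelList} {s : Bool} :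
    L.Compat (.soft s) ↔ L ≠ .hard (!s) := by
  cases L with
  | hard t => cases s <;> cases t <;> simp
  | soft t => simp
  | full => simp

theorem windowLists_self_compat {n : ℕ} {a d : ZMod n} {s : Bool} {x y : ZMod n}
    (h1 : (x = a ∨ x = a + d) → y ≠ a + 2 * d ∧ y ≠ a + 3 * d)
    (h2 : (y = a ∨ y = a + d) → x ≠ a + 2 * d ∧ x ≠ a + 3 * d) :
    (windowLists n a d s x).Compat (windowLists n a d s y) := by
  unfold windowLists
  by_cases hx : x = a ∨ x = a + d
  · obtain ⟨y1, y2⟩ := h1 hx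
    simp only [hx, if_true, y1, y2, or_self, if_false]
    split_ifs <;> simp
  · simp only [hx, if_false]
    by_cases hy : y = a ∨ y = a + d
    · obtain ⟨x1, x2⟩ := h2 hy
      simp [x1, x2]
    · simp only [hy, if_false]
      split_ifs <;> simp

namespace CycleSystem

variable {κ : Type*} (S : CycleSystem κ)

theorem good_window {v : κ} (hn : 5 ≤ S.n v) (a d : ZMod (S.n v)) (s : Bool)
    (hd : d = 1 ∨ d = -1) : S.Good v (windowLists (S.n v) a d s) :=
  isGoodLists_window hn _ a d s hd

theorem freeWins_of_wins {v : κ} (hn : 5 ≤ S.n v) {z : ZMod (S.n v)} {e : ZMod (S.n v) → Bool}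
    (hz : S.mate ⟨v, z⟩ = none) (hc : ∀ x y, S.mate ⟨v, x⟩ ≠ some ⟨v, y⟩)
    (hw : Wins (S.n v) z e) : S.FreeWins v e := by
  intro Av h1 _ h3
  obtain ⟨a, d, s, hd, h⟩ := hw Av (fun x _ => h3 x) (by simp [h1 z hz]) (by simp [h1 z hz])
  exact ⟨_, S.good_window hn a d s hd, h, fun x y hxy => absurd hxy (hc x y)⟩

/-- A place is free if its mate, if any, belongs to the same cycle. -/
def IsFree (v : κ) (x : ZMod (S.n v)) : Prop :=
  S.mate ⟨v, x⟩ = none ∨ ∃ y, S.mate ⟨v, x⟩ = some ⟨v, y⟩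

/-- Two adjacent free places that are not joined to the next two places on one side. -/
theorem freeWins_of_free_pair {v : κ} (hn : 5 ≤ S.n v) (a d : ZMod (S.n v))
    (hd : d = 1 ∨ d = -1) (h0 : S.IsFree v a) (h1 : S.IsFree v (a + d))
    (hm : ∀ x y, (x = a ∨ x = a + d) → S.mate ⟨v, x⟩ = some ⟨v, y⟩ →
      y ≠ a + 2 * d ∧ y ≠ a + 3 * d) : S.FreeWins v fun _ => true := by
  intro Av hA hA' hA''
  have hfree : ∀ x, S.IsFree v x → Av x = .full := by
    rintro x (h | ⟨y, h⟩)
    · exact hA x h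
    · exact hA' x y h
  refine ⟨_, S.good_window hn a d false hd, windowLists_compat ?_ ?_ ?_ ?_ ?_ ?_, ?_⟩
  · simp [hfree _ h0]
  · simp [hfree _ h0]
  · simp [hfree _ h1]
  · simp [hfree _ h1]
  · exact hA'' _
  · exact hA'' _
  · intro x y hxy
    exact windowLists_self_compat (fun h => hm x y h hxy)
      (fun h => hm y x h (S.mate_symm _ _ hxy))

/-- A triangle has a virtual vertex. Lists without a common label at its two other vertices can be
chosen against any available lists that meet opposite demands there. -/
theorem freeWins_triangle {v : κ} (hn : S.n v = 3) : ∃ e, S.FreeWins v e := by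
  classical
  obtain ⟨i, hi, hne⟩ := S.triangle v hn
  have h01 : i + 1 ≠ i := by
    have := ZMod.natCast_ne_zero_of_lt (n := S.n v) (k := 1) (by omega) (by omega)
    simpa using this
  have h02 : i + 2 ≠ i := by
    have := ZMod.natCast_ne_zero_of_lt (n := S.n v) (k := 2) (by omega) (by omega)
    simpa using this
  have h12 : i + 2 ≠ i + 1 := by
    have := ZMod.natCast_ne_zero_of_lt (n := S.n v) (k := 1) (by omega) (by omega)
    intro h
    apply this
    push_cast
    linear_combination h
  have hall : ∀ x, x = i ∨ x = i + 1 ∨ x = i + 2 := by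
    have key : ∀ m : ℕ, m = 3 → ∀ i x : ZMod m, x = i ∨ x = i + 1 ∨ x = i + 2 := by
      rintro m rfl; decide
    exact key _ hn i
  -- the lists `K`, `L` at the two vertices that are not virtual have to exclude equal labels
  have hmain : ∀ Av : ZMod (S.n v) → LabelList, (∃ K L : LabelList, K.Compat (Av (i + 1)) ∧
      L.Compat (Av (i + 2)) ∧ ¬ K.Compat L) → (Av i = .full) →
      ∃ p, S.Good v p ∧ (∀ x, (p x).Compat (Av x)) ∧
        ∀ x y, S.mate ⟨v, x⟩ = some ⟨v, y⟩ → (p x).Compat (p y) := by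
    rintro Av ⟨K, L, hK, hL, hKL⟩ h0
    refine ⟨fun x => if x = i + 1 then K else if x = i + 2 then L else .full, ?_, ?_, ?_⟩
    · intro w hw
      refine Or.inr ⟨hn, i, hi, fun h => hKL ⟨w (i + 1), ?_, ?_⟩⟩
      · simpa using hw (i + 1)
      · rw [h]; simpa [h12] using hw (i + 2)
    · intro x
      rcases hall x with rfl | rfl | rfl
      · simp [h01.symm, h02.symm]
      · simpa using hK
      · simpa [h12] using hL
    · intro x y hxy
      rcases hall x with rfl | rfl | rfl
      · simp [h01.symm, h02.symm]
      · rcases hall y with rfl | rfl | rfl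
        · simp [h01.symm, h02.symm]
        · exact absurd hxy (S.mate_ne _)
        · exact absurd hxy hne
      · rcases hall y with rfl | rfl | rfl
        · simp [h01.symm, h02.symm]
        · exact absurd (S.mate_symm _ _ hxy) hne
        · exact absurd hxy (S.mate_ne _)
  refine ⟨fun x => decide (x = i + 1), fun Av h1 _ h3 => hmain Av ?_ (h1 i (S.mate_of_virt _ hi))⟩
  have d1 := h3 (i + 1)
  have d2 := h3 (i + 2)
  simp only [h12, decide_true, decide_false, Bool.not_true, Bool.not_false] at d1 d2
  by_cases hs : Av (i + 1) = .soft false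
  · by_cases ht : Av (i + 2) = .soft true
    · exact ⟨.hard false, .soft true, by simp [hs], by simp [ht], by simp⟩
    · refine ⟨.soft true, .hard false, by simp [hs], ?_, by simp⟩
      cases h : Av (i + 2) with
      | hard s => cases s <;> simp_all
      | soft s => cases s <;> simp_all
      | full => simp
  · refine ⟨.hard true, .soft false, ?_, ?_, by simp⟩
    · cases h : Av (i + 1) with
      | hard s => cases s <;> simp_all
      | soft s => cases s <;> simp_all
      | full => simp
    · cases h : Av (i + 2) with
      | hard s => cases s <;> simp_all
      | soft s => simp
      | full => simp

/-- A cycle with a chord meets suitable demands. A chord of length `1` or `2` gives two adjacent free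
places. If `x` is the end of a longer chord, the sign that is available at the next
place decides on which side the window is put. -/
theorem freeWins_of_chord {v : κ} (hn : 5 ≤ S.n v) (h : ∃ x y, S.mate ⟨v, x⟩ = some ⟨v, y⟩) :
    ∃ e, S.FreeWins v e := by
  classical
  obtain ⟨t, ht⟩ := S.odd v
  have hk : ∀ k : ℕ, 0 < k → k < S.n v → (k : ZMod (S.n v)) ≠ 0 := fun k =>
    ZMod.natCast_ne_zero_of_lt
  have k1 := hk 1 (by omega) (by omega)
  have k2 := hk 2 (by omega) (by omega)
  have k3 := hk 3 (by omega) (by omega)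
  have k4 := hk 4 (by omega) (by omega)
  push_cast at k1 k2 k3 k4
  by_cases hone : ∃ a d, (d = 1 ∨ d = -1) ∧ S.mate ⟨v, a⟩ = some ⟨v, a + d⟩
  · obtain ⟨a, d, hd, hm⟩ := hone
    refine ⟨_, S.freeWins_of_free_pair hn a d hd (Or.inr ⟨_, hm⟩)
      (Or.inr ⟨_, S.mate_symm _ _ hm⟩) ?_⟩
    have hm' := S.mate_symm _ _ hm
    rintro x y (rfl | rfl) hxy
    · rw [hm] at hxy
      obtain rfl : _ = y := by simpa using hxy
      constructor <;> intro h
      · rcases hd with rfl | rfl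
        · exact k1 (by linear_combination -h)
        · exact k1 (by linear_combination h)
      · rcases hd with rfl | rfl
        · exact k2 (by linear_combination -h)
        · exact k2 (by linear_combination h)
    · rw [hm'] at hxy
      obtain rfl : _ = y := by simpa using hxy
      constructor <;> intro h
      · rcases hd with rfl | rfl
        · exact k2 (by linear_combination -h)
        · exact k2 (by linear_combination h)
      · rcases hd with rfl | rfl
        · exact k3 (by linear_combination -h)
        · exact k3 (by linear_combination h)
  by_cases htwo : ∃ a, S.mate ⟨v, a⟩ = some ⟨v, a + 2⟩
  · obtain ⟨a, hm⟩ := htwo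
    have hnone := S.chord_two v a hn hm
    refine ⟨_, S.freeWins_of_free_pair hn (a + 1) (-1) (Or.inr rfl) (Or.inl hnone)
      (Or.inr ⟨a + 2, by simpa using hm⟩) ?_⟩
    rintro x y (rfl | rfl) hxy
    · rw [hnone] at hxy; simp at hxy
    · rw [show a + 1 + -1 = a by ring, hm] at hxy
      obtain rfl : _ = y := by simpa using hxy
      constructor <;> intro h
      · exact k3 (by linear_combination h)
      · exact k4 (by linear_combination h)
  obtain ⟨x, y, hxy⟩ := h
  have hne : ∀ a b d, (d = 1 ∨ d = -1) → S.mate ⟨v, a⟩ = some ⟨v, b⟩ →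
      b ≠ a ∧ b ≠ a + d ∧ b ≠ a + 2 * d := by
    rintro a b d hd hab
    refine ⟨?_, ?_, ?_⟩ <;> rintro rfl
    · exact S.mate_ne _ hab
    · exact hone ⟨a, d, hd, hab⟩
    · rcases hd with rfl | rfl
      · exact htwo ⟨a, by simpa using hab⟩
      · refine htwo ⟨a + 2 * -1, ?_⟩
        have := S.mate_symm _ _ hab
        rw [this]
        congr 2
        ring
  -- a chord of length at least `3` forces `n ≥ 7`
  have hn7 : 7 ≤ S.n v := by
    by_contra hlt
    have h5 : S.n v = 5 := by omega
    have key : ∀ m : ℕ, m = 5 → ∀ x y : ZMod m, y = x ∨ y = x + 1 ∨ y = x + 2 * 1 ∨ y = x + -1 ∨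
        y = x + 2 * -1 := by
      rintro m rfl; decide
    obtain ⟨m1, m2, m3⟩ := hne x y 1 (Or.inl rfl) hxy
    obtain ⟨-, m5, m6⟩ := hne x y (-1) (Or.inr rfl) hxy
    rcases key _ h5 x y with h | h | h | h | h <;> contradiction
  have k5 := hk 5 (by omega) (by omega)
  have k6 := hk 6 (by omega) (by omega)
  push_cast at k5 k6
  obtain ⟨d, hd, hy3⟩ : ∃ d : ZMod (S.n v), (d = 1 ∨ d = -1) ∧ y ≠ x - 3 * d := by
    by_cases h : y = x - 3 * 1
    · refine ⟨-1, Or.inr rfl, fun h' => k6 ?_⟩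
      linear_combination h - h'
    · exact ⟨1, Or.inl rfl, h⟩
  have hd' : -d = 1 ∨ -d = -1 := by rcases hd with rfl | rfl <;> simp
  obtain ⟨m1, m2, m3⟩ := hne x y d hd hxy
  obtain ⟨-, m5, m6⟩ := hne x y (-d) hd' hxy
  have hx : S.IsFree v x := Or.inr ⟨y, hxy⟩
  by_cases hfree : S.IsFree v (x - d)
  · refine ⟨_, S.freeWins_of_free_pair hn x (-d) hd' hx (by rwa [← sub_eq_add_neg]) ?_⟩
    rintro u w (rfl | rfl) huw
    · rw [hxy] at huw
      obtain rfl : y = w := by simpa using huw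
      exact ⟨m6, fun h => hy3 (by rw [h]; ring)⟩
    · obtain ⟨-, p2, p3⟩ := hne _ w (-d) hd' huw
      exact ⟨fun h => p2 (by rw [h]; ring), fun h => p3 (by rw [h]; ring)⟩
  · have dk : ∀ k : ZMod (S.n v), k ≠ 0 → k * d ≠ 0 := by
      intro k hk0
      rcases hd with rfl | rfl <;> simpa using hk0
    refine ⟨fun u => decide (u = x - 2 * d ∨ u = x - 3 * d), fun Av hA hA' hA'' => ?_⟩
    have hAx : Av x = .full := hA' x y hxy
    have hAf : ∀ u, (u = x - 2 * d ∨ u = x - 3 * d) → Av u ≠ .hard false := fun u hu => by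
      simpa [hu] using hA'' u
    have hAt : ∀ u, ¬ (u = x - 2 * d ∨ u = x - 3 * d) → Av u ≠ .hard true := fun u hu => by
      simpa [hu] using hA'' u
    have hnotfree : ∀ w, S.mate ⟨v, x - d⟩ ≠ some ⟨v, w⟩ := fun w h => hfree (Or.inr ⟨w, h⟩)
    by_cases hs : Av (x - d) = .hard false ∨ Av (x - d) = .soft false
    · refine ⟨_, S.good_window hn x (-d) false hd', windowLists_compat ?_ ?_ ?_ ?_ ?_ ?_, ?_⟩
      · simp [hAx]
      · simp [hAx]
      · rw [← sub_eq_add_neg]; rcases hs with h | h <;> simp [h]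
      · rw [← sub_eq_add_neg]; rcases hs with h | h <;> simp [h]
      · exact hAf _ (Or.inl (by ring))
      · exact hAf _ (Or.inr (by ring))
      · have key : ∀ u w, (u = x ∨ u = x + -d) → S.mate ⟨v, u⟩ = some ⟨v, w⟩ →
            w ≠ x + 2 * -d ∧ w ≠ x + 3 * -d := by
          rintro u w (rfl | rfl) huw
          · rw [hxy] at huw
            obtain rfl : y = w := by simpa using huw
            exact ⟨m6, fun h => hy3 (by rw [h]; ring)⟩
          · exact absurd huw (by rw [← sub_eq_add_neg]; exact hnotfree w)
        intro u w huw
        exact windowLists_self_compat (fun h => key u w h huw)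
          (fun h => key w u h (S.mate_symm _ _ huw))
    · push Not at hs
      refine ⟨_, S.good_window hn (x - d) d true hd, windowLists_compat ?_ ?_ ?_ ?_ ?_ ?_, ?_⟩
      · exact hs.1
      · exact hs.2
      · simp [hAx]
      · simp [hAx]
      · refine hAt _ ?_
        rintro (h | h)
        · exact dk 3 k3 (by linear_combination h)
        · exact dk 4 k4 (by linear_combination h)
      · refine hAt _ ?_
        rintro (h | h)
        · exact dk 4 k4 (by linear_combination h)
        · exact dk 5 k5 (by linear_combination h)
      · have key : ∀ u w, (u = x - d ∨ u = x - d + d) → S.mate ⟨v, u⟩ = some ⟨v, w⟩ →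
            w ≠ x - d + 2 * d ∧ w ≠ x - d + 3 * d := by
          rintro u w (rfl | rfl) huw
          · exact absurd huw (hnotfree w)
          · rw [sub_add_cancel, hxy] at huw
            obtain rfl : y = w := by simpa using huw
            exact ⟨fun h => m2 (by rw [h]; ring), fun h => m3 (by rw [h]; ring)⟩
        intro u w huw
        exact windowLists_self_compat (fun h => key u w h huw)
          (fun h => key w u h (S.mate_symm _ _ huw))

/-- Suitable demands at a root can be met without any help. -/
theorem exists_freeWins {v : κ} (h : S.IsRoot v) : ∃ e, S.FreeWins v e := by
  by_cases hn : S.n v = 3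
  · exact S.freeWins_triangle hn
  have h5 := S.five_le hn
  by_cases hc : ∃ x y, S.mate ⟨v, x⟩ = some ⟨v, y⟩
  · exact S.freeWins_of_chord h5 hc
  push Not at hc
  obtain ⟨z, hz | ⟨y, hy⟩⟩ := h
  · obtain ⟨pat, hp, -⟩ := exists_winsRel_near (S.odd v) h5 z
    exact ⟨_, S.freeWins_of_wins h5 hz hc (hp.2 true)⟩
  · exact absurd hy (hc z y)

end CycleSystem

/-! ### Systems with a root -/

namespace CycleSystem

variable {κ : Type*} (S : CycleSystem κ)

/-- A cycle whose demands `E` can be met with the help of one place `z`, joined either to a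
cycle outside of `out` that is closer to a root, or to a place in `out` whose list is soft with
the right sign or full. -/
def WinsTowards (out : Set κ) (depth : κ → ℕ) (B : (Σ c, ZMod (S.n c)) → LabelList)
    (E : (Σ c, ZMod (S.n c)) → Bool) (v : κ) : Prop :=
  5 ≤ S.n v ∧ (∀ x y, S.mate ⟨v, x⟩ ≠ some ⟨v, y⟩) ∧
    ∃ z y, S.mate ⟨v, z⟩ = some y ∧ Wins (S.n v) z (fun x => E ⟨v, x⟩) ∧
      ((y.1 ∉ out ∧ depth y.1 < depth v ∧ E y = E ⟨v, z⟩) ∨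
       (y.1 ∈ out ∧ (B y = .full ∨ B y = .soft (E ⟨v, z⟩))))

/-- If every cycle outside of `out` wins, either freely or with the help of a cycle closer to a
root, then good lists can be chosen at all of them that are compatible with each other and with
the lists `B` given at the places in `out`. -/
theorem exists_lists [Finite κ] (out : Set κ) (depth : κ → ℕ)
    (B : (Σ c, ZMod (S.n c)) → LabelList) (E : (Σ c, ZMod (S.n c)) → Bool)
    (hB : ∀ x y, S.mate x = some y → x.1 ∉ out → y.1 ∈ out → B y ≠ .hard (!E x))
    (hwin : ∀ v, v ∉ out → S.FreeWins v (fun x => E ⟨v, x⟩) ∨ S.WinsTowards out depth B E v) :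
    ∃ p : ∀ v, ZMod (S.n v) → LabelList, (∀ v, v ∉ out → S.Good v (p v)) ∧
      ∀ x y, S.mate x = some y → x.1 ∉ out →
        (y.1 ∉ out → (p x.1 x.2).Compat (p y.1 y.2)) ∧ (y.1 ∈ out → (p x.1 x.2).Compat (B y)) := by
  classical
  obtain ⟨K, ⟨ι⟩⟩ := Finite.exists_equiv_fin κ
  obtain ⟨D, hD⟩ : ∃ D, ∀ v, depth v ≤ D := by
    have := Fintype.ofFinite κ
    exact ⟨Finset.univ.sup depth, fun v => Finset.le_sup (f := depth) (Finset.mem_univ v)⟩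
  let r : κ → ℕ := fun v => (if v ∈ out then D + 1 else D - depth v) * K + (ι v : ℕ)
  have hr : Function.Injective r := by
    intro u v h
    have h' := congrArg (· % K) h
    simp only [r, Nat.mul_add_mod', Nat.mod_eq_of_lt (ι u).2, Nat.mod_eq_of_lt (ι v).2] at h'
    exact ι.injective (Fin.ext h')
  have hlt : ∀ a b (i j : ℕ), i < K → a < b → a * K + i < b * K + j := by
    intro a b i j hi hab
    have : (a + 1) * K ≤ b * K := Nat.mul_le_mul_right K hab
    rw [add_mul] at this
    omega
  have hout : ∀ v, r v < (D + 1) * K ↔ v ∉ out := by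
    intro v
    by_cases hv : v ∈ out
    · simp [r, hv]
    · have := hlt (D - depth v) (D + 1) (ι v) 0 (ι v).2 (by omega)
      simpa [r, hv] using this
  have hdep : ∀ u v, u ∉ out → v ∉ out → depth u < depth v → r v < r u := by
    intro u v hu hv h
    simp only [r, hu, hv, if_false]
    exact hlt _ _ _ _ (ι v).2 (by have := hD v; omega)
  let B' : (Σ c, ZMod (S.n c)) → LabelList := fun y => if y.1 ∈ out then B y else .soft (E y)
  refine (exists_lists_of_rank S.mate S.mate_symm r hr B' S.Good ((D + 1) * K) ?_).elim ?_
  swap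
  · rintro p ⟨hp, hc⟩
    refine ⟨p, fun v hv => hp v ((hout v).2 hv), fun x y hxy hx => ?_⟩
    obtain ⟨h1, h2⟩ := hc x y hxy ((hout _).2 hx)
    refine ⟨fun h => h1 ((hout _).2 h), fun h => ?_⟩
    have := h2 (by by_contra hlt'; exact (hout _).1 (not_le.1 hlt') h)
    simpa [B', h] using this
  intro v hv Av hnone hself hup hdown
  have hvo := (hout v).1 hv
  -- nothing that is available contradicts the demand
  have hAv : ∀ x, Av x ≠ .hard (!E ⟨v, x⟩) := by
    intro x
    cases hm : S.mate ⟨v, x⟩ with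
    | none => simp [hnone x hm]
    | some y =>
      rcases lt_trichotomy (r v) (r y.1) with h | h | h
      · rw [hup x y hm h]
        by_cases hy : y.1 ∈ out
        · simpa [B', hy] using hB _ _ hm hvo hy
        · simp [B', hy]
      · simp [hself x y hm (hr h).symm]
      · have := hdown x y hm h
        rwa [show B' ⟨v, x⟩ = .soft (E ⟨v, x⟩) by simp [B', hvo],
          LabelList.compat_soft_iff] at this
  rcases hwin v hvo with hfree | ⟨hn, hc, z, y, hzy, hw, hcase⟩
  · exact hfree Av hnone (fun x y h => hself x _ h rfl) hAv
  · have hz : Av z = .full ∨ Av z = .soft (E ⟨v, z⟩) := by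
      rcases hcase with ⟨hy, hd, hE⟩ | ⟨hy, hBy⟩
      · rw [hup z y hzy (hdep _ _ hy hvo hd)]
        simp [B', hy, hE]
      · rw [hup z y hzy (lt_of_lt_of_le hv (by
          by_contra h; exact (hout _).1 (not_le.1 h) hy))]
        simpa [B', hy] using hBy
    obtain ⟨a, d, s, hd, h⟩ := hw Av (fun x _ => hAv x)
      (by rcases hz with h | h <;> simp [h])
      (by rcases hz with h | h <;> simp [h])
    exact ⟨_, S.good_window hn a d s hd, h, fun x y hxy => absurd hxy (hc x y)⟩

/-- Lists that fit together yield labels. -/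
theorem exists_labels_of_lists (p : ∀ v, ZMod (S.n v) → LabelList) (hp : ∀ v, S.Good v (p v))
    (hc : ∀ x y, S.mate x = some y → (p x.1 x.2).Compat (p y.1 y.2)) :
    ∃ w : (Σ c, ZMod (S.n c)) → Option Bool, (∀ x y, S.mate x = some y → w x = w y) ∧
      ∀ c, IsGood (S.n c) (fun i => S.virt ⟨c, i⟩) (fun i => w ⟨c, i⟩) := by
  obtain ⟨f, hsymm, hf⟩ := LabelList.exists_symmetric_choice
  refine ⟨fun x => match S.mate x with
    | none => f (p x.1 x.2) .full
    | some y => f (p x.1 x.2) (p y.1 y.2), ?_, ?_⟩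
  · intro x y hxy
    simp only [hxy, S.mate_symm _ _ hxy]
    exact hsymm _ _
  · intro c
    refine hp c _ fun x => ?_
    cases h : S.mate ⟨c, x⟩ with
    | none => simpa [h] using hf _ _ (LabelList.compat_full _)
    | some y => simpa [h] using hf _ _ (hc _ _ h)

/-- Two cycles are neighbours if a matching edge joins them. -/
def Nbr (u v : κ) : Prop := ∃ x y, S.mate ⟨u, x⟩ = some ⟨v, y⟩

theorem Nbr.symm {S : CycleSystem κ} {u v : κ} (h : S.Nbr u v) : S.Nbr v u := by
  obtain ⟨x, y, hxy⟩ := h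
  exact ⟨y, x, S.mate_symm _ _ hxy⟩

end CycleSystem

/-- Distances to a set `R` that can be reached from everywhere. -/
theorem exists_depth {κ : Type*} (adj : κ → κ → Prop) (R : Set κ)
    (hR : ∀ v, ∃ u ∈ R, Relation.ReflTransGen adj v u) :
    ∃ depth : κ → ℕ, (∀ v, v ∈ R → depth v = 0) ∧
      ∀ v, v ∉ R → ∃ u, adj v u ∧ depth u < depth v := by
  let P : ℕ → κ → Prop := fun k => Nat.rec (fun v => v ∈ R) (fun _ Q v => ∃ u, adj v u ∧ Q u) k
  have hP : ∀ v, ∃ k, P k v := by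
    intro v
    obtain ⟨u, hu, h⟩ := hR v
    induction h using Relation.ReflTransGen.head_induction_on with
    | refl => exact ⟨0, hu⟩
    | head h _ ih =>
      obtain ⟨k, hk⟩ := ih
      exact ⟨k + 1, _, h, hk⟩
  refine ⟨fun v => sInf {k | P k v}, fun v hv => Nat.sInf_eq_zero.2 (Or.inl hv), fun v hv => ?_⟩
  have hspec : P (sInf {k | P k v}) v := Nat.sInf_mem (s := {k | P k v}) (hP v)
  cases h : sInf {k | P k v} with
  | zero => rw [h] at hspec; exact absurd hspec hv
  | succ k =>
    rw [h] at hspec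
    obtain ⟨u, hu, hk⟩ := hspec
    refine ⟨u, hu, ?_⟩
    have : sInf {k | P k u} ≤ k := Nat.sInf_le hk
    simp only [h]
    omega

/-- Signs prescribed on the roots of a rooted forest and by their changes along its edges. -/
theorem exists_signs {κ : Type*} (depth : κ → ℕ) (R : Set κ) (par : κ → κ)
    (hpar : ∀ v, v ∉ R → depth (par v) < depth v) (g0 : κ → Bool) (ch : κ → Bool) :
    ∃ g : κ → Bool, (∀ v, v ∈ R → g v = g0 v) ∧ ∀ v, v ∉ R → g v = (g (par v) ^^ ch v) := by
  classical
  have key : ∀ N : ℕ, ∃ g : κ → Bool, (∀ v, v ∈ R → g v = g0 v) ∧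
      ∀ v, v ∉ R → depth v < N → g v = (g (par v) ^^ ch v) := by
    intro N
    induction N with
    | zero => exact ⟨g0, fun _ _ => rfl, by simp⟩
    | succ N ih =>
      obtain ⟨g, h1, h2⟩ := ih
      refine ⟨fun v => if v ∈ R then g0 v else if depth v < N then g v else g (par v) ^^ ch v,
        fun v hv => by simp [hv], fun v hv hN => ?_⟩
      have hp := hpar v hv
      have hgp : (if par v ∈ R then g0 (par v) else if depth (par v) < N then g (par v)
          else g (par (par v)) ^^ ch (par v)) = g (par v) := by
        by_cases h : par v ∈ R
        · simp [h, h1 _ h]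
        · simp [h, show depth (par v) < N by omega]
      simp only [hgp, hv, if_false]
      split_ifs with h
      · exact h2 v hv h
      · rfl
  choose g h1 h2 using key
  have hcons : ∀ N v M, depth v < N → depth v < M → g N v = g M v := by
    intro N v
    induction hd : depth v using Nat.strong_induction_on generalizing v with
    | _ d ih =>
      intro M hN hM
      by_cases hv : v ∈ R
      · rw [h1 _ _ hv, h1 _ _ hv]
      · have := hpar v hv
        rw [h2 N v hv (by omega), h2 M v hv (by omega),
          ih _ (by omega) _ rfl M (by omega) (by omega)]
  refine ⟨fun v => g (depth v + 1) v, fun v hv => h1 _ v hv, fun v hv => ?_⟩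
  have := hpar v hv
  dsimp only
  rw [h2 _ v hv (by omega), hcons (depth v + 1) (par v) (depth (par v) + 1) (by omega) (by omega)]

namespace CycleSystem

variable {κ : Type*} (S : CycleSystem κ)

/-- A set of cycles that contains all neighbours of its elements is everything, unless it contains
a root. -/
theorem eq_univ_of_closed (A : Set κ) (hA : A.Nonempty) (hroot : ∀ v ∈ A, ¬ S.IsRoot v)
    (hcl : ∀ u ∈ A, ∀ v, S.Nbr u v → v ∈ A) : A = Set.univ := by
  refine S.connected A hA fun x hx => ?_
  cases h : S.mate x with
  | none => exact absurd ⟨x.2, Or.inl h⟩ (hroot _ hx)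
  | some y => exact ⟨y, rfl, hcl _ hx _ ⟨x.2, y.2, h⟩⟩

/-- If there is a root, then all cycles can be treated in the order of decreasing distance from
the roots. -/
theorem exists_labels_of_root [Finite κ] (hroot : ∃ v, S.IsRoot v) :
    ∃ w : (Σ c, ZMod (S.n c)) → Option Bool, (∀ x y, S.mate x = some y → w x = w y) ∧
      ∀ c, IsGood (S.n c) (fun i => S.virt ⟨c, i⟩) (fun i => w ⟨c, i⟩) := by
  classical
  have hreach : ∀ v, ∃ u ∈ {u | S.IsRoot u}, Relation.ReflTransGen S.Nbr v u := by
    by_contra hcon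
    push Not at hcon
    obtain ⟨v, hv⟩ := hcon
    obtain ⟨u, hu⟩ := hroot
    have := S.eq_univ_of_closed {u | Relation.ReflTransGen S.Nbr v u}
      ⟨v, Relation.ReflTransGen.refl⟩ (fun u hu hr => hv u hr hu) (fun a ha b hab => ha.tail hab)
    have hmem := Set.mem_univ u
    rw [← this] at hmem
    exact hv u hu hmem
  obtain ⟨depth, -, hdepth⟩ := exists_depth S.Nbr {u | S.IsRoot u} hreach
  have hpar : ∀ v, ¬ S.IsRoot v → ∃ z y, S.mate ⟨v, z⟩ = some y ∧ depth y.1 < depth v := by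
    intro v hv
    obtain ⟨u, ⟨x, y, hxy⟩, hlt⟩ := hdepth v hv
    exact ⟨x, ⟨u, y⟩, hxy, hlt⟩
  -- a winning relative pattern at each cycle that is not a root, with a soft place towards the roots
  have hn3 : ∀ v, ¬ S.IsRoot v → 5 ≤ S.n v := by
    intro v hv
    refine S.five_le fun h3 => ?_
    obtain ⟨i, hi, -⟩ := S.triangle v h3
    exact hv ⟨i, Or.inl (S.mate_of_virt _ hi)⟩
  have : Inhabited (Σ c, ZMod (S.n c)) := ⟨⟨hroot.choose, 0⟩⟩
  let z : ∀ v, ZMod (S.n v) := fun v => if h : ¬ S.IsRoot v then (hpar v h).choose else 0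
  let m : κ → Σ c, ZMod (S.n c) := fun v => (S.mate ⟨v, z v⟩).getD default
  have hz : ∀ v, ¬ S.IsRoot v → S.mate ⟨v, z v⟩ = some (m v) ∧ depth (m v).1 < depth v := by
    intro v hv
    obtain ⟨y, h1, h2⟩ := (hpar v hv).choose_spec
    have hzv : z v = (hpar v hv).choose := by simp [z, hv]
    have : S.mate ⟨v, z v⟩ = some y := by rw [hzv]; exact h1
    simp only [m, this, Option.getD_some]
    exact ⟨trivial, h2⟩
  have hpat : ∀ v, ∃ pat : ZMod (S.n v) → Bool,
      (S.IsRoot v → S.FreeWins v pat) ∧ (¬ S.IsRoot v → WinsRel (S.n v) (z v) pat) := by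
    intro v
    by_cases hv : S.IsRoot v
    · obtain ⟨e, he⟩ := S.exists_freeWins hv
      exact ⟨e, fun _ => he, fun h => absurd hv h⟩
    · obtain ⟨pat, hp, -⟩ := exists_winsRel_near (S.odd v) (hn3 v hv) (z v)
      exact ⟨pat, fun h => absurd h hv, fun _ => hp⟩
  choose pat hpat1 hpat2 using hpat
  obtain ⟨g, hg0, hg⟩ := exists_signs depth {u | S.IsRoot u} (fun v => (m v).1)
    (fun v hv => (hz v hv).2) (fun _ => false) (fun v => pat (m v).1 (m v).2)
  refine (S.exists_lists ∅ depth (fun _ => .full) (fun x => g x.1 ^^ pat x.1 x.2)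
    (by simp) (fun v _ => ?_)).elim ?_
  swap
  · rintro p ⟨hp, hc⟩
    exact S.exists_labels_of_lists p (fun v => hp v (by simp))
      (fun x y h => (hc x y h (by simp)).1 (by simp))
  by_cases hv : S.IsRoot v
  · left
    simpa [hg0 v hv] using hpat1 v hv
  · right
    refine ⟨hn3 v hv, fun x y h => hv ⟨x, Or.inr ⟨y, h⟩⟩, z v, m v, (hz v hv).1,
      (hpat2 v hv).2 (g v), Or.inl ⟨by simp, (hz v hv).2, ?_⟩⟩
    simp only [(hpat2 v hv).1, Bool.xor_false]
    exact (hg v hv).symm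

end CycleSystem

/-! ### Patterns on the cycles of a system -/

namespace CycleSystem

variable {κ : Type*} (S : CycleSystem κ)

/-- The places of all cycles. -/
abbrev Place := Σ c, ZMod (S.n c)

/-- There are labels of the matching edges that are good on all cycles. -/
def HasLabels : Prop :=
  ∃ w : S.Place → Option Bool, (∀ x y, S.mate x = some y → w x = w y) ∧
    ∀ c, IsGood (S.n c) (fun i => S.virt ⟨c, i⟩) (fun i => w ⟨c, i⟩)

/-- The restriction of `P` to the cycle of the place `z` is a relative pattern that wins with the
soft place `z`. -/
def PlaceWins (z : S.Place) (P : S.Place → Bool) : Prop :=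
  WinsRel (S.n z.1) z.2 fun x => P ⟨z.1, x⟩

/-- The sign relation `signChange` between two places of the same cycle. -/
noncomputable def change (z b : S.Place) : Bool :=
  open Classical in if h : b.1 = z.1 then signChange (S.n z.1) z.2 (h ▸ b.2) else false

/-- Two places of the same cycle that are far apart. -/
def Far (z b : S.Place) : Prop := ∃ h : b.1 = z.1, IsFar (S.n z.1) z.2 (h ▸ b.2)

/-- The relation of the demands at `b` and `c` can be prescribed, with `z` as the soft place. -/
def Flexible (z b c : S.Place) : Prop := ∀ s, ∃ P, S.PlaceWins z P ∧ (P b ^^ P c) = s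

@[simp] theorem change_mk (c : κ) (x y : ZMod (S.n c)) :
    S.change ⟨c, x⟩ ⟨c, y⟩ = signChange (S.n c) x y := by simp [change]

@[simp] theorem far_mk (c : κ) (x y : ZMod (S.n c)) :
    S.Far ⟨c, x⟩ ⟨c, y⟩ ↔ IsFar (S.n c) x y := by simp [Far]

instance (c : κ) : NeZero (S.n c) := ⟨by have := S.three_le c; omega⟩

theorem change_comm (z b : S.Place) : S.change z b = S.change b z := by
  obtain ⟨c, x⟩ := z
  obtain ⟨c', y⟩ := b
  by_cases h : c' = c
  · subst h
    simp [signChange_comm]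
  · simp [change, h, Ne.symm h]

theorem exists_place_pattern (c : κ) (pat : ZMod (S.n c) → Bool) :
    ∃ P : S.Place → Bool, ∀ x, P ⟨c, x⟩ = pat x := by
  classical
  exact ⟨fun y => if h : y.1 = c then pat (h ▸ y.2) else false, fun x => by simp⟩

theorem exists_placeWins_near {z : S.Place} (hn : 5 ≤ S.n z.1) :
    ∃ P, S.PlaceWins z P ∧ ∀ b, b.1 = z.1 → b ≠ z → ¬ S.Far z b → P b = S.change z b := by
  obtain ⟨c, z⟩ := z
  obtain ⟨pat, hp, h⟩ := exists_winsRel_near (S.odd c) hn z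
  obtain ⟨P, hP⟩ := S.exists_place_pattern c pat
  refine ⟨P, by simpa only [PlaceWins, hP] using hp, ?_⟩
  rintro ⟨c', b⟩ rfl hb hfar
  rw [hP, change_mk]
  exact h b (by simpa using hb) (by simpa using hfar)

theorem exists_placeWins_single {z b : S.Place} (hn : 5 ≤ S.n z.1) (hb : b.1 = z.1) (hne : b ≠ z) :
    ∃ P, S.PlaceWins z P ∧ P b = S.change z b := by
  obtain ⟨c, z⟩ := z
  obtain ⟨c', b⟩ := b
  obtain rfl : c' = c := hb
  obtain ⟨pat, hp, h⟩ := exists_winsRel_single (S.odd c') hn z b (by simpa using hne)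
  obtain ⟨P, hP⟩ := S.exists_place_pattern c' pat
  exact ⟨P, by simpa only [PlaceWins, hP] using hp, by rw [hP, change_mk, h]⟩

theorem flexible_of_isFlexible {c : κ} {u v w : ZMod (S.n c)} (h : IsFlexible (S.n c) u v w) :
    S.Flexible ⟨c, u⟩ ⟨c, v⟩ ⟨c, w⟩ := by
  intro s
  obtain ⟨pat, hp, e⟩ := h s
  obtain ⟨P, hP⟩ := S.exists_place_pattern c pat
  exact ⟨P, by simpa only [PlaceWins, hP] using hp, by rw [hP, hP, e]⟩

theorem flexible_of_near_of_far {z b c : S.Place} (hn : 5 ≤ S.n z.1) (hb : b.1 = z.1)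
    (hne : b ≠ z) (hnear : ¬ S.Far z b) (hfar : S.Far z c) : S.Flexible z b c := by
  obtain ⟨u, z⟩ := z
  obtain ⟨u', b⟩ := b
  obtain rfl : u' = u := hb
  obtain ⟨hc, -⟩ := id hfar
  obtain ⟨u'', c⟩ := c
  obtain rfl : u'' = u' := hc
  exact S.flexible_of_isFlexible (isFlexible_of_near_of_far (S.odd _) hn (by simpa using hne)
    (by simpa using hnear) (by simpa using hfar))

theorem flexible_or_flexible_or_near {u v w : S.Place} (hn : 7 ≤ S.n u.1) (hv : v.1 = u.1)
    (hw : w.1 = u.1) (huv : v ≠ u) (huw : w ≠ u) (hvw : v ≠ w) :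
    S.Flexible u v w ∨ S.Flexible w v u ∨ (¬ S.Far u v ∧ ¬ S.Far u w ∧ ¬ S.Far v w) := by
  obtain ⟨c, u⟩ := u
  obtain ⟨c', v⟩ := v
  obtain rfl : c' = c := hv
  obtain ⟨c'', w⟩ := w
  obtain rfl : c'' = c' := hw
  rcases isFlexible_or_isFlexible_or_near (S.odd _) hn (u := u) (v := v) (w := w)
    (by simpa using huv) (by simpa using huw) (by simpa using hvw) with h | h | h
  · exact Or.inl (S.flexible_of_isFlexible h)
  · exact Or.inr (Or.inl (S.flexible_of_isFlexible h))
  · exact Or.inr (Or.inr (by simpa using h))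

theorem not_far_of_eq_five {z b : S.Place} (hn : S.n z.1 = 5) : ¬ S.Far z b := by
  rintro ⟨h, h'⟩
  unfold IsFar at h'
  omega

/-! ### Systems without roots: a static cycle at the end of a longest path -/

/-- A path in the graph whose vertices are the cycles of a system without roots, with its edges
`up k`–`dn (k + 1)`, such that all neighbours of its first vertex `v 0` belong to it. The place
`i` of `v 0` is joined to the place `Y i` of the cycle at height `ht i`. -/
structure RootPath where
  noRoot : ∀ c, ¬ S.IsRoot c
  /-- The last index of the path. -/
  m : ℕ
  /-- The vertices of the path. -/
  v : ℕ → κ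
  inj : ∀ i j, i ≤ m → j ≤ m → v i = v j → i = j
  /-- The place at which the path leaves a vertex. -/
  up : ℕ → S.Place
  /-- The place at which the path enters a vertex. -/
  dn : ℕ → S.Place
  up_fst : ∀ k, 1 ≤ k → k < m → (up k).1 = v k
  dn_fst : ∀ k, 1 ≤ k → k < m → (dn (k + 1)).1 = v (k + 1)
  mate_up : ∀ k, 1 ≤ k → k < m → S.mate (up k) = some (dn (k + 1))
  /-- The mates of the places of the first vertex. -/
  Y : ZMod (S.n (v 0)) → S.Place
  /-- The indices of the neighbours of the first vertex. -/
  ht : ZMod (S.n (v 0)) → ℕ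
  mate_zero : ∀ i, S.mate ⟨v 0, i⟩ = some (Y i)
  Y_fst : ∀ i, (Y i).1 = v (ht i)
  one_le_ht : ∀ i, 1 ≤ ht i
  ht_le : ∀ i, ht i ≤ m

variable {S}

theorem five_le_of_noRoot (h : ∀ c, ¬ S.IsRoot c) (c : κ) : 5 ≤ S.n c := by
  refine S.five_le fun h3 => ?_
  obtain ⟨i, hi, -⟩ := S.triangle c h3
  exact h c ⟨i, Or.inl (S.mate_of_virt _ hi)⟩

theorem exists_mate_of_noRoot (h : ∀ c, ¬ S.IsRoot c) (x : S.Place) :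
    ∃ y, S.mate x = some y ∧ y.1 ≠ x.1 := by
  cases hx : S.mate x with
  | none => exact absurd ⟨x.2, Or.inl hx⟩ (h x.1)
  | some y =>
    refine ⟨y, rfl, fun hy => ?_⟩
    obtain ⟨c, x⟩ := x
    obtain ⟨c', y⟩ := y
    obtain rfl : c' = c := hy
    exact h c' ⟨x, Or.inr ⟨y, hx⟩⟩

/-- A longest path is a `RootPath`. -/
theorem exists_rootPath [Finite κ] [Nonempty κ] (h : ∀ c, ¬ S.IsRoot c) : Nonempty S.RootPath := by
  classical
  let Q : ℕ → Prop := fun m => ∃ v : ℕ → κ, (∀ i j, i ≤ m → j ≤ m → v i = v j → i = j) ∧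
    ∀ k, k < m → S.Nbr (v k) (v (k + 1))
  have hbound : ∀ m, Q m → m ≤ Nat.card κ := by
    rintro m ⟨v, hv, -⟩
    have : Function.Injective fun i : Fin m => v i := fun i j hij =>
      Fin.ext (hv i j (by omega) (by omega) hij)
    simpa using Nat.card_le_card_of_injective _ this
  have h0 : Q 0 := ⟨fun _ => Classical.arbitrary κ, fun i j hi hj _ => by omega, by simp⟩
  obtain ⟨m, ⟨v, hinj, hadj⟩, hmax⟩ : ∃ m, Q m ∧ ∀ m', Q m' → m' ≤ m :=
    ⟨Nat.findGreatest Q (Nat.card κ), Nat.findGreatest_spec (Nat.zero_le _) h0,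
      fun m' hm' => Nat.le_findGreatest (hbound m' hm') hm'⟩
  have hnbr : ∀ u, S.Nbr (v 0) u → ∃ k, k ≤ m ∧ v k = u := by
    intro u hu
    by_contra hcon
    push Not at hcon
    have : Q (m + 1) := by
      refine ⟨fun k => Nat.casesOn k u v, ?_, ?_⟩
      · intro i j hi hj hij
        cases i with
        | zero =>
          cases j with
          | zero => rfl
          | succ j => exact absurd hij.symm (hcon j (by omega))
        | succ i =>
          cases j with
          | zero => exact absurd hij (hcon i (by omega))
          | succ j => rw [hinj i j (by omega) (by omega) hij]
      · intro k hk
        cases k with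
        | zero => exact hu.symm
        | succ k => exact hadj k (by omega)
    have := hmax _ this
    omega
  have hed : ∀ k, ∃ x y : S.Place, k < m → x.1 = v k ∧ y.1 = v (k + 1) ∧ S.mate x = some y := by
    intro k
    by_cases hk : k < m
    · obtain ⟨x, y, hxy⟩ := hadj k hk
      exact ⟨⟨_, x⟩, ⟨_, y⟩, fun _ => ⟨rfl, rfl, hxy⟩⟩
    · exact ⟨⟨v 0, 0⟩, ⟨v 0, 0⟩, fun h => absurd h hk⟩
  choose up dn hud using hed
  have hY : ∀ i, ∃ (y : S.Place) (k : ℕ), S.mate ⟨v 0, i⟩ = some y ∧ y.1 = v k ∧ 1 ≤ k ∧ k ≤ m := by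
    intro i
    obtain ⟨y, hy, hne⟩ := exists_mate_of_noRoot h ⟨v 0, i⟩
    obtain ⟨k, hk, hvk⟩ := hnbr y.1 ⟨i, y.2, hy⟩
    refine ⟨y, k, hy, hvk.symm, ?_, hk⟩
    rcases Nat.eq_zero_or_pos k with rfl | hpos
    · exact absurd hvk.symm hne
    · exact hpos
  choose Y ht hY1 hY2 hY3 hY4 using hY
  exact ⟨⟨h, m, v, hinj, up, fun k => dn (k - 1), fun k _ hk => (hud k hk).1,
    fun k _ hk => (hud k hk).2.1, fun k _ hk => (hud k hk).2.2, Y, ht, hY1, hY2, hY3, hY4⟩⟩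

namespace RootPath

variable (D : S.RootPath)

/-- The static strategy: the lists at `v 0` are those of a window, and all other cycles are rooted at
neighbours of full places of `v 0`. The two hard places of the window prescribe two demands. -/
theorem hasLabels_of_static [Finite κ] (a d : ZMod (S.n (D.v 0))) (hd : d = 1 ∨ d = -1) (s : Bool)
    (Z W : ℕ → S.Place) (nx δ : ℕ → ℕ) (P : ℕ → S.Place → Bool) (g : ℕ → Bool)
    (hZ : ∀ k, 1 ≤ k → k ≤ D.m → (Z k).1 = D.v k ∧ S.PlaceWins (Z k) (P k) ∧
      ((∃ f, Z k = D.Y f ∧ windowLists (S.n (D.v 0)) a d s f = .full) ∨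
       (1 ≤ nx k ∧ nx k ≤ D.m ∧ S.mate (Z k) = some (W k) ∧ (W k).1 = D.v (nx k) ∧
        δ (nx k) < δ k ∧ g k = (g (nx k) ^^ P (nx k) (W k)))))
    (h0 : (g (D.ht a) ^^ P (D.ht a) (D.Y a)) = s)
    (h1 : (g (D.ht (a + d)) ^^ P (D.ht (a + d)) (D.Y (a + d))) = s) : S.HasLabels := by
  classical
  have hn := five_le_of_noRoot D.noRoot
  -- cycles outside of the path are treated according to their distance from it
  let R : Set κ := {c | ∃ k, k ≤ D.m ∧ D.v k = c}
  have hreach : ∀ c, ∃ u ∈ R, Relation.ReflTransGen S.Nbr c u := by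
    intro c
    have := S.eq_univ_of_closed {u | Relation.ReflTransGen S.Nbr c u} ⟨c, .refl⟩
      (fun u _ => D.noRoot u) (fun a ha b hab => ha.tail hab)
    refine ⟨D.v 0, ⟨0, Nat.zero_le _, rfl⟩, ?_⟩
    have hm := Set.mem_univ (D.v 0)
    rwa [← this] at hm
  obtain ⟨dist, -, hdist⟩ := exists_depth S.Nbr R hreach
  obtain ⟨M, hM⟩ : ∃ M, ∀ k, k ≤ D.m → δ k ≤ M :=
    ⟨(Finset.range (D.m + 1)).sup δ, fun k hk =>
      Finset.le_sup (f := δ) (Finset.mem_range.2 (by omega))⟩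
  have hidx : ∀ c, ∃ k, c ∈ R → k ≤ D.m ∧ D.v k = c := by
    intro c
    by_cases hc : c ∈ R
    · obtain ⟨k, hk⟩ := hc
      exact ⟨k, fun _ => hk⟩
    · exact ⟨0, fun h => absurd h hc⟩
  choose idx hidx using hidx
  have hidxv : ∀ k, k ≤ D.m → idx (D.v k) = k := fun k hk =>
    D.inj _ _ (hidx _ ⟨k, hk, rfl⟩).1 hk (hidx _ ⟨k, hk, rfl⟩).2
  let depth : κ → ℕ := fun c => if c ∈ R then δ (idx c) else M + 1 + dist c
  have hoff : ∀ c, ∃ (z w : S.Place) (Q : S.Place → Bool), c ∉ R → z.1 = c ∧ S.mate z = some w ∧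
      S.PlaceWins z Q ∧ depth w.1 < depth c ∧ w.1 ≠ D.v 0 := by
    intro c
    by_cases hc : c ∈ R
    · exact ⟨⟨c, 0⟩, ⟨c, 0⟩, fun _ => false, fun h => absurd hc h⟩
    · obtain ⟨u, ⟨x, y, hxy⟩, hlt⟩ := hdist c hc
      obtain ⟨Q, hQ, -⟩ := S.exists_placeWins_near (z := ⟨c, x⟩) (hn c)
      refine ⟨⟨c, x⟩, ⟨u, y⟩, Q, fun _ => ⟨rfl, hxy, hQ, ?_, ?_⟩⟩
      · simp only [depth, hc, if_false]
        split_ifs with hu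
        · have := hM _ (hidx u hu).1
          omega
        · omega
      · rintro rfl
        -- all neighbours of `v 0` are on the path
        have := D.mate_zero y
        rw [S.mate_symm _ _ hxy] at this
        refine hc ⟨D.ht y, D.ht_le y, ?_⟩
        rw [← D.Y_fst y, ← Option.some.inj this]
  choose zo wo Qo hoff using hoff
  let z : κ → S.Place := fun c => if c ∈ R then Z (idx c) else zo c
  let w : κ → S.Place := fun c => if c ∈ R then W (idx c) else wo c
  let PP : κ → S.Place → Bool := fun c => if c ∈ R then P (idx c) else Qo c
  obtain ⟨gg, hg1, hg2⟩ := exists_signs depth R (fun c => (wo c).1)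
    (fun c hc => (hoff c hc).2.2.2.1) (fun c => g (idx c)) (fun c => PP (wo c).1 (wo c))
  have hggv : ∀ k, k ≤ D.m → gg (D.v k) = g k := fun k hk => by
    rw [hg1 _ ⟨k, hk, rfl⟩, hidxv k hk]
  have hPPv : ∀ k, k ≤ D.m → PP (D.v k) = P k := fun k hk => by
    have : D.v k ∈ R := ⟨k, hk, rfl⟩
    simp only [PP, this, if_true, hidxv k hk]
  let E : S.Place → Bool := fun x => gg x.1 ^^ PP x.1 x
  have hEY : ∀ i, E (D.Y i) = (g (D.ht i) ^^ P (D.ht i) (D.Y i)) := fun i => by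
    simp only [E]
    rw [D.Y_fst, hggv _ (D.ht_le i), hPPv _ (D.ht_le i)]
  let B : S.Place → LabelList := fun y =>
    if h : y.1 = D.v 0 then windowLists (S.n (D.v 0)) a d s (h ▸ y.2) else .full
  have hB0 : ∀ i, B ⟨D.v 0, i⟩ = windowLists (S.n (D.v 0)) a d s i := fun i => by simp [B]
  have hmateY : ∀ i, S.mate (D.Y i) = some ⟨D.v 0, i⟩ := fun i =>
    S.mate_symm _ _ (D.mate_zero i)
  refine (S.exists_lists {D.v 0} depth B E ?_ ?_).elim ?_
  · rintro x ⟨c, i⟩ hxy - (rfl : c = D.v 0)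
    have hx : x = D.Y i := by
      have := S.mate_symm _ _ hxy
      rw [D.mate_zero] at this
      exact (Option.some.inj this).symm
    rw [hB0, hx]
    unfold windowLists
    split_ifs with hi
    · rcases hi with rfl | rfl
      · rw [hEY, h0]; simp
      · rw [hEY, h1]; simp
    · simp
    · simp
  · intro c hc
    right
    refine ⟨hn c, fun x y hxy => D.noRoot c ⟨x, Or.inr ⟨y, hxy⟩⟩, ?_⟩
    have wins : ∀ (z : S.Place), z.1 = c → S.PlaceWins z (PP c) →
        ∃ z', (⟨c, z'⟩ : S.Place) = z ∧ Wins (S.n c) z' (fun x => E ⟨c, x⟩) ∧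
          E z = gg c := by
      rintro ⟨c', z'⟩ rfl hz
      refine ⟨z', rfl, hz.2 (gg c'), ?_⟩
      simp only [E]
      have := hz.1
      simp only at this
      simp [this]
    by_cases hcR : c ∈ R
    · obtain ⟨k, hk, rfl⟩ := hcR
      have hk1 : 1 ≤ k := by
        rcases Nat.eq_zero_or_pos k with rfl | h
        · exact absurd rfl hc
        · exact h
      obtain ⟨hzc, hzw, hcase⟩ := hZ k hk1 hk
      obtain ⟨z', hz', hw', hE'⟩ := wins (Z k) hzc (by rw [hPPv k hk]; exact hzw)
      rcases hcase with ⟨f, hf, hfull⟩ | ⟨n1, n2, hm, hWv, hδ, hgk⟩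
      · refine ⟨z', ⟨D.v 0, f⟩, ?_, hw', Or.inr ⟨rfl, Or.inl ?_⟩⟩
        · rw [hz', hf, hmateY]
        · rw [hB0, hfull]
      · refine ⟨z', W k, by rw [hz', hm], hw', Or.inl ⟨?_, ?_, ?_⟩⟩
        · rw [hWv]
          intro h
          have := D.inj _ _ n2 (Nat.zero_le _) h
          omega
        · have m1 : D.v (nx k) ∈ R := ⟨_, n2, rfl⟩
          have m2 : D.v k ∈ R := ⟨_, hk, rfl⟩
          simp only [hWv, depth, m1, m2, if_true, hidxv _ n2, hidxv _ hk]
          exact hδ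
        · rw [hz', hE', hggv k hk, hgk]
          simp only [E]
          rw [hWv, hggv _ n2, hPPv _ n2]
    · obtain ⟨h1, h2, h3, h4, h5⟩ := hoff c hcR
      obtain ⟨z', hz', hw', hE'⟩ := wins (zo c) h1 (by simpa [PP, hcR] using h3)
      refine ⟨z', wo c, by rw [hz', h2], hw', Or.inl ⟨h5, h4, ?_⟩⟩
      rw [hz', hE', hg2 c hcR]
  · rintro p ⟨hp, hpc⟩
    let q : ∀ c, ZMod (S.n c) → LabelList := fun c x => if c = D.v 0 then B ⟨c, x⟩ else p c x
    have hq0 : q (D.v 0) = windowLists (S.n (D.v 0)) a d s := by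
      funext x
      simp [q, hB0]
    have hq : ∀ c, c ≠ D.v 0 → q c = p c := fun c hc => by
      funext x
      simp [q, hc]
    refine S.exists_labels_of_lists q (fun c => ?_) ?_
    · by_cases hc : c = D.v 0
      · subst hc
        rw [hq0]
        exact S.good_window (hn _) a d s hd
      · rw [hq c hc]
        exact hp c hc
    · have key : ∀ x y, S.mate x = some y → x.1 ≠ D.v 0 → (q x.1 x.2).Compat (q y.1 y.2) := by
        rintro x ⟨c, y⟩ hxy hx
        obtain ⟨k1, k2⟩ := hpc x ⟨c, y⟩ hxy hx
        rw [hq _ hx]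
        by_cases hc : c = D.v 0
        · subst hc
          have := k2 rfl
          rw [hB0] at this
          simpa only [hq0] using this
        · simpa only [hq c hc] using k1 hc
      intro x y hxy
      by_cases hx : x.1 = D.v 0
      · by_cases hy : y.1 = D.v 0
        · obtain ⟨y', hy', hne⟩ := exists_mate_of_noRoot D.noRoot x
          rw [hxy] at hy'
          obtain rfl := Option.some.inj hy'
          exact absurd (hy.trans hx.symm) hne
        · exact (key y x (S.mate_symm _ _ hxy) hy).symm
      · exact key x y hxy hx

end RootPath

end CycleSystem

/-! ### Trees of demands along the path -/

namespace CycleSystem.RootPath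

variable {κ : Type*} {S : CycleSystem κ} (D : S.RootPath)

theorem mate_dn {k : ℕ} (h1 : 1 ≤ k) (hk : k < D.m) : S.mate (D.dn (k + 1)) = some (D.up k) :=
  S.mate_symm _ _ (D.mate_up k h1 hk)

theorem mate_Y (i) : S.mate (D.Y i) = some ⟨D.v 0, i⟩ := S.mate_symm _ _ (D.mate_zero i)

theorem Y_injective {i j} (h : D.Y i = D.Y j) : i = j := by
  have := D.mate_Y i
  rw [h, D.mate_Y j] at this
  simpa using this.symm

theorem Y_ne_up (i) {k : ℕ} (h1 : 1 ≤ k) (hk : k < D.m) : D.Y i ≠ D.up k := by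
  intro h
  have := D.mate_Y i
  rw [h, D.mate_up k h1 hk] at this
  have h2 := D.dn_fst k h1 hk
  rw [Option.some.inj this] at h2
  have := D.inj _ _ (Nat.zero_le _) (by omega) h2
  omega

theorem Y_ne_dn (i) {k : ℕ} (h1 : 1 ≤ k) (hk : k < D.m) : D.Y i ≠ D.dn (k + 1) := by
  intro h
  have := D.mate_Y i
  rw [h, D.mate_dn h1 hk] at this
  have h2 := D.up_fst k h1 hk
  rw [Option.some.inj this] at h2
  have := D.inj _ _ (Nat.zero_le _) (by omega) h2
  omega

theorem up_ne_dn {k : ℕ} (h1 : 1 ≤ k) (hk : k + 1 < D.m) : D.up (k + 1) ≠ D.dn (k + 1) := by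
  intro h
  have := D.mate_up (k + 1) (by omega) hk
  rw [h, D.mate_dn h1 (by omega)] at this
  have h2 := D.up_fst k h1 (by omega)
  rw [Option.some.inj this, D.dn_fst (k + 1) (by omega) hk] at h2
  have := D.inj _ _ (by omega) (by omega) h2
  omega

/-- The soft place of the `k`-th cycle of the path, if it belongs to the tree rooted at the
neighbour of the place `f k`. -/
def soft (f : ℕ → ZMod (S.n (D.v 0))) (k : ℕ) : S.Place :=
  if k < D.ht (f k) then D.up k else if k = D.ht (f k) then D.Y (f k) else D.dn k

theorem soft_fst {f : ℕ → ZMod (S.n (D.v 0))} {k : ℕ} (h1 : 1 ≤ k) (hk : k ≤ D.m) :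
    (D.soft f k).1 = D.v k := by
  have h2 := D.one_le_ht (f k)
  have h3 := D.ht_le (f k)
  unfold soft
  split_ifs with h h'
  · exact D.up_fst k h1 (by omega)
  · rw [D.Y_fst, ← h']
  · obtain ⟨k, rfl⟩ : ∃ j, k = j + 1 := ⟨k - 1, by omega⟩
    exact D.dn_fst k (by omega) (by omega)

/-- The static strategy in the case that the `k`-th cycle of the path belongs to the tree rooted at the
neighbour of the full place `f k`, and these trees are intervals of the path. -/
theorem hasLabels_of_roots [Finite κ] (a d : ZMod (S.n (D.v 0))) (hd : d = 1 ∨ d = -1) (s : Bool)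
    (f : ℕ → ZMod (S.n (D.v 0)))
    (hfull : ∀ k, 1 ≤ k → k ≤ D.m → windowLists (S.n (D.v 0)) a d s (f k) = .full)
    (hup : ∀ k, 1 ≤ k → k < D.ht (f k) → f (k + 1) = f k)
    (hdn : ∀ k, k ≤ D.m → D.ht (f k) < k → f (k - 1) = f k)
    (P : ℕ → S.Place → Bool) (hP : ∀ k, 1 ≤ k → k ≤ D.m → S.PlaceWins (D.soft f k) (P k))
    (g : ℕ → Bool) (hgup : ∀ k, 1 ≤ k → k < D.ht (f k) → g k = (g (k + 1) ^^ P (k + 1) (D.dn (k + 1))))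
    (hgdn : ∀ k, k ≤ D.m → D.ht (f k) < k → g k = (g (k - 1) ^^ P (k - 1) (D.up (k - 1))))
    (h0 : (g (D.ht a) ^^ P (D.ht a) (D.Y a)) = s)
    (h1 : (g (D.ht (a + d)) ^^ P (D.ht (a + d)) (D.Y (a + d))) = s) : S.HasLabels := by
  refine D.hasLabels_of_static a d hd s (D.soft f)
    (fun k => if k < D.ht (f k) then D.dn (k + 1) else D.up (k - 1))
    (fun k => if k < D.ht (f k) then k + 1 else k - 1)
    (fun k => (k - D.ht (f k)) + (D.ht (f k) - k)) P g (fun k hk1 hk => ?_) h0 h1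
  refine ⟨D.soft_fst hk1 hk, hP k hk1 hk, ?_⟩
  have h2 := D.one_le_ht (f k)
  have h3 := D.ht_le (f k)
  rcases lt_trichotomy k (D.ht (f k)) with h | h | h
  · right
    simp only [h, if_true, soft]
    refine ⟨by omega, by omega, D.mate_up k hk1 (by omega), D.dn_fst k hk1 (by omega), ?_,
      hgup k hk1 h⟩
    rw [hup k hk1 h]
    omega
  · left
    refine ⟨f k, ?_, hfull k hk1 hk⟩
    simp [soft, ← h]
  · right
    have hlt : ¬ k < D.ht (f k) := by omega
    have hne : k ≠ D.ht (f k) := by omega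
    simp only [hlt, hne, if_false, soft]
    refine ⟨by omega, by omega, ?_, D.up_fst _ (by omega) (by omega), ?_, hgdn k hk h⟩
    · have := D.mate_dn (k := k - 1) (by omega) (by omega)
      rwa [show k - 1 + 1 = k by omega] at this
    · rw [hdn k hk h]
      omega

/-- The demand of a cycle at its soft place agrees with the demand of the next cycle towards the root,
which determines the signs `g` of the relative patterns `P`. -/
theorem exists_path_signs (f : ℕ → ZMod (S.n (D.v 0)))
    (hup : ∀ k, 1 ≤ k → k < D.ht (f k) → f (k + 1) = f k)
    (hdn : ∀ k, k ≤ D.m → D.ht (f k) < k → f (k - 1) = f k) (P : ℕ → S.Place → Bool) :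
    ∃ g : ℕ → Bool,
      (∀ k, 1 ≤ k → k < D.ht (f k) → g k = (g (k + 1) ^^ P (k + 1) (D.dn (k + 1)))) ∧
      (∀ k, k ≤ D.m → D.ht (f k) < k → g k = (g (k - 1) ^^ P (k - 1) (D.up (k - 1)))) := by
  obtain ⟨g, -, hg⟩ := exists_signs (fun k => (k - D.ht (f k)) + (D.ht (f k) - k))
    {k | k = D.ht (f k) ∨ k = 0 ∨ D.m < k} (fun k => if k < D.ht (f k) then k + 1 else k - 1)
    (fun k hk => by
      simp only [Set.mem_ofPred_eq, not_or, not_lt] at hk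
      by_cases h : k < D.ht (f k)
      · simp only [h, if_true]
        rw [hup k (by omega) h]
        omega
      · simp only [h, if_false]
        rw [hdn k (by omega) (by omega)]
        omega)
    (fun _ => false)
    (fun k => if k < D.ht (f k) then P (k + 1) (D.dn (k + 1)) else P (k - 1) (D.up (k - 1)))
  refine ⟨g, fun k hk h => ?_, fun k hk h => ?_⟩
  · have h3 := D.ht_le (f k)
    have := hg k (by simp only [Set.mem_ofPred_eq, not_or, not_lt]; omega)
    simpa only [h, if_true] using this
  · have h3 := D.one_le_ht (f k)
    have := hg k (by simp only [Set.mem_ofPred_eq, not_or, not_lt]; omega)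
    simpa only [show ¬ k < D.ht (f k) by omega, if_false] using this

theorem windowLists_eq_full {n : ℕ} {a d f : ZMod n} {s : Bool} (h0 : f ≠ a) (h1 : f ≠ a + d)
    (h2 : f ≠ a + 2 * d) (h3 : f ≠ a + 3 * d) : windowLists n a d s f = .full := by
  simp [windowLists, h0, h1, h2, h3]

/-- If the two hard places of a window are joined to different sides of an edge of the path, and both
sides have a root, the two demands can be met independently. -/
theorem hasLabels_of_split [Finite κ] (a d : ZMod (S.n (D.v 0))) (hd : d = 1 ∨ d = -1) (t : ℕ)
    (hsplit : D.ht a ≤ t ↔ t < D.ht (a + d)) (f₁ f₂ : ZMod (S.n (D.v 0)))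
    (h1 : D.ht f₁ ≤ t) (h2 : t < D.ht f₂)
    (hf₁ : f₁ ≠ a ∧ f₁ ≠ a + d ∧ f₁ ≠ a + 2 * d ∧ f₁ ≠ a + 3 * d)
    (hf₂ : f₂ ≠ a ∧ f₂ ≠ a + d ∧ f₂ ≠ a + 2 * d ∧ f₂ ≠ a + 3 * d) : S.HasLabels := by
  have hn := five_le_of_noRoot D.noRoot
  let f : ℕ → ZMod (S.n (D.v 0)) := fun k => if k ≤ t then f₁ else f₂
  have hfle : ∀ k, k ≤ t → f k = f₁ := fun k hk => by simp [f, hk]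
  have hfgt : ∀ k, t < k → f k = f₂ := fun k hk => by simp [f, hk]
  have hup : ∀ k, 1 ≤ k → k < D.ht (f k) → f (k + 1) = f k := by
    intro k _ hk
    rcases Nat.lt_or_ge t k with h | h
    · rw [hfgt k h, hfgt (k + 1) (by omega)]
    · rw [hfle k h] at hk ⊢
      rw [hfle (k + 1) (by omega)]
  have hdn : ∀ k, k ≤ D.m → D.ht (f k) < k → f (k - 1) = f k := by
    intro k _ hk
    rcases Nat.lt_or_ge t k with h | h
    · rw [hfgt k h] at hk ⊢
      rw [hfgt (k - 1) (by omega)]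
    · rw [hfle k h, hfle (k - 1) (by omega)]
  have hPex : ∀ k, ∃ P, 1 ≤ k → k ≤ D.m → S.PlaceWins (D.soft f k) P := by
    intro k
    obtain ⟨P, hP, -⟩ := S.exists_placeWins_near (z := D.soft f k) (hn _)
    exact ⟨P, fun _ _ => hP⟩
  choose P hP using hPex
  obtain ⟨g, hg1, hg2⟩ := D.exists_path_signs f hup hdn P
  -- adjust the signs of the two trees
  let E : ℕ → S.Place → Bool := fun k x => g k ^^ P k x
  obtain ⟨i, j, hij, hi, hj⟩ : ∃ i j, ((i = a ∧ j = a + d) ∨ (i = a + d ∧ j = a)) ∧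
      D.ht i ≤ t ∧ t < D.ht j := by
    by_cases h : D.ht a ≤ t
    · exact ⟨a, a + d, Or.inl ⟨rfl, rfl⟩, h, hsplit.1 h⟩
    · exact ⟨a + d, a, Or.inr ⟨rfl, rfl⟩, by rw [hsplit] at h; omega, by omega⟩
  let g' : ℕ → Bool := fun k => g k ^^ (if k ≤ t then E (D.ht i) (D.Y i) else E (D.ht j) (D.Y j))
  have hi' : (g' (D.ht i) ^^ P (D.ht i) (D.Y i)) = false := by
    simp only [g', hi, if_true, E]
    cases g (D.ht i) <;> cases P (D.ht i) (D.Y i) <;> rfl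
  have hj' : (g' (D.ht j) ^^ P (D.ht j) (D.Y j)) = false := by
    simp only [g', not_le.2 hj, if_false, E]
    cases g (D.ht j) <;> cases P (D.ht j) (D.Y j) <;> rfl
  have hhard : (g' (D.ht a) ^^ P (D.ht a) (D.Y a)) = false ∧
      (g' (D.ht (a + d)) ^^ P (D.ht (a + d)) (D.Y (a + d))) = false := by
    rcases hij with ⟨rfl, rfl⟩ | ⟨rfl, rfl⟩
    · exact ⟨hi', hj'⟩
    · exact ⟨hj', hi'⟩
  refine D.hasLabels_of_roots a d hd false f (fun k _ _ => ?_) hup hdn P (fun k => hP k) g'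
    (fun k hk h => ?_) (fun k hk h => ?_) hhard.1 hhard.2
  · rcases Nat.lt_or_ge t k with h | h
    · rw [hfgt k h]
      exact windowLists_eq_full hf₂.1 hf₂.2.1 hf₂.2.2.1 hf₂.2.2.2
    · rw [hfle k h]
      exact windowLists_eq_full hf₁.1 hf₁.2.1 hf₁.2.2.1 hf₁.2.2.2
  · have hiff : k ≤ t ↔ k + 1 ≤ t := by
      rcases Nat.lt_or_ge t k with h' | h'
      · omega
      · rw [hfle k h'] at h
        omega
    simp only [g', hiff]
    rw [hg1 k hk h]
    simp only [Bool.xor_assoc]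
    congr 1
    rw [Bool.xor_comm]
  · have hiff : k ≤ t ↔ k - 1 ≤ t := by
      rcases Nat.lt_or_ge t k with h' | h'
      · rw [hfgt k h'] at h
        omega
      · omega
    simp only [g', hiff]
    rw [hg2 k hk h]
    simp only [Bool.xor_assoc]
    congr 1
    rw [Bool.xor_comm]

/-- The accumulated sign changes along the path. -/
noncomputable def acc (k : ℕ) : Bool :=
  Nat.rec false (fun j b => b ^^ S.change (D.dn (j + 1)) (D.up (j + 1))) k

theorem acc_succ (k : ℕ) : D.acc (k + 1) = (D.acc k ^^ S.change (D.dn (k + 1)) (D.up (k + 1))) :=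
  rfl

/-- The place of the `M`-th cycle of the path that leads to the place `x` of the first cycle. -/
def exit (M : ℕ) (x : ZMod (S.n (D.v 0))) : S.Place :=
  if D.ht x = M then D.Y x else if D.ht x < M then D.dn M else D.up M

/-- The change of sign between `exit M x` and `Y x`. -/
noncomputable def offset (M : ℕ) (x : ZMod (S.n (D.v 0))) : Bool :=
  if D.ht x = M then false
  else if D.ht x < M then D.acc (M - 1) ^^ D.acc (D.ht x) ^^ S.change (D.up (D.ht x)) (D.Y x)
  else D.acc (D.ht x - 1) ^^ D.acc M ^^ S.change (D.dn (D.ht x)) (D.Y x)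

/-- The sign of the `k`-th cycle is determined by the one of the `M`-th cycle below it, if all patterns
between follow `change`. -/
theorem sign_up {g : ℕ → Bool} {P : ℕ → S.Place → Bool} {M k : ℕ} (hM : M < k)
    (hg : ∀ j, M < j → j ≤ k → g j = (g (j - 1) ^^ P (j - 1) (D.up (j - 1))))
    (hP : ∀ j, M < j → j < k → P j (D.up j) = S.change (D.dn j) (D.up j)) :
    g k = (g M ^^ P M (D.up M) ^^ D.acc (k - 1) ^^ D.acc M) := by
  induction k, hM using Nat.le_induction with
  | base =>
    rw [hg (M + 1) (by omega) (by omega)]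
    simp
  | succ k hk ih =>
    rw [hg (k + 1) (by omega) le_rfl, Nat.add_sub_cancel, hP k (by omega) (by omega),
      ih (fun j h h' => hg j h (by omega)) (fun j h h' => hP j h (by omega))]
    have := D.acc_succ (k - 1)
    rw [show k - 1 + 1 = k by omega] at this
    rw [this]
    simp only [Bool.xor_assoc]
    congr 3
    rw [Bool.xor_comm]

/-- The sign of the `k`-th cycle is determined by the one of the `M`-th cycle above it, if all patterns
between follow `change`. -/
theorem sign_down {g : ℕ → Bool} {P : ℕ → S.Place → Bool} {M k : ℕ} (hM : k < M)
    (hg : ∀ j, k ≤ j → j < M → g j = (g (j + 1) ^^ P (j + 1) (D.dn (j + 1))))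
    (hP : ∀ j, k < j → j < M → P j (D.dn j) = S.change (D.up j) (D.dn j)) :
    g k = (g M ^^ P M (D.dn M) ^^ D.acc (M - 1) ^^ D.acc k) := by
  obtain ⟨r, rfl⟩ : ∃ r, M = k + 1 + r := ⟨M - k - 1, by omega⟩
  clear hM
  induction r generalizing k with
  | zero =>
    rw [hg k le_rfl (by omega)]
    simp
  | succ r ih =>
    have e : k + 1 + (r + 1) = k + 1 + 1 + r := by omega
    rw [e] at hg hP ⊢
    rw [hg k le_rfl (by omega), hP (k + 1) (by omega) (by omega),
      ih (fun j h h' => hg j (by omega) h') (fun j h h' => hP j (by omega) h'), D.acc_succ k,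
      S.change_comm (D.up (k + 1))]
    generalize D.acc k = x
    generalize S.change (D.dn (k + 1)) (D.up (k + 1)) = y
    simp only [Bool.xor_assoc]
    congr 3
    cases x <;> cases y <;> rfl

/-- The demand at `Y x` is determined by the pattern at the `M`-th cycle, if all patterns between
follow `change`. -/
theorem demand_eq {g : ℕ → Bool} {P : ℕ → S.Place → Bool} {M H : ℕ} {x : ZMod (S.n (D.v 0))}
    (hg1 : ∀ k, 1 ≤ k → k < H → g k = (g (k + 1) ^^ P (k + 1) (D.dn (k + 1))))
    (hg2 : ∀ k, k ≤ D.m → H < k → g k = (g (k - 1) ^^ P (k - 1) (D.up (k - 1))))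
    (hgt : M < D.ht x → H ≤ M ∧ (∀ j, M < j → j < D.ht x → P j (D.up j) = S.change (D.dn j) (D.up j)) ∧
      P (D.ht x) (D.Y x) = S.change (D.dn (D.ht x)) (D.Y x))
    (hlt : D.ht x < M → M ≤ H ∧ (∀ j, D.ht x < j → j < M → P j (D.dn j) = S.change (D.up j) (D.dn j)) ∧
      P (D.ht x) (D.Y x) = S.change (D.up (D.ht x)) (D.Y x)) :
    (g (D.ht x) ^^ P (D.ht x) (D.Y x)) = (g M ^^ P M (D.exit M x) ^^ D.offset M x) := by
  have h1 := D.one_le_ht x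
  have h2 := D.ht_le x
  unfold exit offset
  rcases lt_trichotomy (D.ht x) M with h | h | h
  · obtain ⟨hH, hj, hY⟩ := hlt h
    simp only [h.ne, h, if_true, if_false]
    rw [D.sign_down h (fun j hj1 hj2 => hg1 j (by omega) (by omega)) hj, hY]
    simp only [Bool.xor_assoc]
  · simp [h]
  · obtain ⟨hH, hj, hY⟩ := hgt h
    simp only [h.ne', not_lt.2 h.le, if_false]
    rw [D.sign_up h (fun j hj1 hj2 => hg2 j (by omega) (by omega)) hj, hY]
    simp only [Bool.xor_assoc]

/-- The places `x` and `y` are not on the same side of the `M`-th cycle of the path. -/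
def Apart (M : ℕ) (x y : ZMod (S.n (D.v 0))) : Prop :=
  ¬ (D.ht x < M ∧ D.ht y < M) ∧ ¬ (M < D.ht x ∧ M < D.ht y)

/-- The single tree rooted at the neighbour of `f`. Only the pattern at the cycle where the paths from
`f`, `a`, `a + d` meet has to take care of both demands. -/
theorem hasLabels_of_median [Finite κ] (a d : ZMod (S.n (D.v 0))) (hd : d = 1 ∨ d = -1)
    (f : ZMod (S.n (D.v 0))) (hf : f ≠ a ∧ f ≠ a + d ∧ f ≠ a + 2 * d ∧ f ≠ a + 3 * d) (M : ℕ)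
    (hM1 : 1 ≤ M) (hMm : M ≤ D.m) (hfa : D.Apart M f a) (hfb : D.Apart M f (a + d))
    (hab : D.Apart M a (a + d)) (Q : S.Place → Bool) (hQ : S.PlaceWins (D.exit M f) Q)
    (hQab : (Q (D.exit M a) ^^ Q (D.exit M (a + d))) = (D.offset M a ^^ D.offset M (a + d))) :
    S.HasLabels := by
  classical
  have hn := five_le_of_noRoot D.noRoot
  let t : ℕ → S.Place := fun k => if k = D.ht a then D.Y a else if k = D.ht (a + d) then D.Y (a + d)
    else if M < k then D.up k else D.dn k
  have hPex : ∀ k, ∃ P, (k ≠ M → S.PlaceWins (D.soft (fun _ => f) k) P ∧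
      ((t k).1 = (D.soft (fun _ => f) k).1 → t k ≠ D.soft (fun _ => f) k →
        P (t k) = S.change (D.soft (fun _ => f) k) (t k))) ∧ (k = M → P = Q) := by
    intro k
    by_cases hk : k = M
    · exact ⟨Q, fun h => absurd hk h, fun _ => rfl⟩
    by_cases ht : (t k).1 = (D.soft (fun _ => f) k).1 ∧ t k ≠ D.soft (fun _ => f) k
    · obtain ⟨P, hP, h⟩ := S.exists_placeWins_single (hn _) ht.1 ht.2
      exact ⟨P, fun _ => ⟨hP, fun _ _ => h⟩, fun h => absurd h hk⟩
    · obtain ⟨P, hP, -⟩ := S.exists_placeWins_near (z := D.soft (fun _ => f) k) (hn _)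
      exact ⟨P, fun _ => ⟨hP, fun h h' => absurd ⟨h, h'⟩ ht⟩, fun h => absurd h hk⟩
  choose P hP hPM using hPex
  have hPMQ : P M = Q := hPM M rfl
  obtain ⟨g, hg1, hg2⟩ := D.exists_path_signs (fun _ => f) (fun _ _ _ => rfl) (fun _ _ _ => rfl) P
  unfold Apart at hfa hfb hab
  -- the patterns off the cycle `M` follow `change`
  have hsoft_dn : ∀ k, D.ht f < k → D.soft (fun _ => f) k = D.dn k := fun k hk => by
    simp [soft, not_lt.2 hk.le, hk.ne']
  have hsoft_up : ∀ k, k < D.ht f → D.soft (fun _ => f) k = D.up k := fun k hk => by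
    simp [soft, hk]
  have hta : t (D.ht a) = D.Y a := by simp [t]
  have htb : D.ht a ≠ D.ht (a + d) → t (D.ht (a + d)) = D.Y (a + d) := fun h => by
    simp [t, h.symm]
  have htok : ∀ x, D.Apart M f x → (∀ j, M < j → j < D.ht x → t j = D.up j) →
      (∀ j, D.ht x < j → j < M → t j = D.dn j) → (D.ht x ≠ M → t (D.ht x) = D.Y x) →
      (g (D.ht x) ^^ P (D.ht x) (D.Y x)) = (g M ^^ Q (D.exit M x) ^^ D.offset M x) := by
    intro x hx ht1 ht2 ht3
    unfold Apart at hx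
    have x1 := D.one_le_ht x
    have x2 := D.ht_le x
    have f1 := D.one_le_ht f
    have f2 := D.ht_le f
    rw [← hPMQ]
    refine D.demand_eq hg1 hg2 (fun hlt => ⟨by omega, fun j hj1 hj2 => ?_, ?_⟩)
      (fun hlt => ⟨by omega, fun j hj1 hj2 => ?_, ?_⟩)
    · obtain ⟨j, rfl⟩ : ∃ i, j = i + 1 := ⟨j - 1, by omega⟩
      have := (hP (j + 1) (by omega)).2
      rw [ht1 _ hj1 hj2, hsoft_dn _ (by omega)] at this
      exact this (by rw [D.up_fst _ (by omega) (by omega), D.dn_fst _ (by omega) (by omega)])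
        (D.up_ne_dn (by omega) (by omega))
    · have := (hP (D.ht x) (by omega)).2
      rw [ht3 (by omega), hsoft_dn _ (by omega)] at this
      obtain ⟨j, hj⟩ : ∃ i, D.ht x = i + 1 := ⟨D.ht x - 1, by omega⟩
      rw [hj] at this ⊢
      exact this (by rw [D.Y_fst, D.dn_fst _ (by omega) (by omega), hj])
        (D.Y_ne_dn _ (by omega) (by omega))
    · obtain ⟨j, rfl⟩ : ∃ i, j = i + 1 := ⟨j - 1, by omega⟩
      have := (hP (j + 1) (by omega)).2
      rw [ht2 _ hj1 hj2, hsoft_up _ (by omega)] at this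
      exact this (by rw [D.up_fst _ (by omega) (by omega), D.dn_fst _ (by omega) (by omega)])
        (D.up_ne_dn (by omega) (by omega)).symm
    · have := (hP (D.ht x) (by omega)).2
      rw [ht3 (by omega), hsoft_up _ (by omega)] at this
      exact this (by rw [D.Y_fst, D.up_fst _ (by omega) (by omega)])
        (D.Y_ne_up _ (by omega) (by omega))
  have ha := htok a hfa (fun j h h' => by simp only [t]; split_ifs <;> first | rfl | omega)
    (fun j h h' => by simp only [t]; split_ifs <;> first | rfl | omega) (fun _ => hta)
  have hb := htok (a + d) hfb (fun j h h' => by simp only [t]; split_ifs <;> first | rfl | omega)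
    (fun j h h' => by simp only [t]; split_ifs <;> first | rfl | omega)
    (fun h => by
      by_cases hab' : D.ht a = D.ht (a + d)
      · omega
      · exact htb hab')
  refine D.hasLabels_of_roots a d hd _ (fun _ => f)
    (fun k _ _ => windowLists_eq_full hf.1 hf.2.1 hf.2.2.1 hf.2.2.2) (fun _ _ _ => rfl)
    (fun _ _ _ => rfl) P (fun k hk1 hk => ?_) g hg1 hg2 rfl ?_
  · by_cases hkM : k = M
    · subst hkM
      rw [hPMQ]
      convert hQ using 1
      simp only [soft, exit]
      split_ifs <;> first | rfl | omega
    · exact (hP k hkM).1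
  · rw [ha, hb]
    revert hQab
    generalize Q (D.exit M a) = x1
    generalize Q (D.exit M (a + d)) = x2
    generalize D.offset M a = x3
    generalize D.offset M (a + d) = x4
    cases x1 <;> cases x2 <;> cases x3 <;> cases x4 <;> simp

end CycleSystem.RootPath

/-! ### Two cycles treated last -/

/-- A list that has a common label with `hard s`. -/
def LabelList.Allows (s : Bool) (L : LabelList) : Prop := L ≠ .hard (!s) ∧ L ≠ .soft (!s)

theorem LabelList.allows_or {L : LabelList} (s : Bool) : L.Allows s ∨ L.Allows (!s) := by
  unfold LabelList.Allows
  cases L with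
  | hard t => cases s <;> cases t <;> simp
  | soft t => cases s <;> cases t <;> simp
  | full => simp

theorem windowLists_compat_of {n : ℕ} {a d x : ZMod n} {s : Bool} {L : LabelList}
    (h1 : x = a ∨ x = a + d → L.Allows s) (h2 : x = a + 2 * d ∨ x = a + 3 * d → L ≠ .hard s) :
    (windowLists n a d s x).Compat L := by
  unfold windowLists
  split_ifs with h h'
  · obtain ⟨k1, k2⟩ := h1 h
    cases L with
    | hard t => cases s <;> cases t <;> simp_all
    | soft t => cases s <;> cases t <;> simp_all
    | full => simp
  · have k := h2 h'
    cases L with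
    | hard t => cases s <;> cases t <;> simp_all
    | soft t => simp
    | full => simp
  · simp

theorem windowLists_eq_hard {n : ℕ} {a d x : ZMod n} {s t : Bool}
    (h : windowLists n a d s x = .hard t) : s = t ∧ (x = a ∨ x = a + d) := by
  unfold windowLists at h
  split_ifs at h with h1
  exact ⟨by simpa using h, h1⟩

theorem windowLists_eq_soft {n : ℕ} {a d x : ZMod n} {s t : Bool}
    (h : windowLists n a d s x = .soft t) :
    (!s) = t ∧ (x = a + 2 * d ∨ x = a + 3 * d) ∧ x ≠ a ∧ x ≠ a + d := by
  unfold windowLists at h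
  split_ifs at h with h1 h2
  push Not at h1
  exact ⟨by simpa using h, h2, h1⟩

namespace CycleSystem

variable {κ : Type*} {S : CycleSystem κ}

/-- Two cycles `C` and `W` are treated last: all other cycles can be given good lists that are
compatible with the demand `-1` of `C` and `W`. -/
theorem exists_outer_lists [Finite κ] (h : ∀ c, ¬ S.IsRoot c) (C W : κ) :
    ∃ p : ∀ v, ZMod (S.n v) → LabelList, (∀ v, v ≠ C → v ≠ W → S.Good v (p v)) ∧
      (∀ x y, S.mate x = some y → x.1 ≠ C → x.1 ≠ W → y.1 ≠ C → y.1 ≠ W →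
        (p x.1 x.2).Compat (p y.1 y.2)) ∧
      ∀ x y, S.mate x = some y → x.1 ≠ C → x.1 ≠ W → (y.1 = C ∨ y.1 = W) →
        p x.1 x.2 ≠ .hard true := by
  classical
  have hn := five_le_of_noRoot h
  let R : Set κ := {C, W}
  have hR : ∀ c, c ∉ R ↔ c ≠ C ∧ c ≠ W := fun c => by simp [R]
  have hreach : ∀ c, ∃ u ∈ R, Relation.ReflTransGen S.Nbr c u := by
    intro c
    have := S.eq_univ_of_closed {u | Relation.ReflTransGen S.Nbr c u} ⟨c, .refl⟩
      (fun u _ => h u) (fun a ha b hab => ha.tail hab)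
    refine ⟨C, by simp [R], ?_⟩
    have hm := Set.mem_univ C
    rwa [← this] at hm
  obtain ⟨depth, -, hdepth⟩ := exists_depth S.Nbr R hreach
  have hpar : ∀ c, ∃ (z w : S.Place) (Q : S.Place → Bool), c ∉ R → z.1 = c ∧ S.mate z = some w ∧
      S.PlaceWins z Q ∧ depth w.1 < depth c := by
    intro c
    by_cases hc : c ∈ R
    · exact ⟨⟨c, 0⟩, ⟨c, 0⟩, fun _ => false, fun h => absurd hc h⟩
    · obtain ⟨u, ⟨x, y, hxy⟩, hlt⟩ := hdepth c hc
      obtain ⟨Q, hQ, -⟩ := S.exists_placeWins_near (z := ⟨c, x⟩) (hn c)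
      exact ⟨⟨c, x⟩, ⟨u, y⟩, Q, fun _ => ⟨rfl, hxy, hQ, hlt⟩⟩
  choose z w Q hz using hpar
  obtain ⟨g, hg1, hg2⟩ := exists_signs depth R (fun c => (w c).1) (fun c hc => (hz c hc).2.2.2)
    (fun _ => false) (fun c => if (w c).1 ∈ R then false else Q (w c).1 (w c))
  let E : S.Place → Bool := fun x => g x.1 ^^ Q x.1 x
  refine (S.exists_lists R depth (fun _ => .soft false) E (by simp) ?_).elim ?_
  · intro c hc
    right
    refine ⟨hn c, fun x y hxy => h c ⟨x, Or.inr ⟨y, hxy⟩⟩, ?_⟩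
    obtain ⟨h1, h2, h3, h4⟩ := hz c hc
    obtain ⟨z', hz'⟩ : ∃ z', (⟨c, z'⟩ : S.Place) = z c := by
      refine ⟨h1 ▸ (z c).2, ?_⟩
      generalize z c = zz at h1
      subst h1
      rfl
    rw [← hz'] at h3
    have hE : E ⟨c, z'⟩ = g c := by
      have := h3.1
      simp only at this
      simp [E, this]
    refine ⟨z', w c, by rw [hz', h2], h3.2 (g c), ?_⟩
    rw [hE, hg2 c hc]
    by_cases hw : (w c).1 ∈ R
    · right
      simp [hw, hg1]
    · left
      refine ⟨hw, h4, ?_⟩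
      simp [hw, E]
  · rintro p ⟨hp, hpc⟩
    refine ⟨p, fun v h1 h2 => hp v ((hR v).2 ⟨h1, h2⟩), fun x y hxy h1 h2 h3 h4 =>
      (hpc x y hxy ((hR _).2 ⟨h1, h2⟩)).1 ((hR _).2 ⟨h3, h4⟩), fun x y hxy h1 h2 h3 => ?_⟩
    have := (hpc x y hxy ((hR _).2 ⟨h1, h2⟩)).2 (by simpa [R] using h3)
    rw [LabelList.compat_soft_iff] at this
    exact this

/-- The lists of the other cycles can be completed by two windows on `C` and `W`. -/
theorem hasLabels_of_two_windows (h : ∀ c, ¬ S.IsRoot c) {C W : κ} (hCW : C ≠ W)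
    (p : ∀ v, ZMod (S.n v) → LabelList) (hp : ∀ v, v ≠ C → v ≠ W → S.Good v (p v))
    (hpp : ∀ x y, S.mate x = some y → x.1 ≠ C → x.1 ≠ W → y.1 ≠ C → y.1 ≠ W →
        (p x.1 x.2).Compat (p y.1 y.2))
    (a d : ZMod (S.n C)) (hd : d = 1 ∨ d = -1) (s : Bool)
    (a' d' : ZMod (S.n W)) (hd' : d' = 1 ∨ d' = -1) (s' : Bool)
    (hC : ∀ x y, S.mate ⟨C, x⟩ = some y → y.1 ≠ W →
      (x = a ∨ x = a + d → (p y.1 y.2).Allows s) ∧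
      (x = a + 2 * d ∨ x = a + 3 * d → p y.1 y.2 ≠ .hard s))
    (hW : ∀ x y, S.mate ⟨W, x⟩ = some y → y.1 ≠ C →
      (x = a' ∨ x = a' + d' → (p y.1 y.2).Allows s') ∧
      (x = a' + 2 * d' ∨ x = a' + 3 * d' → p y.1 y.2 ≠ .hard s'))
    (hJ : ∀ x y, S.mate ⟨C, x⟩ = some ⟨W, y⟩ →
      (x = a ∨ x = a + d → (windowLists _ a' d' s' y).Allows s) ∧
      (x = a + 2 * d ∨ x = a + 3 * d → windowLists _ a' d' s' y ≠ .hard s)) : S.HasLabels := by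
  classical
  have hn := five_le_of_noRoot h
  let B : S.Place → LabelList := fun y =>
    if h : y.1 = C then windowLists (S.n C) a d s (h ▸ y.2)
    else if h : y.1 = W then windowLists (S.n W) a' d' s' (h ▸ y.2) else p y.1 y.2
  have hBC : ∀ x, B ⟨C, x⟩ = windowLists _ a d s x := fun x => by simp [B]
  have hBW : ∀ x, B ⟨W, x⟩ = windowLists _ a' d' s' x := fun x => by simp [B, hCW.symm]
  have hBo : ∀ x : S.Place, x.1 ≠ C → x.1 ≠ W → B x = p x.1 x.2 := fun x h1 h2 => by
    simp [B, h1, h2]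
  have keyC : ∀ x y, S.mate ⟨C, x⟩ = some y → (B ⟨C, x⟩).Compat (B y) := by
    rintro x ⟨c, y⟩ hxy
    have hne : c ≠ C := by
      obtain ⟨y', hy', hne⟩ := exists_mate_of_noRoot h ⟨C, x⟩
      rw [hxy] at hy'
      obtain rfl := Option.some.inj hy'
      exact hne
    rw [hBC]
    by_cases hc : c = W
    · subst hc
      rw [hBW]
      exact windowLists_compat_of (hJ x y hxy).1 (hJ x y hxy).2
    · rw [hBo _ hne hc]
      exact windowLists_compat_of (hC x _ hxy hc).1 (hC x _ hxy hc).2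
  have keyW : ∀ x y, S.mate ⟨W, x⟩ = some y → y.1 ≠ C → (B ⟨W, x⟩).Compat (B y) := by
    rintro x ⟨c, y⟩ hxy hc
    have hne : c ≠ W := by
      obtain ⟨y', hy', hne⟩ := exists_mate_of_noRoot h ⟨W, x⟩
      rw [hxy] at hy'
      obtain rfl := Option.some.inj hy'
      exact hne
    rw [hBW, hBo _ hc hne]
    exact windowLists_compat_of (hW x _ hxy hc).1 (hW x _ hxy hc).2
  refine S.exists_labels_of_lists (fun c x => B ⟨c, x⟩) (fun c => ?_) ?_
  · by_cases hc : c = C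
    · subst hc
      simp only [hBC]
      exact S.good_window (hn _) a d s hd
    by_cases hc' : c = W
    · subst hc'
      simp only [hBW]
      exact S.good_window (hn _) a' d' s' hd'
    · rw [show (fun x => B ⟨c, x⟩) = p c from funext fun x => hBo _ hc hc']
      exact hp c hc hc'
  · rintro ⟨c, x⟩ ⟨c', y⟩ hxy
    simp only
    by_cases hc : c = C
    · subst hc
      exact keyC _ _ hxy
    by_cases hc' : c' = C
    · subst hc'
      exact (keyC _ _ (S.mate_symm _ _ hxy)).symm
    by_cases hw : c = W
    · subst hw
      exact keyW _ _ hxy hc'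
    by_cases hw' : c' = W
    · subst hw'
      exact (keyW _ _ (S.mate_symm _ _ hxy) hc).symm
    rw [hBo _ hc hw, hBo _ hc' hw']
    exact hpp _ _ hxy hc hw hc' hw'

/-- Two cycles with adjacent places of one joined to adjacent places of the other: these are the hard
places of windows on both cycles. -/
theorem hasLabels_of_ladder [Finite κ] (h : ∀ c, ¬ S.IsRoot c) {C W : κ} (hCW : C ≠ W)
    (a d : ZMod (S.n C)) (hd : d = 1 ∨ d = -1) (a' d' : ZMod (S.n W)) (hd' : d' = 1 ∨ d' = -1)
    (h1 : S.mate ⟨C, a⟩ = some ⟨W, a'⟩) (h2 : S.mate ⟨C, a + d⟩ = some ⟨W, a' + d'⟩) :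
    S.HasLabels := by
  obtain ⟨p, hp, hpp, hpo⟩ := exists_outer_lists h C W
  have h1' := S.mate_symm _ _ h1
  have h2' := S.mate_symm _ _ h2
  have hneC : ∀ x y, S.mate ⟨C, x⟩ = some y → y.1 ≠ C := fun x ⟨c, y⟩ hxy hc => by
    obtain rfl : c = C := hc
    exact h c ⟨x, Or.inr ⟨y, hxy⟩⟩
  have hneW : ∀ x y, S.mate ⟨W, x⟩ = some y → y.1 ≠ W := fun x ⟨c, y⟩ hxy hc => by
    obtain rfl : c = W := hc
    exact h c ⟨x, Or.inr ⟨y, hxy⟩⟩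
  refine hasLabels_of_two_windows h hCW p hp hpp a d hd true a' d' hd' true ?_ ?_ ?_
  · intro x y hxy hy
    refine ⟨?_, fun _ => hpo y _ (S.mate_symm _ _ hxy) (hneC _ _ hxy) hy (Or.inl rfl)⟩
    rintro (rfl | rfl)
    · rw [h1] at hxy; exact absurd (by rw [← Option.some.inj hxy]) hy
    · rw [h2] at hxy; exact absurd (by rw [← Option.some.inj hxy]) hy
  · intro x y hxy hy
    refine ⟨?_, fun _ => hpo y _ (S.mate_symm _ _ hxy) hy (hneW _ _ hxy) (Or.inr rfl)⟩
    rintro (rfl | rfl)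
    · rw [h1'] at hxy; exact absurd (by rw [← Option.some.inj hxy]) hy
    · rw [h2'] at hxy; exact absurd (by rw [← Option.some.inj hxy]) hy
  · intro x y hxy
    have hmem : x = a ∨ x = a + d ↔ y = a' ∨ y = a' + d' := by
      constructor
      · rintro (rfl | rfl)
        · rw [h1] at hxy; left; simpa using hxy.symm
        · rw [h2] at hxy; right; simpa using hxy.symm
      · have := S.mate_symm _ _ hxy
        rintro (rfl | rfl)
        · rw [h1'] at this; left; simpa using this.symm
        · rw [h2'] at this; right; simpa using this.symm
    constructor
    · intro hx
      rw [hmem] at hx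
      simp [windowLists, hx, LabelList.Allows]
    · intro hx hhard
      have hy := (windowLists_eq_hard hhard).2
      rw [← hmem] at hy
      have k1 := ZMod.natCast_ne_zero_of_lt (n := S.n C) (k := 1) (by omega)
        (by have := five_le_of_noRoot h C; omega)
      have k2 := ZMod.natCast_ne_zero_of_lt (n := S.n C) (k := 2) (by omega)
        (by have := five_le_of_noRoot h C; omega)
      have k3 := ZMod.natCast_ne_zero_of_lt (n := S.n C) (k := 3) (by omega)
        (by have := five_le_of_noRoot h C; omega)
      push_cast at k1 k2 k3
      have dk : ∀ k : ZMod (S.n C), k ≠ 0 → k * d ≠ 0 := by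
        intro k hk0
        rcases hd with rfl | rfl <;> simpa using hk0
      rcases hx with rfl | rfl <;> rcases hy with hy | hy
      · exact dk 2 k2 (by linear_combination hy)
      · exact dk 1 k1 (by linear_combination hy)
      · exact dk 3 k3 (by linear_combination hy)
      · exact dk 2 k2 (by linear_combination hy)

/-! ### Two pentagons joined as in the Petersen graph -/

/-- Two cycles of length `5` joined by three edges in the way of the Petersen graph. -/
structure Twisted (S : CycleSystem κ) (C W : κ) (c d : ZMod (S.n C)) (w e : ZMod (S.n W)) :
    Prop where
  ne : C ≠ W
  nC : S.n C = 5
  nW : S.n W = 5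
  hd : d = 1 ∨ d = -1
  he : e = 1 ∨ e = -1
  m0 : S.mate ⟨C, c⟩ = some ⟨W, w⟩
  m1 : S.mate ⟨C, c + d⟩ = some ⟨W, w + 3 * e⟩
  m2 : S.mate ⟨C, c + 2 * d⟩ = some ⟨W, w + e⟩

theorem ZMod.five_eq_zero {n : ℕ} (hn : n = 5) : (5 : ZMod n) = 0 := by
  subst hn; rfl

theorem Twisted.reflect {C W : κ} {c d : ZMod (S.n C)} {w e : ZMod (S.n W)}
    (h : Twisted S C W c d w e) : Twisted S C W (c + 2 * d) (-d) (w + e) (-e) where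
  ne := h.ne
  nC := h.nC
  nW := h.nW
  hd := by rcases h.hd with rfl | rfl <;> simp
  he := by rcases h.he with rfl | rfl <;> simp
  m0 := h.m2
  m1 := by
    have := h.m1
    have h5 := ZMod.five_eq_zero h.nW
    rw [show c + 2 * d + -d = c + d by ring,
      show w + e + 3 * -e = w + 3 * e by linear_combination -e * h5]
    exact this
  m2 := by
    rw [show c + 2 * d + 2 * -d = c by ring, show w + e + -e = w by ring]
    exact h.m0

theorem ZMod.five_cases {n : ℕ} (hn : n = 5) {d : ZMod n} (hd : d = 1 ∨ d = -1) (c x : ZMod n) :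
    x = c ∨ x = c + d ∨ x = c + 2 * d ∨ x = c + 3 * d ∨ x = c + 4 * d := by
  subst hn
  revert c x
  rcases hd with rfl | rfl <;> decide

end CycleSystem

theorem ZMod.five_absurd {n : ℕ} (hn : n = 5) {e : ZMod n} (he : e = 1 ∨ e = -1) {w x : ZMod n}
    (i j : ℕ) (hij : i % 5 ≠ j % 5) (hi : x = w + i * e) (hj : x = w + j * e) : False := by
  subst hn
  apply hij
  have : (i : ZMod 5) = j := by
    rw [hi] at hj
    have := add_left_cancel hj
    rcases he with rfl | rfl
    · simpa using this
    · simpa using this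
  exact (ZMod.natCast_eq_natCast_iff i j 5).1 this

namespace CycleSystem

variable {κ : Type*} {S : CycleSystem κ}

/-- The lists of the cycles other than `C` and `W`, chosen before those of `C` and `W`. -/
structure OuterLists (S : CycleSystem κ) (C W : κ) (p : ∀ v, ZMod (S.n v) → LabelList) : Prop where
  noRoot : ∀ c, ¬ S.IsRoot c
  good : ∀ v, v ≠ C → v ≠ W → S.Good v (p v)
  compat : ∀ x y, S.mate x = some y → x.1 ≠ C → x.1 ≠ W → y.1 ≠ C → y.1 ≠ W →
    (p x.1 x.2).Compat (p y.1 y.2)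
  ne_hard : ∀ x y, S.mate x = some y → x.1 ≠ C → x.1 ≠ W → (y.1 = C ∨ y.1 = W) →
    p x.1 x.2 ≠ .hard true

theorem OuterLists.ne_hard_left {C W : κ} {p : ∀ v, ZMod (S.n v) → LabelList}
    (hp : OuterLists S C W p) {x : ZMod (S.n C)} {y : S.Place} (hxy : S.mate ⟨C, x⟩ = some y)
    (hy : y.1 ≠ W) : p y.1 y.2 ≠ .hard true := by
  refine hp.ne_hard y _ (S.mate_symm _ _ hxy) (fun hc => ?_) hy (Or.inl rfl)
  obtain ⟨c, y⟩ := y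
  obtain rfl : c = C := hc
  exact hp.noRoot c ⟨x, Or.inr ⟨y, hxy⟩⟩

theorem OuterLists.ne_hard_right {C W : κ} {p : ∀ v, ZMod (S.n v) → LabelList}
    (hp : OuterLists S C W p) {x : ZMod (S.n W)} {y : S.Place} (hxy : S.mate ⟨W, x⟩ = some y)
    (hy : y.1 ≠ C) : p y.1 y.2 ≠ .hard true := by
  refine hp.ne_hard y _ (S.mate_symm _ _ hxy) hy (fun hc => ?_) (Or.inr rfl)
  obtain ⟨c, y⟩ := y
  obtain rfl : c = W := hc
  exact hp.noRoot c ⟨x, Or.inr ⟨y, hxy⟩⟩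

namespace Twisted

variable {C W : κ} {c d : ZMod (S.n C)} {w e : ZMod (S.n W)} (h : Twisted S C W c d w e)
  {p : ∀ v, ZMod (S.n v) → LabelList} (hp : OuterLists S C W p)

include h

theorem mate_left {x : ZMod (S.n C)} {y : ZMod (S.n W)} (hxy : S.mate ⟨C, x⟩ = some ⟨W, y⟩) :
    (x = c ∧ y = w) ∨ (x = c + d ∧ y = w + 3 * e) ∨ (x = c + 2 * d ∧ y = w + e) ∨
    ((x = c + 3 * d ∨ x = c + 4 * d) ∧ (y = w + 2 * e ∨ y = w + 4 * e)) := by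
  have hyx := S.mate_symm _ _ hxy
  have m0 := S.mate_symm _ _ h.m0
  have m1 := S.mate_symm _ _ h.m1
  have m2 := S.mate_symm _ _ h.m2
  rcases ZMod.five_cases h.nC h.hd c x with rfl | rfl | rfl | hx | hx
  · left; rw [h.m0] at hxy; simpa using hxy.symm
  · right; left; rw [h.m1] at hxy; simpa using hxy.symm
  · right; right; left; rw [h.m2] at hxy; simpa using hxy.symm
  all_goals
    rcases ZMod.five_cases h.nW h.he w y with rfl | rfl | rfl | rfl | rfl
    · left; rw [m0] at hyx; simpa using hyx.symm
    · right; right; left; rw [m2] at hyx; simpa using hyx.symm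
    · right; right; right; simp [hx]
    · right; left; rw [m1] at hyx; simpa using hyx.symm
    · right; right; right; simp [hx]

theorem outer_left {x : ZMod (S.n C)} {y : S.Place} (hxy : S.mate ⟨C, x⟩ = some y)
    (hy : y.1 ≠ W) : x = c + 3 * d ∨ x = c + 4 * d := by
  rcases ZMod.five_cases h.nC h.hd c x with rfl | rfl | rfl | hx | hx
  · rw [h.m0] at hxy; exact absurd (by rw [← Option.some.inj hxy]) hy
  · rw [h.m1] at hxy; exact absurd (by rw [← Option.some.inj hxy]) hy
  · rw [h.m2] at hxy; exact absurd (by rw [← Option.some.inj hxy]) hy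
  · exact Or.inl hx
  · exact Or.inr hx

theorem outer_right {x : ZMod (S.n W)} {y : S.Place} (hxy : S.mate ⟨W, x⟩ = some y)
    (hy : y.1 ≠ C) : x = w + 2 * e ∨ x = w + 4 * e := by
  rcases ZMod.five_cases h.nW h.he w x with rfl | rfl | hx | rfl | hx
  · rw [S.mate_symm _ _ h.m0] at hxy; exact absurd (by rw [← Option.some.inj hxy]) hy
  · rw [S.mate_symm _ _ h.m2] at hxy; exact absurd (by rw [← Option.some.inj hxy]) hy
  · exact Or.inl hx
  · rw [S.mate_symm _ _ h.m1] at hxy; exact absurd (by rw [← Option.some.inj hxy]) hy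
  · exact Or.inr hx

include hp

/-- The place `w + 4 * e` of `W` can get the label `1`. -/
theorem hasLabels_of_right {y : S.Place} (hy : S.mate ⟨W, w + 4 * e⟩ = some y) (hyC : y.1 ≠ C)
    (hyp : (p y.1 y.2).Allows true) : S.HasLabels := by
  refine hasLabels_of_two_windows hp.noRoot h.ne p hp.good hp.compat c d h.hd true
    (w + 4 * e) e h.he true ?_ ?_ ?_
  · intro x y hxy hyW
    refine ⟨fun hx => ?_, fun _ => hp.ne_hard_left hxy hyW⟩
    exfalso
    rcases h.outer_left hxy hyW with h1 | h1 <;> rcases hx with h2 | h2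
    · exact ZMod.five_absurd h.nC h.hd 3 0 (by decide) h1 (by simpa using h2)
    · exact ZMod.five_absurd h.nC h.hd 3 1 (by decide) h1 (by simpa using h2)
    · exact ZMod.five_absurd h.nC h.hd 4 0 (by decide) h1 (by simpa using h2)
    · exact ZMod.five_absurd h.nC h.hd 4 1 (by decide) h1 (by simpa using h2)
  · intro x y' hxy hyC'
    refine ⟨fun hx => ?_, fun _ => hp.ne_hard_right hxy hyC'⟩
    rcases hx with rfl | hx
    · rw [hy] at hxy
      rwa [← Option.some.inj hxy]
    · exfalso
      rcases h.outer_right hxy hyC' with h1 | h1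
      · exact ZMod.five_absurd h.nW h.he 2 5 (by decide) h1 (by rw [hx]; push_cast; ring)
      · exact ZMod.five_absurd h.nW h.he 4 5 (by decide) h1 (by rw [hx]; push_cast; ring)
  · intro x y' hxy
    have h4 : y' ≠ w + 4 * e := by
      rintro rfl
      rw [S.mate_symm _ _ hxy] at hy
      exact hyC (by rw [← Option.some.inj hy])
    constructor
    · intro hx
      refine ⟨fun hh => ?_, fun hh => ?_⟩
      · exact absurd (windowLists_eq_hard hh).1 (by simp)
      · obtain ⟨-, h2, -⟩ := windowLists_eq_soft hh
        rcases h.mate_left hxy with ⟨-, h1⟩ | ⟨-, h1⟩ | ⟨h1, -⟩ | ⟨h1, -⟩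
        · rcases h2 with h2 | h2
          · exact ZMod.five_absurd h.nW h.he (w := w) (x := y') 0 6 (by decide) (by rw [h1]; simp)
              (by rw [h2]; push_cast; ring)
          · exact ZMod.five_absurd h.nW h.he (w := w) (x := y') 0 7 (by decide) (by rw [h1]; simp)
              (by rw [h2]; push_cast; ring)
        · rcases h2 with h2 | h2
          · exact ZMod.five_absurd h.nW h.he (w := w) (x := y') 3 6 (by decide) (by rw [h1]; simp)
              (by rw [h2]; push_cast; ring)
          · exact ZMod.five_absurd h.nW h.he (w := w) (x := y') 3 7 (by decide) (by rw [h1]; simp)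
              (by rw [h2]; push_cast; ring)
        · rcases hx with h2 | h2
          · exact ZMod.five_absurd h.nC h.hd 2 0 (by decide) h1 (by simpa using h2)
          · exact ZMod.five_absurd h.nC h.hd 2 1 (by decide) h1 (by simpa using h2)
        · rcases h1 with h1 | h1 <;> rcases hx with h2 | h2
          · exact ZMod.five_absurd h.nC h.hd 3 0 (by decide) h1 (by simpa using h2)
          · exact ZMod.five_absurd h.nC h.hd 3 1 (by decide) h1 (by simpa using h2)
          · exact ZMod.five_absurd h.nC h.hd 4 0 (by decide) h1 (by simpa using h2)
          · exact ZMod.five_absurd h.nC h.hd 4 1 (by decide) h1 (by simpa using h2)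
    · intro hx hh
      rcases (windowLists_eq_hard hh).2 with h2 | h2
      · exact h4 h2
      rcases h.mate_left hxy with ⟨h1, -⟩ | ⟨h1, -⟩ | ⟨-, h1⟩ | ⟨-, h1⟩
      · rcases hx with h3 | h3
        · exact ZMod.five_absurd h.nC h.hd 0 2 (by decide) (by simpa using h1) h3
        · exact ZMod.five_absurd h.nC h.hd 0 3 (by decide) (by simpa using h1) h3
      · rcases hx with h3 | h3
        · exact ZMod.five_absurd h.nC h.hd 1 2 (by decide) (by simpa using h1) h3
        · exact ZMod.five_absurd h.nC h.hd 1 3 (by decide) (by simpa using h1) h3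
      · exact ZMod.five_absurd h.nW h.he (w := w) (x := y') 1 5 (by decide) (by rw [h1]; simp)
          (by rw [h2]; push_cast; ring)
      · rcases h1 with h1 | h1
        · exact ZMod.five_absurd h.nW h.he (w := w) (x := y') 2 5 (by decide) (by rw [h1]; simp)
            (by rw [h2]; push_cast; ring)
        · exact h4 h1

/-- The place `c + 3 * d` of `C` can get the label `1`, and the place `w + 2 * e` of `W` the
label `-1`. -/
theorem hasLabels_of_left {y : S.Place} (hy : S.mate ⟨C, c + 3 * d⟩ = some y) (hyW : y.1 ≠ W)
    (hyp : (p y.1 y.2).Allows true)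
    (hw : ∀ y, S.mate ⟨W, w + 2 * e⟩ = some y → y.1 ≠ C → (p y.1 y.2).Allows false) :
    S.HasLabels := by
  refine hasLabels_of_two_windows hp.noRoot h.ne p hp.good hp.compat (c + 2 * d) d h.hd true
    (w + 3 * e) (-e) (by rcases h.he with rfl | rfl <;> simp) false ?_ ?_ ?_
  · intro x y' hxy hyW'
    refine ⟨fun hx => ?_, fun _ => hp.ne_hard_left hxy hyW'⟩
    rcases hx with hx | hx
    · exfalso
      rcases h.outer_left hxy hyW' with h1 | h1
      · exact ZMod.five_absurd h.nC h.hd 3 2 (by decide) h1 (by simpa using hx)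
      · exact ZMod.five_absurd h.nC h.hd 4 2 (by decide) h1 (by simpa using hx)
    · rw [hx, show c + 2 * d + d = c + 3 * d by ring, hy] at hxy
      rwa [← Option.some.inj hxy]
  · intro x y' hxy hyC'
    rcases h.outer_right hxy hyC' with h1 | h1
    · subst h1
      refine ⟨fun _ => hw y' hxy hyC', fun hx => ?_⟩
      exfalso
      rcases hx with h2 | h2
      · exact ZMod.five_absurd h.nW h.he (w := w) 2 1 (by decide)
            (x := w + 2 * e) (by push_cast; ring) (h2.trans (by push_cast; ring))
      · exact ZMod.five_absurd h.nW h.he (w := w) 2 0 (by decide)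
            (x := w + 2 * e) (by push_cast; ring) (h2.trans (by push_cast; ring))
    · constructor
      · intro hx
        exfalso
        rcases hx with h2 | h2
        · exact ZMod.five_absurd h.nW h.he (w := w) 4 3 (by decide) h1 (by rw [h2]; push_cast; ring)
        · exact ZMod.five_absurd h.nW h.he (w := w) 4 2 (by decide) h1 (by rw [h2]; push_cast; ring)
      · intro hx
        exfalso
        rcases hx with h2 | h2
        · exact ZMod.five_absurd h.nW h.he (w := w) 4 1 (by decide) h1 (by rw [h2]; push_cast; ring)
        · exact ZMod.five_absurd h.nW h.he (w := w) 4 0 (by decide) h1 (by rw [h2]; push_cast; ring)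
  · intro x y' hxy
    refine ⟨fun hx => ⟨fun hh => ?_, fun hh => ?_⟩, fun _ hh => ?_⟩
    · obtain ⟨-, h2⟩ := windowLists_eq_hard hh
      rcases h.mate_left hxy with ⟨h1, -⟩ | ⟨h1, -⟩ | ⟨-, h1⟩ | ⟨h1, -⟩
      · rcases hx with h3 | h3
        · exact ZMod.five_absurd h.nC h.hd 0 2 (by decide) (by simpa using h1) h3
        · exact ZMod.five_absurd h.nC h.hd (w := c) 0 3 (by decide) (by simpa using h1)
            (by rw [h3]; push_cast; ring)
      · rcases hx with h3 | h3
        · exact ZMod.five_absurd h.nC h.hd 1 2 (by decide) (by simpa using h1) h3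
        · exact ZMod.five_absurd h.nC h.hd (w := c) 1 3 (by decide) (by simpa using h1)
            (by rw [h3]; push_cast; ring)
      · rcases h2 with h2 | h2
        · exact ZMod.five_absurd h.nW h.he (w := w) 1 3 (by decide) (by simpa using h1)
            (by rw [h2]; push_cast; ring)
        · exact ZMod.five_absurd h.nW h.he (w := w) 1 2 (by decide) (by simpa using h1)
            (by rw [h2]; push_cast; ring)
      · rcases hx with h3 | h3
        · rcases h1 with h1 | h1
          · exact ZMod.five_absurd h.nC h.hd 3 2 (by decide) h1 h3
          · exact ZMod.five_absurd h.nC h.hd 4 2 (by decide) h1 h3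
        · rw [h3, show c + 2 * d + d = c + 3 * d by ring, hy] at hxy
          exact hyW (by rw [Option.some.inj hxy])
    · exact absurd (windowLists_eq_soft hh).1 (by simp)
    · exact absurd (windowLists_eq_hard hh).1 (by simp)

/-- Both remaining places of `C` can get the label `-1`. -/
theorem hasLabels_of_neg
    (hc : ∀ x y, (x = c + 3 * d ∨ x = c + 4 * d) → S.mate ⟨C, x⟩ = some y → y.1 ≠ W →
      (p y.1 y.2).Allows false) : S.HasLabels := by
  have h5 := ZMod.five_eq_zero h.nC
  refine hasLabels_of_two_windows hp.noRoot h.ne p hp.good hp.compat (c + 3 * d) d h.hd false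
    w e h.he true ?_ ?_ ?_
  · intro x y' hxy hyW'
    have hx := h.outer_left hxy hyW'
    refine ⟨fun _ => hc x y' hx hxy hyW', fun hx' => ?_⟩
    exfalso
    rcases hx with h1 | h1 <;> rcases hx' with h2 | h2
    · exact ZMod.five_absurd h.nC h.hd (w := c) 3 5 (by decide) h1 (by rw [h2]; push_cast; ring)
    · exact ZMod.five_absurd h.nC h.hd (w := c) 3 6 (by decide) h1 (by rw [h2]; push_cast; ring)
    · exact ZMod.five_absurd h.nC h.hd (w := c) 4 5 (by decide) h1 (by rw [h2]; push_cast; ring)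
    · exact ZMod.five_absurd h.nC h.hd (w := c) 4 6 (by decide) h1 (by rw [h2]; push_cast; ring)
  · intro x y' hxy hyC'
    refine ⟨fun hx => ?_, fun _ => hp.ne_hard_right hxy hyC'⟩
    exfalso
    rcases h.outer_right hxy hyC' with h1 | h1 <;> rcases hx with h2 | h2
    · exact ZMod.five_absurd h.nW h.he 2 0 (by decide) h1 (by simpa using h2)
    · exact ZMod.five_absurd h.nW h.he 2 1 (by decide) h1 (by simpa using h2)
    · exact ZMod.five_absurd h.nW h.he 4 0 (by decide) h1 (by simpa using h2)
    · exact ZMod.five_absurd h.nW h.he 4 1 (by decide) h1 (by simpa using h2)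
  · intro x y' hxy
    refine ⟨fun hx => ⟨fun hh => ?_, fun hh => ?_⟩, fun _ hh => ?_⟩
    · obtain ⟨-, h2⟩ := windowLists_eq_hard hh
      rcases h.mate_left hxy with ⟨h1, -⟩ | ⟨h1, -⟩ | ⟨h1, -⟩ | ⟨-, h1⟩
      · rcases hx with h3 | h3
        · exact ZMod.five_absurd h.nC h.hd 0 3 (by decide) (by simpa using h1) h3
        · exact ZMod.five_absurd h.nC h.hd (w := c) 0 4 (by decide) (by simpa using h1)
            (by rw [h3]; push_cast; ring)
      · rcases hx with h3 | h3
        · exact ZMod.five_absurd h.nC h.hd 1 3 (by decide) (by simpa using h1) h3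
        · exact ZMod.five_absurd h.nC h.hd (w := c) 1 4 (by decide) (by simpa using h1)
            (by rw [h3]; push_cast; ring)
      · rcases hx with h3 | h3
        · exact ZMod.five_absurd h.nC h.hd 2 3 (by decide) (by simpa using h1) h3
        · exact ZMod.five_absurd h.nC h.hd (w := c) 2 4 (by decide) (by simpa using h1)
            (by rw [h3]; push_cast; ring)
      · rcases h1 with h1 | h1 <;> rcases h2 with h2 | h2
        · exact ZMod.five_absurd h.nW h.he 2 0 (by decide) h1 (by simpa using h2)
        · exact ZMod.five_absurd h.nW h.he 2 1 (by decide) h1 (by simpa using h2)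
        · exact ZMod.five_absurd h.nW h.he 4 0 (by decide) h1 (by simpa using h2)
        · exact ZMod.five_absurd h.nW h.he 4 1 (by decide) h1 (by simpa using h2)
    · exact absurd (windowLists_eq_soft hh).1 (by simp)
    · exact absurd (windowLists_eq_hard hh).1 (by simp)

omit hp in
/-- The remaining two places of either cycle are joined to outer lists that do not enforce the label `1`.
A window with `s = 1` can be used as soon as one of these lists allows `1`; otherwise all of them allow
`-1`. -/
theorem hasLabels [Finite κ] (hroot : ∀ c, ¬ S.IsRoot c) : S.HasLabels := by
  obtain ⟨p, p1, p2, p3⟩ := exists_outer_lists hroot C W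
  have hp : OuterLists S C W p := ⟨hroot, p1, p2, p3⟩
  have h5C := ZMod.five_eq_zero h.nC
  have h5W := ZMod.five_eq_zero h.nW
  have hr := h.reflect
  have e1 : c + 2 * d + 3 * -d = c + 4 * d := by linear_combination -d * h5C
  have e2 : c + 2 * d + 4 * -d = c + 3 * d := by linear_combination -d * h5C
  have e3 : w + e + 4 * -e = w + 2 * e := by linear_combination -e * h5W
  have e4 : w + e + 2 * -e = w + 4 * e := by linear_combination -e * h5W
  by_cases c1 : ∃ y, S.mate ⟨W, w + 4 * e⟩ = some y ∧ y.1 ≠ C ∧ (p y.1 y.2).Allows true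
  · obtain ⟨y, y1, y2, y3⟩ := c1
    exact h.hasLabels_of_right hp y1 y2 y3
  by_cases c2 : ∃ y, S.mate ⟨W, w + 2 * e⟩ = some y ∧ y.1 ≠ C ∧ (p y.1 y.2).Allows true
  · obtain ⟨y, y1, y2, y3⟩ := c2
    exact hr.hasLabels_of_right hp (by rwa [e3]) y2 y3
  push Not at c1 c2
  have n1 : ∀ y, S.mate ⟨W, w + 4 * e⟩ = some y → y.1 ≠ C → (p y.1 y.2).Allows false :=
    fun y k1 k2 => (LabelList.allows_or true).resolve_left (c1 y k1 k2)
  have n2 : ∀ y, S.mate ⟨W, w + 2 * e⟩ = some y → y.1 ≠ C → (p y.1 y.2).Allows false :=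
    fun y k1 k2 => (LabelList.allows_or true).resolve_left (c2 y k1 k2)
  by_cases c3 : ∃ y, S.mate ⟨C, c + 3 * d⟩ = some y ∧ y.1 ≠ W ∧ (p y.1 y.2).Allows true
  · obtain ⟨y, y1, y2, y3⟩ := c3
    exact h.hasLabels_of_left hp y1 y2 y3 n2
  by_cases c4 : ∃ y, S.mate ⟨C, c + 4 * d⟩ = some y ∧ y.1 ≠ W ∧ (p y.1 y.2).Allows true
  · obtain ⟨y, y1, y2, y3⟩ := c4
    exact hr.hasLabels_of_left hp (by rwa [e1]) y2 y3 (by rwa [e4])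
  push Not at c3 c4
  refine h.hasLabels_of_neg hp ?_
  rintro x y (rfl | rfl) k1 k2
  · exact (LabelList.allows_or true).resolve_left (c3 y k1 k2)
  · exact (LabelList.allows_or true).resolve_left (c4 y k1 k2)

end Twisted

end CycleSystem

/-! ### Signs of pairs of places of the first cycle -/

theorem ZMod.mem_of_not_isFar {n : ℕ} [NeZero n] {z b : ZMod n} (hb : b ≠ z) (h : ¬ IsFar n z b) :
    b = z + 1 ∨ b = z - 1 ∨ b = z + 2 ∨ b = z - 2 := by
  have h1 := ZMod.val_sub_pos hb
  have h2 := ZMod.val_lt (b - z)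
  have e1 := ZMod.eq_add_val_mul z b
  have e2 := ZMod.eq_add_sub_val_mul z b
  unfold IsFar at h
  have : (b - z).val = 1 ∨ (b - z).val = 2 ∨ n - (b - z).val = 1 ∨ n - (b - z).val = 2 := by omega
  rcases this with h | h | h | h
  · rw [h] at e1; left; simpa using e1
  · rw [h] at e1; right; right; left; simpa using e1
  · rw [h] at e2; right; left; simpa [sub_eq_add_neg] using e2
  · rw [h] at e2; right; right; right; simpa [sub_eq_add_neg] using e2

theorem ZMod.isFar_of_add_two {n : ℕ} (hn : 7 ≤ n) (z : ZMod n) : IsFar n (z - 2) (z + 2) := by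
  have : NeZero n := ⟨by omega⟩
  have : (z + 2 - (z - 2)).val = 4 := by
    rw [show z + 2 - (z - 2) = ((4 : ℕ) : ZMod n) by push_cast; ring]
    exact ZMod.val_cast_of_lt (by omega)
  unfold IsFar
  omega

/-- A property that never changes between two consecutive places of a cycle is constant. -/
theorem ZMod.forall_of_iff_succ {n : ℕ} [NeZero n] {A : ZMod n → Prop}
    (h : ∀ i, A i ↔ A (i + 1)) (i j : ZMod n) : A i ↔ A j := by
  have key : ∀ k : ℕ, A i ↔ A (i + k) := by
    intro k
    induction k with
    | zero => simp
    | succ k ih => rw [ih, h, Nat.cast_succ, add_assoc]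
  have := key (j - i).val
  rwa [ZMod.natCast_val, ZMod.cast_id, add_sub_cancel] at this

theorem ZMod.five_signChange {n : ℕ} (hn : n = 5) {x y : ZMod n} (hxy : x ≠ y) :
    (signChange n x y = false ↔ y = x + 1 ∨ y = x - 1) ∧
      (signChange n x y = true ↔ y = x + 2 ∨ y = x - 2) := by
  subst hn
  revert x y
  unfold signChange
  decide

/-- A splitting of the places of a pentagon into two sets of at least two places has one of two local
patterns. -/
theorem ZMod.five_patterns {n : ℕ} (hn : n = 5) (A : ZMod n → Bool)
    (h1 : ∃ i j, i ≠ j ∧ A i = true ∧ A j = true) (h2 : ∃ i j, i ≠ j ∧ A i = false ∧ A j = false) :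
    ∃ i, (A (i + 1) = A i ∧ A (i + 2) = (!A i) ∧ A (i + 3) = (!A i)) ∨
      (A (i + 1) = (!A i) ∧ A (i + 2) = A i ∧ A (i + 3) = (!A i)) := by
  subst hn
  have key : ∀ A : Fin 5 → Bool, (∃ i j, i ≠ j ∧ A i = true ∧ A j = true) →
    (∃ i j, i ≠ j ∧ A i = false ∧ A j = false) →
    ∃ i, (A (i + 1) = A i ∧ A (i + 2) = (!A i) ∧ A (i + 3) = (!A i)) ∨
      (A (i + 1) = (!A i) ∧ A (i + 2) = A i ∧ A (i + 3) = (!A i)) := by decide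
  exact key A h1 h2

theorem ZMod.five_triples {n : ℕ} (hn : n = 5) (A : ZMod n → Bool)
    (h : ∀ i j k, i ≠ j → i ≠ k → j ≠ k → A i = true ∨ A j = true ∨ A k = true) :
    ∃ j, A j = true ∧ A (j + 1) = true ∧ (A (j + 2) = true ∨ A (j + 3) = true) := by
  subst hn
  have key : ∀ A : Fin 5 → Bool,
    (∀ i j k, i ≠ j → i ≠ k → j ≠ k → A i = true ∨ A j = true ∨ A k = true) →
    ∃ j, A j = true ∧ A (j + 1) = true ∧ (A (j + 2) = true ∨ A (j + 3) = true) := by decide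
  exact key A h

namespace CycleSystem

variable {κ : Type*} {S : CycleSystem κ}

theorem Flexible.symm {z b c : S.Place} (h : S.Flexible z b c) : S.Flexible z c b := fun s => by
  obtain ⟨P, hP, e⟩ := h s
  exact ⟨P, hP, by rw [Bool.xor_comm, e]⟩

namespace RootPath

variable (D : S.RootPath)

theorem exit_fst {M : ℕ} (h1 : 1 ≤ M) (hM : M ≤ D.m) (x) : (D.exit M x).1 = D.v M := by
  have h2 := D.one_le_ht x
  have h3 := D.ht_le x
  unfold exit
  split_ifs with h h'
  · rw [D.Y_fst, h]
  · obtain ⟨k, rfl⟩ : ∃ j, M = j + 1 := ⟨M - 1, by omega⟩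
    exact D.dn_fst k (by omega) (by omega)
  · exact D.up_fst M h1 (by omega)

theorem exit_ne {M : ℕ} {x y} (h : D.Apart M x y) (hxy : x ≠ y) : D.exit M x ≠ D.exit M y := by
  have hx := D.one_le_ht x
  have hx' := D.ht_le x
  have hy := D.one_le_ht y
  have hy' := D.ht_le y
  obtain ⟨h1, h2⟩ := h
  obtain ⟨M, rfl⟩ | rfl : (∃ j, M = j + 1) ∨ M = 0 := by cases M <;> simp
  · unfold exit
    split_ifs with a b c d e f g i
    · exact fun h => hxy (D.Y_injective h)
    · exact D.Y_ne_dn _ (by omega) (by omega)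
    · exact D.Y_ne_up _ (by omega) (by omega)
    · exact (D.Y_ne_dn _ (by omega) (by omega)).symm
    · omega
    · exact (D.up_ne_dn (by omega) (by omega)).symm
    · exact (D.Y_ne_up _ (by omega) (by omega)).symm
    · exact D.up_ne_dn (by omega) (by omega)
    · omega
  · omega

/-- The part of `pairSign x y` that belongs to the lower place. -/
noncomputable def upSign (x : ZMod (S.n (D.v 0))) : Bool :=
  D.acc (D.ht x) ^^ S.change (D.up (D.ht x)) (D.Y x)

/-- The part of `pairSign x y` that belongs to the upper place. -/
noncomputable def downSign (x : ZMod (S.n (D.v 0))) : Bool :=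
  D.acc (D.ht x - 1) ^^ S.change (D.dn (D.ht x)) (D.Y x)

/-- The total change of sign along the path that joins two places of the first cycle. -/
noncomputable def pairSign (x y : ZMod (S.n (D.v 0))) : Bool :=
  if D.ht x = D.ht y then S.change (D.Y x) (D.Y y)
  else if D.ht x < D.ht y then D.upSign x ^^ D.downSign y else D.upSign y ^^ D.downSign x

theorem pairSign_comm (x y) : D.pairSign x y = D.pairSign y x := by
  unfold pairSign
  rcases lt_trichotomy (D.ht x) (D.ht y) with h | h | h
  · simp [h.ne, h.ne', h, h.not_gt]
  · simp [h, S.change_comm]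
  · simp [h.ne, h.ne', h, h.not_gt]

theorem pairSign_eq_of_lt {M : ℕ} {x y} (h : D.Apart M x y) (hxy : D.ht x < D.ht y) :
    D.pairSign x y = (D.offset M x ^^ D.offset M y ^^ S.change (D.exit M x) (D.exit M y)) := by
  obtain ⟨h1, h2⟩ := h
  have hx := D.one_le_ht x
  rw [pairSign, if_neg hxy.ne, if_pos hxy, upSign, downSign]
  rcases (show D.ht x ≤ M by omega).eq_or_lt with e1 | e1
  · have e2 : ¬ D.ht y = M := by omega
    have e3 : ¬ D.ht y < M := by omega
    simp only [offset, exit, e1, e2, e3, if_true, if_false]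
    rw [S.change_comm (D.up M)]
    generalize D.acc M = a, D.acc (D.ht y - 1) = b, S.change _ _ = c, S.change _ _ = d
    revert a b c d; decide
  · rcases (show M ≤ D.ht y by omega).eq_or_lt with e2 | e2
    · simp only [offset, exit, e1, e1.ne, e2.symm, if_true, if_false]
      generalize D.acc (M - 1) = a, D.acc (D.ht x) = b, S.change _ _ = c, S.change _ _ = d
      revert a b c d; decide
    · simp only [offset, exit, e1, e1.ne, e2.ne', e2.not_gt, if_true, if_false]
      obtain ⟨k, rfl⟩ : ∃ k, M = k + 1 := ⟨M - 1, by omega⟩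
      rw [D.acc_succ k, Nat.add_sub_cancel]
      generalize D.acc k = a, D.acc (D.ht x) = b, S.change _ _ = c, S.change _ _ = d,
        D.acc (D.ht y - 1) = e, S.change _ _ = f
      revert a b c d e f; decide

/-- The sign of a pair of places can be computed at every cycle of the path between their neighbours. -/
theorem pairSign_eq {M : ℕ} {x y} (h : D.Apart M x y) :
    D.pairSign x y = (D.offset M x ^^ D.offset M y ^^ S.change (D.exit M x) (D.exit M y)) := by
  rcases lt_trichotomy (D.ht x) (D.ht y) with e | e | e
  · exact D.pairSign_eq_of_lt h e
  · have : D.ht x = M := by obtain ⟨h1, h2⟩ := h; omega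
    have e' : D.ht y = M := by omega
    simp [pairSign, offset, exit, this, e']
  · rw [pairSign_comm, D.pairSign_eq_of_lt ⟨fun c => h.1 c.symm, fun c => h.2 c.symm⟩ e,
      S.change_comm, Bool.xor_comm (D.offset M y)]

/-- The median of three places of the first cycle: a cycle of the path at which the paths between them
meet. -/
theorem exists_median (x y z) : ∃ M, 1 ≤ M ∧ M ≤ D.m ∧ D.Apart M x y ∧ D.Apart M x z ∧ D.Apart M y z := by
  have h1 := D.one_le_ht x
  have h2 := D.ht_le x
  have h3 := D.one_le_ht y
  have h4 := D.ht_le y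
  have h5 := D.one_le_ht z
  have h6 := D.ht_le z
  unfold Apart
  by_cases c1 : (D.ht x ≤ D.ht y ∧ D.ht y ≤ D.ht z) ∨ (D.ht z ≤ D.ht y ∧ D.ht y ≤ D.ht x)
  · exact ⟨D.ht y, by omega⟩
  by_cases c2 : (D.ht y ≤ D.ht x ∧ D.ht x ≤ D.ht z) ∨ (D.ht z ≤ D.ht x ∧ D.ht x ≤ D.ht y)
  · exact ⟨D.ht x, by omega⟩
  · exact ⟨D.ht z, by omega⟩

/-- If there are no labels, the exits of the median towards the two hard places of a window are not
flexible. -/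
theorem not_flexible [Finite κ] (hno : ¬ S.HasLabels) {a d f : ZMod (S.n (D.v 0))}
    (hd : d = 1 ∨ d = -1) (hf : f ≠ a ∧ f ≠ a + d ∧ f ≠ a + 2 * d ∧ f ≠ a + 3 * d) {M : ℕ}
    (hM1 : 1 ≤ M) (hMm : M ≤ D.m) (hfa : D.Apart M f a) (hfb : D.Apart M f (a + d))
    (hab : D.Apart M a (a + d)) :
    ¬ S.Flexible (D.exit M f) (D.exit M a) (D.exit M (a + d)) := fun h => by
  obtain ⟨P, hP, e⟩ := h (D.offset M a ^^ D.offset M (a + d))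
  exact hno (D.hasLabels_of_median a d hd f hf M hM1 hMm hfa hfb hab P hP e)

theorem mul_ne_zero {d : ZMod (S.n (D.v 0))} (hd : d = 1 ∨ d = -1) {k : ℕ} (h0 : 0 < k)
    (hk : k < S.n (D.v 0)) : (k : ZMod (S.n (D.v 0))) * d ≠ 0 := by
  have := ZMod.natCast_ne_zero_of_lt h0 hk
  rcases hd with rfl | rfl <;> simpa using this

/-- If there are no labels, then the exits to three consecutive places are near each other, and the
natural signs contradict the demands. -/
theorem near_and_pairSign_ne [Finite κ] (hno : ¬ S.HasLabels) (f δ : ZMod (S.n (D.v 0)))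
    (hδ : δ = 1 ∨ δ = -1) :
    D.pairSign f (f + δ) ≠ D.pairSign f (f + 2 * δ) ∧ ∀ M, 1 ≤ M → M ≤ D.m →
      D.Apart M f (f + δ) → D.Apart M f (f + 2 * δ) → D.Apart M (f + δ) (f + 2 * δ) →
      ¬ S.Far (D.exit M f) (D.exit M (f + δ)) ∧ ¬ S.Far (D.exit M f) (D.exit M (f + 2 * δ)) := by
  have hn := five_le_of_noRoot D.noRoot
  have k1 := D.mul_ne_zero hδ (k := 1) (by omega) (by have := hn (D.v 0); omega)
  have k2 := D.mul_ne_zero hδ (k := 2) (by omega) (by have := hn (D.v 0); omega)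
  have k3 := D.mul_ne_zero hδ (k := 3) (by omega) (by have := hn (D.v 0); omega)
  have k4 := D.mul_ne_zero hδ (k := 4) (by omega) (by have := hn (D.v 0); omega)
  push_cast at k1 k2 k3 k4
  have e2 : f + δ + δ = f + 2 * δ := by ring
  have hf : f ≠ f + δ ∧ f ≠ f + δ + δ ∧ f ≠ f + δ + 2 * δ ∧ f ≠ f + δ + 3 * δ :=
    ⟨fun h => k1 (by linear_combination -h), fun h => k2 (by linear_combination -h),
      fun h => k3 (by linear_combination -h), fun h => k4 (by linear_combination -h)⟩
  have near : ∀ M, 1 ≤ M → M ≤ D.m →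
      D.Apart M f (f + δ) → D.Apart M f (f + 2 * δ) → D.Apart M (f + δ) (f + 2 * δ) →
      ¬ S.Far (D.exit M f) (D.exit M (f + δ)) ∧ ¬ S.Far (D.exit M f) (D.exit M (f + 2 * δ)) := by
    intro M h1 hm ha hb hab
    have hfst := D.exit_fst h1 hm
    by_cases h5 : S.n (D.v M) = 5
    · exact ⟨S.not_far_of_eq_five (by rw [hfst, h5]), S.not_far_of_eq_five (by rw [hfst, h5])⟩
    have h7 : 7 ≤ S.n (D.v M) := by
      obtain ⟨r, hr⟩ := S.odd (D.v M)
      have := hn (D.v M)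
      omega
    rcases S.flexible_or_flexible_or_near (u := D.exit M f) (v := D.exit M (f + δ))
      (w := D.exit M (f + 2 * δ)) (by rwa [hfst]) (by rw [hfst, hfst]) (by rw [hfst, hfst])
      (D.exit_ne ha hf.1).symm (D.exit_ne hb (by rw [← e2]; exact hf.2.1)).symm
      (D.exit_ne hab fun h => k1 (by linear_combination -h)) with h | h | h
    · rw [← e2] at h hb hab
      exact absurd h (D.not_flexible hno hδ hf h1 hm ha hb hab)
    · refine absurd ?_ (D.not_flexible hno (a := f + δ) (d := -δ) (f := f + 2 * δ) (M := M)
        (by rcases hδ with rfl | rfl <;> simp) ⟨fun h => k1 (by linear_combination h),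
          fun h => k2 (by linear_combination h), fun h => k3 (by linear_combination h),
          fun h => k4 (by linear_combination h)⟩ h1 hm ⟨fun c => hab.1 c.symm, fun c => hab.2 c.symm⟩ ?_ ?_)
      · simpa using h
      · rw [add_neg_cancel_right]
        exact ⟨fun c => hb.1 c.symm, fun c => hb.2 c.symm⟩
      · rw [add_neg_cancel_right]
        exact ⟨fun c => ha.1 c.symm, fun c => ha.2 c.symm⟩
    · exact ⟨h.1, h.2.1⟩
  refine ⟨fun heq => ?_, near⟩
  obtain ⟨M, h1, hm, ha, hb, hab⟩ := D.exists_median f (f + δ) (f + 2 * δ)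
  obtain ⟨n1, n2⟩ := near M h1 hm ha hb hab
  have hfst := D.exit_fst h1 hm
  obtain ⟨P, hP, e⟩ := S.exists_placeWins_near (z := D.exit M f) (hn _)
  refine hno (D.hasLabels_of_median (f + δ) δ hδ f hf M h1 hm ha (by rwa [e2]) (by rwa [e2]) P hP ?_)
  rw [e2, e _ (by rw [hfst, hfst]) (D.exit_ne ha hf.1).symm n1,
    e _ (by rw [hfst, hfst]) (D.exit_ne hb (by rw [← e2]; exact hf.2.1)).symm n2]
  rw [D.pairSign_eq ha, D.pairSign_eq hb] at heq
  revert heq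
  generalize S.change _ _ = a, S.change _ _ = b, D.offset _ _ = c, D.offset _ _ = d, D.offset _ _ = e
  revert a b c d e; decide

/-- If there are no labels, the signs of pairs at distance `1` are all equal, and opposite to those of
pairs at distance `2`. -/
theorem pairSign_values [Finite κ] (hno : ¬ S.HasLabels) :
    ∃ e, ∀ i, D.pairSign i (i + 1) = e ∧ D.pairSign i (i + 2) = !e := by
  have hstep : ∀ i, D.pairSign i (i + 1) ≠ D.pairSign i (i + 2) ∧
      D.pairSign (i + 1) (i + 1 + 1) ≠ D.pairSign i (i + 2) := fun i => by
    constructor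
    · simpa using (D.near_and_pairSign_ne hno i 1 (Or.inl rfl)).1
    · have := (D.near_and_pairSign_ne hno (i + 2) (-1) (Or.inr rfl)).1
      rw [show i + 2 + -1 = i + 1 by ring, show i + 2 + 2 * -1 = i by ring, D.pairSign_comm,
        D.pairSign_comm (i + 2) i] at this
      rwa [show i + 1 + 1 = i + 2 by ring]
  refine ⟨D.pairSign 0 (0 + 1), fun i => ?_⟩
  have h : D.pairSign i (i + 1) = D.pairSign 0 (0 + 1) := by
    have := ZMod.forall_of_iff_succ (A := fun i => D.pairSign i (i + 1) = true) (fun i => by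
      obtain ⟨h1, h2⟩ := hstep i
      revert h1 h2
      generalize D.pairSign i (i + 1) = a, D.pairSign i (i + 2) = b, D.pairSign (i + 1) _ = c
      revert a b c; decide) i 0
    exact Bool.eq_iff_iff.2 this
  refine ⟨h, ?_⟩
  rw [← h]
  exact Bool.eq_not_of_ne (hstep i).1.symm

end RootPath

end CycleSystem

/-! ### The labelling theorem -/

theorem ZMod.five_opposite {n : ℕ} (hn : n = 5) {x y d : ZMod n} (hd : d = 1 ∨ d = -1)
    (h1 : y = x + 2 ∨ y = x - 2) (h2 : x + d = y + 2 ∨ x + d = y - 2) : y = x + 3 * d := by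
  subst hn
  revert x y d
  decide

theorem ZMod.five_beyond {n : ℕ} (hn : n = 5) {x y d : ZMod n} (hd : d = 1 ∨ d = -1)
    (h1 : y = x + 2 ∨ y = x - 2) (h2 : x + d = y + 1 ∨ x + d = y - 1) : y = x + 2 * d := by
  subst hn
  revert x y d
  decide

namespace CycleSystem

variable {κ : Type*} {S : CycleSystem κ}

namespace RootPath

variable (D : S.RootPath)

/-- An edge of the path with at least two places of the first cycle on both of its sides makes labels
possible. -/
theorem no_split [Finite κ] (hno : ¬ S.HasLabels) (t : ℕ) {i j k l : ZMod (S.n (D.v 0))}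
    (hij : i ≠ j) (hi : D.ht i ≤ t) (hj : D.ht j ≤ t) (hkl : k ≠ l) (hk : t < D.ht k)
    (hl : t < D.ht l) : False := by
  have hn := five_le_of_noRoot D.noRoot (D.v 0)
  by_cases h5 : S.n (D.v 0) = 5
  · -- The sign of a pair of places on different sides is a product of two factors.
    obtain ⟨e, he⟩ := D.pairSign_values hno
    have he4 : ∀ i, D.pairSign i (i + 3) = !e := fun i => by
      rw [pairSign_comm, ← (he (i + 3)).2]
      congr 1
      linear_combination -ZMod.five_eq_zero h5
    have hmul : ∀ a b c d : ZMod (S.n (D.v 0)), D.ht a ≤ t → D.ht b ≤ t → t < D.ht c → t < D.ht d →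
        (D.pairSign a c ^^ D.pairSign a d) = (D.pairSign b c ^^ D.pairSign b d) := by
      intro a b c d ha hb hc hd
      have : ∀ a c, D.ht a ≤ t → t < D.ht c → D.pairSign a c = (D.upSign a ^^ D.downSign c) :=
        fun a c ha hc => by
          rw [pairSign, if_neg (by omega), if_pos (by omega)]
      rw [this a c ha hc, this a d ha hd, this b c hb hc, this b d hb hd]
      generalize D.upSign _ = a, D.upSign _ = b, D.downSign _ = c, D.downSign _ = d
      revert a b c d; decide
    have hmul' : ∀ a b c d : ZMod (S.n (D.v 0)), decide (D.ht b ≤ t) = decide (D.ht a ≤ t) →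
        decide (D.ht c ≤ t) = (!decide (D.ht a ≤ t)) → decide (D.ht d ≤ t) = (!decide (D.ht a ≤ t)) →
        (D.pairSign a c ^^ D.pairSign a d) = (D.pairSign b c ^^ D.pairSign b d) := by
      intro a b c d hb hc hd
      by_cases ha : D.ht a ≤ t
      · simp only [ha, decide_true, Bool.not_true, decide_eq_true_eq, decide_eq_false_iff_not,
          not_le] at hb hc hd
        exact hmul a b c d ha hb hc hd
      · simp only [ha, decide_false, Bool.not_false, decide_eq_true_eq, decide_eq_false_iff_not,
          not_le] at hb hc hd
        have := hmul c d a b hc hd (by omega) hb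
        rw [D.pairSign_comm c, D.pairSign_comm c, D.pairSign_comm d, D.pairSign_comm d] at this
        revert this
        generalize D.pairSign _ _ = a, D.pairSign _ _ = b, D.pairSign _ _ = c, D.pairSign _ _ = d
        revert a b c d; decide
    obtain ⟨x, ⟨h1, h2, h3⟩ | ⟨h1, h2, h3⟩⟩ := ZMod.five_patterns h5 (fun i => decide (D.ht i ≤ t))
      ⟨i, j, hij, by simpa using hi, by simpa using hj⟩ ⟨k, l, hkl, by simpa using hk, by simpa using hl⟩
    · have := hmul' x (x + 1) (x + 2) (x + 3) h1 h2 h3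
      rw [(he x).2, he4, show x + 2 = x + 1 + 1 by ring, show x + 3 = x + 1 + 2 by ring, (he _).1,
        (he _).2] at this
      revert this; cases e <;> decide
    · have := hmul' x (x + 2) (x + 1) (x + 3) h2 h1 h3
      rw [(he x).1, he4, D.pairSign_comm (x + 2), show x + 3 = x + 2 + 1 by ring, (he _).1,
        show x + 2 = x + 1 + 1 by ring, (he _).1] at this
      revert this; cases e <;> decide
  have h7 : 7 ≤ S.n (D.v 0) := by
    obtain ⟨r, hr⟩ := S.odd (D.v 0)
    omega
  have h1 := D.mul_ne_zero (d := 1) (Or.inl rfl) (k := 1) (by omega) (by omega)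
  have h2 := D.mul_ne_zero (d := 1) (Or.inl rfl) (k := 2) (by omega) (by omega)
  have h3 := D.mul_ne_zero (d := 1) (Or.inl rfl) (k := 3) (by omega) (by omega)
  have h4 := D.mul_ne_zero (d := 1) (Or.inl rfl) (k := 4) (by omega) (by omega)
  have h5' := D.mul_ne_zero (d := 1) (Or.inl rfl) (k := 5) (by omega) (by omega)
  have h6 := D.mul_ne_zero (d := 1) (Or.inl rfl) (k := 6) (by omega) (by omega)
  push_cast at h1 h2 h3 h4 h5' h6
  rw [mul_one] at h1 h2 h3 h4 h5' h6
  obtain ⟨b, hb⟩ : ∃ b, ¬ (D.ht b ≤ t ↔ D.ht (b + 1) ≤ t) := by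
    by_contra hcon
    push Not at hcon
    have := ZMod.forall_of_iff_succ hcon i k
    omega
  -- All places outside of the window are on the same side of the edge.
  have hout : ∀ a d, (d = 1 ∨ d = -1) → ¬ (D.ht a ≤ t ↔ D.ht (a + d) ≤ t) → ∀ x y,
      (x ≠ a ∧ x ≠ a + d ∧ x ≠ a + 2 * d ∧ x ≠ a + 3 * d) →
      (y ≠ a ∧ y ≠ a + d ∧ y ≠ a + 2 * d ∧ y ≠ a + 3 * d) → (D.ht x ≤ t ↔ D.ht y ≤ t) := by
    intro a d hd had x y hx hy
    by_contra hxy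
    rcases le_or_gt (D.ht x) t with h | h
    · exact hno (D.hasLabels_of_split a d hd t (by omega) x y h (by omega) hx hy)
    · exact hno (D.hasLabels_of_split a d hd t (by omega) y x (by omega) h hy hx)
  have hbase : ∀ x, x ≠ b → x ≠ b + 1 → (D.ht x ≤ t ↔ D.ht (b + 4) ≤ t) := by
    intro x x0 x1
    by_cases c : x ≠ b + 2 ∧ x ≠ b + 3
    · refine hout b 1 (Or.inl rfl) hb x (b + 4) ⟨x0, x1, by simpa using c.1, by simpa using c.2⟩
        ⟨fun h => h4 (by linear_combination h), fun h => h3 (by linear_combination h),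
          fun h => h2 (by linear_combination h), fun h => h1 (by linear_combination h)⟩
    · refine hout (b + 1) (-1) (Or.inr rfl) (by rw [add_neg_cancel_right]; tauto) x (b + 4)
        ⟨x1, by simpa using x0, ?_, ?_⟩
        ⟨fun h => h3 (by linear_combination h), fun h => h4 (by linear_combination h),
          fun h => h5' (by linear_combination h), fun h => h6 (by linear_combination h)⟩
      · rintro rfl
        exact c ⟨fun h => h3 (by linear_combination -h), fun h => h4 (by linear_combination -h)⟩
      · rintro rfl
        exact c ⟨fun h => h4 (by linear_combination -h), fun h => h5' (by linear_combination -h)⟩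
  -- So one side has only one place.
  by_cases hs : D.ht (b + 4) ≤ t
  · have hk' : k = b ∨ k = b + 1 := by by_contra! c; have := (hbase k c.1 c.2).2 hs; omega
    have hl' : l = b ∨ l = b + 1 := by by_contra! c; have := (hbase l c.1 c.2).2 hs; omega
    rcases hk' with rfl | rfl <;> rcases hl' with rfl | rfl <;> first | exact hkl rfl | omega
  · have hi' : i = b ∨ i = b + 1 := by by_contra! c; have := (hbase i c.1 c.2).1 hi; omega
    have hj' : j = b ∨ j = b + 1 := by by_contra! c; have := (hbase j c.1 c.2).1 hj; omega
    rcases hi' with rfl | rfl <;> rcases hj' with rfl | rfl <;> first | exact hij rfl | omega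

/-- If there are no labels, some cycle of the path lies between the neighbours of any two places of the
first cycle: at most one place has its neighbour below that cycle, and at most one above. -/
theorem exists_common_median [Finite κ] (hno : ¬ S.HasLabels) :
    ∃ M, 1 ≤ M ∧ M ≤ D.m ∧ ∀ x y, x ≠ y → D.Apart M x y := by
  classical
  have h1 := D.mul_ne_zero (d := 1) (Or.inl rfl) (k := 1) (by omega)
    (by have := S.three_le (D.v 0); omega)
  have hex : ∃ t i j, i ≠ j ∧ D.ht i ≤ t ∧ D.ht j ≤ t :=
    ⟨D.m, 1, 0, by simpa using h1, D.ht_le _, D.ht_le _⟩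
  obtain ⟨i, j, hij, hi, hj⟩ := Nat.find_spec hex
  have hmin := fun t (ht : t < Nat.find hex) => Nat.find_min hex ht
  have hle : Nat.find hex ≤ D.m := Nat.find_min' hex ⟨1, 0, by simpa using h1, D.ht_le _, D.ht_le _⟩
  revert hi hj hmin hle
  generalize Nat.find hex = M
  intro hi hj hmin hle
  have := D.one_le_ht i
  refine ⟨M, by omega, hle, fun x y hxy => ⟨fun h => ?_, fun h => D.no_split hno M hij hi hj hxy h.1 h.2⟩⟩
  exact hmin (M - 1) (by omega) ⟨x, y, hxy, by omega, by omega⟩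

end RootPath

/-- Labels of a system without roots. All places of the first cycle have different exits at a common
median. If the median has length at least `7`, either two consecutive places have a near and a far
exit as seen from a third one, which makes them flexible, or all exits are near to one of them. In
the latter case the first cycle is a pentagon and two of its five exits are far apart, which is
impossible as any two places of a pentagon are at distance at most `2` and therefore have near
exits. If the median is a pentagon, so is the first cycle, at least three edges join them, and the
signs of the pairs show that these edges form a ladder or are twisted. -/
theorem hasLabels_of_noRoot [Finite κ] [Nonempty κ] (h : ∀ c, ¬ S.IsRoot c) : S.HasLabels := by
  by_contra hno
  obtain ⟨D⟩ := exists_rootPath h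
  obtain ⟨M, hM1, hMm, hap⟩ := D.exists_common_median hno
  obtain ⟨e, he⟩ := D.pairSign_values hno
  have hnC := five_le_of_noRoot h (D.v 0)
  have hnW := five_le_of_noRoot h (D.v M)
  have hz : ∀ x, ∃ y, D.exit M x = ⟨D.v M, y⟩ := fun x => by
    obtain ⟨c, y, hx⟩ : ∃ c y, D.exit M x = ⟨c, y⟩ := ⟨_, _, rfl⟩
    obtain rfl : c = D.v M := by rw [← D.exit_fst hM1 hMm x, hx]
    exact ⟨y, hx⟩
  choose z hz using hz
  have hne : ∀ x y, x ≠ y → z x ≠ z y := fun x y hxy hc =>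
    D.exit_ne (hap x y hxy) hxy (by rw [hz, hz, hc])
  have hzinj : Function.Injective z := fun x y hxy => by
    by_contra hc
    exact hne x y hc hxy
  have hk : ∀ k : ℕ, 0 < k → k < S.n (D.v 0) → (k : ZMod (S.n (D.v 0))) ≠ 0 := fun k =>
    ZMod.natCast_ne_zero_of_lt
  have h1 := hk 1 (by omega) (by omega)
  have h2 := hk 2 (by omega) (by omega)
  push_cast at h1 h2
  have hnear : ∀ f δ, (δ = 1 ∨ δ = -1) → ¬ IsFar (S.n (D.v M)) (z f) (z (f + δ)) ∧
      ¬ IsFar (S.n (D.v M)) (z f) (z (f + 2 * δ)) := by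
    intro f δ hδ
    have m1 := D.mul_ne_zero hδ (k := 1) (by omega) (by omega)
    have m2 := D.mul_ne_zero hδ (k := 2) (by omega) (by omega)
    push_cast at m1 m2
    have := (D.near_and_pairSign_ne hno f δ hδ).2 M hM1 hMm
      (hap _ _ fun h => m1 (by linear_combination -h)) (hap _ _ fun h => m2 (by linear_combination -h))
      (hap _ _ fun h => m1 (by linear_combination -h))
    simpa only [hz, far_mk] using this
  have hCcard : Nat.card (ZMod (S.n (D.v 0))) = S.n (D.v 0) := Nat.card_zmod _
  have hWcard : Nat.card (ZMod (S.n (D.v M))) = S.n (D.v M) := Nat.card_zmod _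
  have hCW : S.n (D.v 0) ≤ S.n (D.v M) := by
    rw [← hCcard, ← hWcard]
    exact Nat.card_le_card_of_injective z hzinj
  obtain ⟨r, hr⟩ := S.odd (D.v 0)
  obtain ⟨r', hr'⟩ := S.odd (D.v M)
  by_cases h7 : 7 ≤ S.n (D.v M)
  · by_cases hfar : ∃ j, IsFar (S.n (D.v M)) (z 0) (z j)
    · -- Some consecutive places avoiding `0` are near to and far from `0`.
      obtain ⟨j, hj⟩ := hfar
      have hnear0 : ∀ x, x = 0 ∨ x = 1 ∨ x = -1 ∨ x = 2 ∨ x = -2 →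
          ¬ IsFar (S.n (D.v M)) (z 0) (z x) := by
        rintro x (rfl | rfl | rfl | rfl | rfl)
        · simp [IsFar]
        · simpa using (hnear 0 1 (Or.inl rfl)).1
        · simpa using (hnear 0 (-1) (Or.inr rfl)).1
        · simpa using (hnear 0 1 (Or.inl rfl)).2
        · simpa using (hnear 0 (-1) (Or.inr rfl)).2
      have hC7 : 7 ≤ S.n (D.v 0) := by
        by_contra hC
        have hC5 : S.n (D.v 0) = 5 := by omega
        have h5 := ZMod.five_eq_zero hC5
        refine hnear0 j ?_ hj
        rcases ZMod.five_cases hC5 (Or.inl rfl) 0 j with c | c | c | c | c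
        · exact Or.inl c
        · right; left; simpa using c
        · right; right; right; left; simpa using c
        · right; right; right; right; linear_combination c + h5
        · right; right; left; linear_combination c + h5
      obtain ⟨b, hb⟩ : ∃ b, ¬ (IsFar (S.n (D.v M)) (z 0) (z b) ↔ IsFar (S.n (D.v M)) (z 0) (z (b + 1))) := by
        by_contra hcon
        push Not at hcon
        exact hnear0 0 (Or.inl rfl) ((ZMod.forall_of_iff_succ hcon j 0).1 hj)
      have b0 : b ≠ 0 := by
        rintro rfl
        exact hb (iff_of_false (hnear0 _ (by simp)) (hnear0 _ (by simp)))
      have b1 : b + 1 ≠ 0 := fun c => by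
        obtain rfl : b = -1 := by linear_combination c
        exact hb (iff_of_false (hnear0 _ (by simp)) (hnear0 _ (by simp)))
      have b2 : b ≠ 1 := by
        rintro rfl
        exact hb (iff_of_false (hnear0 _ (by simp)) (hnear0 _ (by rw [one_add_one_eq_two]; simp)))
      have b3 : b + 2 ≠ 0 := fun c => by
        obtain rfl : b = -2 := by linear_combination c
        exact hb (iff_of_false (hnear0 _ (by simp)) (hnear0 _ (by simp; right; right; left; ring)))
      have hflex : S.Flexible (D.exit M 0) (D.exit M b) (D.exit M (b + 1)) := by
        rw [hz 0, hz b, hz (b + 1)]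
        by_cases c : IsFar (S.n (D.v M)) (z 0) (z b)
        · refine (S.flexible_of_near_of_far (z := ⟨D.v M, z 0⟩) (b := ⟨D.v M, z (b + 1)⟩) hnW rfl ?_ ?_
            ?_).symm
          · simpa using hne _ _ b1
          · rw [far_mk]; tauto
          · rwa [far_mk]
        · refine S.flexible_of_near_of_far (z := ⟨D.v M, z 0⟩) hnW rfl ?_ ?_ ?_
          · simpa using hne _ _ b0
          · rwa [far_mk]
          · rw [far_mk]; tauto
      by_cases c3 : b + 3 = 0
      · refine D.not_flexible hno (a := b + 1) (d := -1) (f := 0) (M := M) (Or.inr rfl)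
          ⟨b1.symm, ?_, ?_, ?_⟩ hM1 hMm (hap _ _ b1.symm) ?_ ?_ ?_
        · simpa using b0.symm
        · intro c; exact b2 (by linear_combination -c)
        · intro c
          exact hk 5 (by omega) (by omega) (by push_cast; linear_combination c3 + c)
        · simpa using hap _ _ b0.symm
        · simpa using hap _ _ (by simpa using h1)
        · simpa using hflex.symm
      · refine D.not_flexible hno (a := b) (d := 1) (f := 0) (M := M) (Or.inl rfl)
          ⟨b0.symm, b1.symm, by simpa using b3.symm, fun c => c3 (by linear_combination -c)⟩ hM1 hMm
          (hap _ _ b0.symm) (hap _ _ b1.symm) (hap _ _ (by simpa using h1)) hflex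
    · -- All exits are near to the one of `0`, so there are too few of them.
      have : NeZero (S.n (D.v 0)) := inferInstance
      have hsub : (Finset.univ.erase (0 : ZMod (S.n (D.v 0)))).image z ⊆
          {z 0 + 1, z 0 - 1, z 0 + 2, z 0 - 2} := by
        intro y hy
        simp only [Finset.mem_image, Finset.mem_erase, Finset.mem_univ, and_true] at hy
        obtain ⟨x, hx, rfl⟩ := hy
        simpa using ZMod.mem_of_not_isFar (hne _ _ hx) (fun c => hfar ⟨x, c⟩)
      have hcard : ((Finset.univ.erase (0 : ZMod (S.n (D.v 0)))).image z).card = S.n (D.v 0) - 1 := by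
        rw [Finset.card_image_of_injective _ hzinj, Finset.card_erase_of_mem (Finset.mem_univ _),
          Finset.card_univ, ZMod.card]
      have h4 : ({z 0 + 1, z 0 - 1, z 0 + 2, z 0 - 2} : Finset (ZMod (S.n (D.v M)))).card ≤ 4 :=
        Finset.card_le_four
      have heq := Finset.eq_of_subset_of_card_le hsub (by omega)
      have hC5 : S.n (D.v 0) = 5 := by
        have := Finset.card_le_card hsub
        omega
      obtain ⟨x, hx⟩ : ∃ x, z x = z 0 + 2 := by
        have : z 0 + 2 ∈ (Finset.univ.erase (0 : ZMod (S.n (D.v 0)))).image z := by rw [heq]; simp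
        obtain ⟨x, -, hx⟩ := Finset.mem_image.1 this
        exact ⟨x, hx⟩
      obtain ⟨y, hy⟩ : ∃ y, z y = z 0 - 2 := by
        have : z 0 - 2 ∈ (Finset.univ.erase (0 : ZMod (S.n (D.v 0)))).image z := by rw [heq]; simp
        obtain ⟨x, -, hx⟩ := Finset.mem_image.1 this
        exact ⟨x, hx⟩
      have hf := ZMod.isFar_of_add_two h7 (z 0)
      rw [← hx, ← hy] at hf
      rcases ZMod.five_cases hC5 (Or.inl rfl) y x with c | c | c | c | c <;> rw [c] at hf
      · simp [IsFar] at hf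
      · exact (hnear y 1 (Or.inl rfl)).1 hf
      · exact (hnear y 1 (Or.inl rfl)).2 hf
      · rw [show y + 3 * 1 = y + 2 * -1 by linear_combination ZMod.five_eq_zero hC5] at hf
        exact (hnear y (-1) (Or.inr rfl)).2 hf
      · rw [show y + 4 * 1 = y + -1 by linear_combination ZMod.five_eq_zero hC5] at hf
        exact (hnear y (-1) (Or.inr rfl)).1 hf
  -- Two pentagons with at least three edges between them.
  have hW5 : S.n (D.v M) = 5 := by omega
  have hC5 : S.n (D.v 0) = 5 := by omega
  have z5 := ZMod.five_eq_zero hC5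
  have hne' : D.v 0 ≠ D.v M := fun c => by
    have := D.inj 0 M (by omega) hMm c
    omega
  have hmate : ∀ i, D.ht i = M → S.mate ⟨D.v 0, i⟩ = some ⟨D.v M, z i⟩ := fun i hi => by
    rw [D.mate_zero, ← hz, RootPath.exit, if_pos hi]
  have hsign : ∀ i j, i ≠ j → D.ht i = M → D.ht j = M →
      signChange (S.n (D.v M)) (z i) (z j) = D.pairSign i j := fun i j hij hi hj => by
    rw [D.pairSign_eq (hap i j hij), RootPath.offset, RootPath.offset, if_pos hi, if_pos hj, hz, hz,
      change_mk]
    simp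
  obtain ⟨j, hj, hj1, hj2⟩ := ZMod.five_triples hC5 (fun i => decide (D.ht i = M)) (by
    intro i j k hij hik hjk
    obtain ⟨a1, a2⟩ := hap i j hij
    obtain ⟨a3, a4⟩ := hap i k hik
    obtain ⟨a5, a6⟩ := hap j k hjk
    simp only [decide_eq_true_eq]
    omega)
  simp only [decide_eq_true_eq] at hj hj1 hj2
  have n1 : ∀ i : ZMod (S.n (D.v 0)), i ≠ i + 1 := fun i c => h1 (by linear_combination -c)
  have n2 : ∀ i : ZMod (S.n (D.v 0)), i ≠ i + 2 := fun i c => h2 (by linear_combination -c)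
  have s1 : ∀ i, D.ht i = M → D.ht (i + 1) = M →
      signChange (S.n (D.v M)) (z i) (z (i + 1)) = e := fun i hi hi' => by
    rw [hsign _ _ (n1 i) hi hi', (he i).1]
  have s2 : ∀ i, D.ht i = M → D.ht (i + 2) = M →
      signChange (S.n (D.v M)) (z i) (z (i + 2)) = !e := fun i hi hi' => by
    rw [hsign _ _ (n2 i) hi hi', (he i).2]
  cases e with
  | false =>
    have := (ZMod.five_signChange hW5 (hne _ _ (n1 j))).1.1 (s1 j hj hj1)
    rw [sub_eq_add_neg] at this
    obtain ⟨d', hd', e'⟩ : ∃ d', (d' = 1 ∨ d' = -1) ∧ z (j + 1) = z j + d' := by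
      rcases this with c | c
      · exact ⟨_, Or.inl rfl, c⟩
      · exact ⟨_, Or.inr rfl, c⟩
    refine hno (hasLabels_of_ladder h hne' j 1 (Or.inl rfl) (z j) d' hd' (hmate _ hj) ?_)
    rw [hmate _ hj1, e']
  | true =>
    have w5 := ZMod.five_eq_zero hW5
    have p1 := (ZMod.five_signChange hW5 (hne _ _ (n1 j))).2.1 (s1 j hj hj1)
    rcases hj2 with hj2 | hj3
    · have p2 := (ZMod.five_signChange hW5 (hne _ _ (n2 j))).1.1 (s2 j hj hj2)
      have e2 : j + 1 + 1 = j + 2 := by ring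
      have p3 := (ZMod.five_signChange hW5 (hne _ _ (n1 (j + 1)))).2.1 (s1 _ hj1 (by rwa [e2]))
      rw [e2] at p3
      rw [sub_eq_add_neg] at p2
      obtain ⟨d', hd', e'⟩ : ∃ d', (d' = 1 ∨ d' = -1) ∧ z (j + 2) = z j + d' := by
        rcases p2 with c | c
        · exact ⟨_, Or.inl rfl, c⟩
        · exact ⟨_, Or.inr rfl, c⟩
      have e3 : z (j + 1) = z j + 3 * d' := ZMod.five_opposite hW5 hd' p1 (e' ▸ p3)
      have tw : Twisted S (D.v 0) (D.v M) j 1 (z j) d' :=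
        ⟨hne', hC5, hW5, Or.inl rfl, hd', hmate _ hj, by rw [hmate _ hj1, e3],
          by rw [mul_one, hmate _ hj2, e']⟩
      exact hno (tw.hasLabels h)
    · have e3' : j + 3 + 2 = j := by linear_combination z5
      have p2 := (ZMod.five_signChange hW5 (hne _ _ (n2 (j + 3)))).1.1 (s2 _ hj3 (by rwa [e3']))
      have e2 : j + 1 + 2 = j + 3 := by ring
      have p3 := (ZMod.five_signChange hW5 (hne _ _ (n2 (j + 1)))).1.1 (s2 _ hj1 (by rwa [e2]))
      rw [e3'] at p2
      rw [e2] at p3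
      obtain ⟨d', hd', e'⟩ : ∃ d', (d' = 1 ∨ d' = -1) ∧ z (j + 3) = z j + d' := by
        rcases p2 with c | c
        · exact ⟨-1, Or.inr rfl, by rw [c]; ring⟩
        · exact ⟨1, Or.inl rfl, by rw [c]; ring⟩
      have e3 : z (j + 1) = z j + 2 * d' := ZMod.five_beyond hW5 hd' p1 (e' ▸ p3)
      have tw : Twisted S (D.v M) (D.v 0) (z j) d' j 1 :=
        ⟨hne'.symm, hW5, hC5, hd', Or.inl rfl, S.mate_symm _ _ (hmate _ hj),
          by rw [mul_one, ← e']; exact S.mate_symm _ _ (hmate _ hj3),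
          by rw [← e3]; exact S.mate_symm _ _ (hmate _ hj1)⟩
      exact hno (tw.hasLabels h)

/-- The labelling theorem: a finite system of odd cycles has labels of its matching edges that are
good on every cycle. -/
theorem hasLabels [Finite κ] (S : CycleSystem κ) : S.HasLabels := by
  by_cases h : ∃ c, S.IsRoot c
  · exact S.exists_labels_of_root h
  · push Not at h
    cases isEmpty_or_nonempty κ with
    | inl _ => exact ⟨fun _ => none, fun _ _ _ => rfl, fun c => isEmptyElim c⟩
    | inr _ => exact hasLabels_of_noRoot h

end CycleSystem

/-! ### Colouring an odd cycle modulo `11` -/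

/-- Two colours of `ZMod 11` at circular distance at least `3`. -/
def ColorsApart (a b : ZMod 11) : Prop := 3 ≤ (a - b).val ∧ (a - b).val ≤ 8

instance : DecidableRel ColorsApart := fun _ _ => inferInstanceAs (Decidable (_ ∧ _))

theorem ColorsApart.symm {a b : ZMod 11} (h : ColorsApart a b) : ColorsApart b a := by
  revert a b; decide

/-- The colour of a matching edge with the given label. -/
def labelColor : Option Bool → ZMod 11
  | none => 0
  | some true => 1
  | some false => -1

/-- The colours `4` and `7` of the alternating parts are compatible with all labels. -/
theorem colorsApart_labelColor (l : Option Bool) :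
    ColorsApart 4 (labelColor l) ∧ ColorsApart 7 (labelColor l) := by
  rcases l with _ | _ | _ <;> decide

/-- `g` colours the edges of the cycle of length `n`, where the edge `i` joins the vertices `i` and
`i + 1`, and is compatible with the labels `w` of the matching edges at the vertices. -/
def IsCycleColoring (n : ℕ) (virt : ZMod n → Prop) (w : ZMod n → Option Bool) (g : ZMod n → ZMod 11) :
    Prop :=
  ∀ i, ColorsApart (g i) (g (i + 1)) ∧ (¬ virt i → ColorsApart (g i) (labelColor (w i)) ∧
    ColorsApart (g (i - 1)) (labelColor (w i)))

/-- The colours of the edges of an odd cycle from the beginning of a window on. -/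
def windowColor (k : ℕ) : ZMod 11 :=
  if k = 0 then 9 else if k = 1 then 6 else if k = 2 then 3 else if k % 2 = 1 then 7 else 4

theorem windowColor_apart (k : ℕ) : ColorsApart (windowColor k) (windowColor (k + 1)) := by
  rcases k with _ | _ | _ | k
  · decide
  · decide
  · decide
  · rcases Nat.mod_two_eq_zero_or_one k with h | h
    · simp [windowColor, show (k + 3) % 2 = 1 by omega, show (k + 3 + 1) % 2 = 0 by omega]; decide
    · simp [windowColor, show (k + 3) % 2 = 0 by omega, show (k + 3 + 1) % 2 = 1 by omega]; decide

/-- The edges after the beginning of a window with `s = 1` get the colours `9, 6, 3`, and then `7, 4`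
alternately up to the beginning of the window. -/
theorem exists_isCycleColoring_pos {n : ℕ} (hodd : Odd n) (hn : 5 ≤ n) (virt : ZMod n → Prop)
    (w : ZMod n → Option Bool) (a : ZMod n) (h0 : w a = some true) (h1 : w (a + 1) = some true)
    (h2 : w (a + 2) ≠ some true) (h3 : w (a + 3) ≠ some true) : ∃ g, IsCycleColoring n virt w g := by
  have : NeZero n := ⟨by omega⟩
  obtain ⟨r, hr⟩ := hodd
  have hlast : windowColor (n - 1) = 4 := by
    obtain ⟨m, hm⟩ : ∃ m, n - 1 = m + 4 := ⟨n - 5, by omega⟩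
    simp [windowColor, hm, show (m + 4) % 2 = 0 by omega]
  have hval : ∀ k : ℕ, k < n → (a + k - a).val = k := fun k hk => by
    rw [add_sub_cancel_left, ZMod.val_cast_of_lt hk]
  have hneg : (a - 1 - a).val = n - 1 := by
    rw [show a - 1 - a = ((n - 1 : ℕ) : ZMod n) by
      rw [Nat.cast_sub (by omega)]; simp]
    exact ZMod.val_cast_of_lt (by omega)
  have hnot : ∀ l : Option Bool, l ≠ some true → ColorsApart 3 (labelColor l) ∧
      ColorsApart 6 (labelColor l) := by
    rintro (_ | _ | _) h
    · decide
    · decide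
    · exact absurd rfl h
  have key : ∀ k : ℕ, k < n → ColorsApart (windowColor k) (labelColor (w (a + k))) ∧
      (k + 1 < n → ColorsApart (windowColor k) (labelColor (w (a + (k + 1 : ℕ))))) := by
    intro k hk
    have h47 := fun i => colorsApart_labelColor (w i)
    rcases k with _ | _ | _ | k
    · simp only [Nat.cast_zero, add_zero, zero_add, Nat.cast_one, h0, h1]
      exact ⟨by decide, fun _ => by decide⟩
    · rw [Nat.cast_two]
      refine ⟨?_, fun _ => (hnot _ h2).2⟩
      simp only [zero_add, Nat.cast_one, h1]; decide
    · simp only [zero_add, Nat.reduceAdd, Nat.cast_ofNat]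
      exact ⟨(hnot _ h2).1, fun _ => (hnot _ h3).1⟩
    · have : windowColor (k + 3) = 7 ∨ windowColor (k + 3) = 4 := by
        rcases Nat.mod_two_eq_zero_or_one k with h | h
        · simp [windowColor, show (k + 3) % 2 = 1 by omega]
        · simp [windowColor, show (k + 3) % 2 = 0 by omega]
      rcases this with e | e <;> rw [e]
      · exact ⟨(h47 _).2, fun _ => (h47 _).2⟩
      · exact ⟨(h47 _).1, fun _ => (h47 _).1⟩
  refine ⟨fun i => windowColor (i - a).val, fun i => ?_⟩
  obtain ⟨k, hk, rfl⟩ : ∃ k : ℕ, k < n ∧ i = a + k :=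
    ⟨(i - a).val, ZMod.val_lt _, by simp⟩
  simp only [hval k hk]
  refine ⟨?_, fun _ => ⟨(key k hk).1, ?_⟩⟩
  · rcases Nat.lt_or_ge (k + 1) n with h | h
    · rw [add_assoc, ← Nat.cast_succ, hval _ h]
      exact windowColor_apart k
    · obtain rfl : k = n - 1 := by omega
      rw [add_assoc, ← Nat.cast_succ, hlast, show (n - 1).succ = n by omega]
      simp [windowColor]
      decide
  · rcases k with _ | k
    · simp only [Nat.cast_zero, add_zero, hneg, hlast]
      exact (colorsApart_labelColor _).1
    · rw [show a + ((k + 1 : ℕ) : ZMod n) - 1 = a + k by push_cast; ring, hval k (by omega)]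
      exact (key k (by omega)).2 hk

/-- Negating the colours negates the labels. -/
theorem IsCycleColoring.neg {n : ℕ} {virt : ZMod n → Prop} {w : ZMod n → Option Bool}
    {g : ZMod n → ZMod 11} (h : IsCycleColoring n virt (fun i => (w i).map not) g) :
    IsCycleColoring n virt w fun i => -g i := by
  have key : ∀ a b, ColorsApart a b → ColorsApart (-a) (-b) := by decide
  have key' : ∀ a l, ColorsApart a (labelColor (Option.map not l)) → ColorsApart (-a) (labelColor l) := by
    intro a l h
    have := key _ _ h
    rcases l with _ | _ | _
    · exact this
    · exact this
    · exact this
  exact fun i => ⟨key _ _ (h i).1, fun hv => ⟨key' _ _ ((h i).2 hv).1, key' _ _ ((h i).2 hv).2⟩⟩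

/-- The reflection `i ↦ -i` of the vertices maps the edge `i` to the edge `-1 - i`. -/
theorem IsCycleColoring.reflect {n : ℕ} {virt : ZMod n → Prop} {w : ZMod n → Option Bool}
    {g : ZMod n → ZMod 11} (h : IsCycleColoring n (fun i => virt (-i)) (fun i => w (-i)) g) :
    IsCycleColoring n virt w fun i => g (-1 - i) := by
  intro i
  refine ⟨?_, fun hv => ?_⟩
  · have := (h (-1 - (i + 1))).1
    rw [show -1 - (i + 1) + 1 = -1 - i by ring] at this
    exact this.symm
  · have := (h (-i)).2 (by simpa only [neg_neg] using hv)
    simp only [neg_neg] at this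
    simp only []
    rw [show -1 - i = -i - 1 by ring, show -1 - (i - 1) = -i by ring]
    exact ⟨this.2, this.1⟩

/-- A cycle whose labels are good has a compatible colouring of its edges. -/
theorem IsGood.exists_isCycleColoring {n : ℕ} (hodd : Odd n) {virt : ZMod n → Prop}
    {w : ZMod n → Option Bool} (h : IsGood n virt w) : ∃ g, IsCycleColoring n virt w g := by
  rcases h with ⟨hn, a, d, s, hd, h0, h1, h2, h3⟩ | ⟨rfl, i, hi, hw⟩
  · have pos : ∀ w : ZMod n → Option Bool, w a = some true → w (a + d) = some true →
        w (a + 2 * d) ≠ some true → w (a + 3 * d) ≠ some true → ∃ g, IsCycleColoring n virt w g := by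
      intro w h0 h1 h2 h3
      rcases hd with rfl | rfl
      · exact exists_isCycleColoring_pos hodd hn virt w a h0 h1 (by simpa using h2) (by simpa using h3)
      · obtain ⟨g, hg⟩ := exists_isCycleColoring_pos hodd hn (fun i => virt (-i)) (fun i => w (-i)) (-a)
          (by simpa using h0) (by simpa [add_comm] using h1)
          (by rwa [show -(-a + 2) = a + 2 * -1 by ring]) (by rwa [show -(-a + 3) = a + 3 * -1 by ring])
        exact ⟨_, hg.reflect⟩
    cases s with
    | true => exact pos w h0 h1 h2 h3
    | false =>
      obtain ⟨g, hg⟩ := pos (fun i => (w i).map not) (by simp [h0]) (by simp [h1])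
        (by simpa using h2) (by simpa using h3)
      exact ⟨_, hg.neg⟩
  · -- The edges at the vertex without matching edge get `3` and `9`, or `2` and `8`.
    have key : ∀ l l' : Option Bool, l ≠ l' → ∃ a b c, ColorsApart a b ∧ ColorsApart b c ∧
        ColorsApart c a ∧ ColorsApart a (labelColor l) ∧ ColorsApart b (labelColor l) ∧
        ColorsApart b (labelColor l') ∧ ColorsApart c (labelColor l') := by
      rintro (_ | _ | _) (_ | _ | _) h
      · exact absurd rfl h
      · exact ⟨8, 5, 2, by decide⟩
      · exact ⟨3, 6, 9, by decide⟩
      · exact ⟨2, 5, 8, by decide⟩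
      · exact absurd rfl h
      · exact ⟨3, 6, 9, by decide⟩
      · exact ⟨9, 6, 3, by decide⟩
      · exact ⟨9, 6, 3, by decide⟩
      · exact absurd rfl h
    obtain ⟨a, b, c, k1, k2, k3, k4, k5, k6, k7⟩ := key _ _ hw
    have h3 : (3 : ZMod 3) = 0 := rfl
    have ne1 : ∀ i : ZMod 3, i + 1 ≠ i := by decide
    have ne2 : ∀ i : ZMod 3, i + 2 ≠ i := by decide
    have ne3 : ∀ i : ZMod 3, i + 2 ≠ i + 1 := by decide
    refine ⟨fun x => if x = i then a else if x = i + 1 then b else c, fun x => ?_⟩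
    have hx : ∀ i x : ZMod 3, x = i ∨ x = i + 1 ∨ x = i + 2 := by decide
    rcases hx i x with rfl | rfl | rfl
    · simp only [if_true, ne1, if_false]
      exact ⟨k1, fun hv => absurd hi hv⟩
    · rw [show i + 1 + 1 = i + 2 by ring, show i + 1 - 1 = i by ring]
      simp only [if_true, ne1, if_false, ne2, ne3]
      exact ⟨k2, fun _ => ⟨k5, k4⟩⟩
    · rw [show i + 2 + 1 = i by linear_combination h3, show i + 2 - 1 = i + 1 by ring]
      simp only [if_true, ne1, if_false, ne2, ne3]
      exact ⟨k3, fun _ => ⟨k7, k6⟩⟩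

/-! ### Odd components of a multigraph of maximum degree `2` -/

/-- A graph that is not `2`-colourable contains an odd cycle, here as a map from `ZMod n`. -/
theorem SimpleGraph.exists_odd_cycle {V : Type*} {G : SimpleGraph V} (h : ¬ G.Colorable 2) :
    ∃ n, Odd n ∧ 3 ≤ n ∧ ∃ e : ZMod n → V, Function.Injective e ∧ ∀ i, G.Adj (e i) (e (i + 1)) := by
  classical
  rw [two_colorable_iff_forall_loop_even] at h
  push Not at h
  have hex : ∃ n, ∃ u, ∃ w : G.Walk u u, w.length = n ∧ Odd n := by
    obtain ⟨u, w, hw⟩ := h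
    exact ⟨_, u, w, rfl, Nat.not_even_iff_odd.1 hw⟩
  obtain ⟨u, w, hw, hodd⟩ := Nat.find_spec hex
  have hmin : ∀ v (w' : G.Walk v v), Odd w'.length → w.length ≤ w'.length := fun v w' h' => by
    rw [hw]
    exact Nat.find_min' hex ⟨v, w', rfl, h'⟩
  rw [← hw] at hodd
  obtain ⟨r, hr⟩ := hodd
  -- The shortest odd closed walk has no repeated vertex.
  have hinj : ∀ i j, i < j → j < w.length → w.getVert i ≠ w.getVert j := by
    intro i j hij hj he
    let w₁ := ((w.take i).append ((w.drop j).copy he.symm rfl))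
    let w₂ := (((w.drop i).take (j - i)).copy rfl (by
      rw [Walk.drop_getVert, Nat.add_sub_cancel' hij.le, he]) : G.Walk (w.getVert i) (w.getVert i))
    have l₁ : w₁.length = i + (w.length - j) := by
      simp only [w₁, Walk.length_append, Walk.length_copy, Walk.take_length, Walk.drop_length]
      omega
    have l₂ : w₂.length = j - i := by
      simp only [w₂, Walk.length_copy, Walk.take_length, Walk.drop_length]
      omega
    rcases Nat.even_or_odd (j - i) with h | h
    · have := hmin _ w₁ (by
        rw [l₁]
        obtain ⟨q, hq⟩ := h
        exact ⟨r - q, by omega⟩)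
      omega
    · have := hmin _ w₂ (by rwa [l₂])
      omega
  have h1 : w.length ≠ 1 := fun h1 => by
    have := w.adj_getVert_succ (i := 0) (by omega)
    rw [show 0 + 1 = w.length by omega, Walk.getVert_length, Walk.getVert_zero] at this
    exact this.ne rfl
  have : NeZero w.length := ⟨by omega⟩
  refine ⟨w.length, ⟨r, hr⟩, by omega, fun i => w.getVert i.val, fun i j hij => ?_, fun i => ?_⟩
  · rcases lt_trichotomy i.val j.val with h | h | h
    · exact absurd hij (hinj _ _ h (ZMod.val_lt _))
    · exact ZMod.val_injective _ h
    · exact absurd hij.symm (hinj _ _ h (ZMod.val_lt _))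
  · have hi := ZMod.val_lt i
    have := w.adj_getVert_succ hi
    simp only
    rcases (show i.val + 1 ≤ w.length by omega).lt_or_eq with h | h
    · rwa [ZMod.val_add_of_lt (by rwa [ZMod.val_one_eq_one_mod, Nat.mod_eq_of_lt (by omega)]),
        ZMod.val_one_eq_one_mod, Nat.mod_eq_of_lt (by omega)]
    · have h0 : i + 1 = 0 := by
        rw [← ZMod.natCast_zmod_val (i + 1), ← ZMod.natCast_zmod_val i, ← Nat.cast_succ]
        simp [h]
      rw [h0, ZMod.val_zero, Walk.getVert_zero]
      rwa [h, Walk.getVert_length] at this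

section Multigraph

variable {α β : Type*}

/-- A cycle of odd length `n` in the multigraph with edge set `R`, with the edges `e i` joining the
vertices `p i` and `p (i + 1)`, that is not connected to any other edge of `R`. -/
structure IsOddComponent (R : Set β) (ends : β → Sym2 α) (n : ℕ) (e : ZMod n → β) (p : ZMod n → α) :
    Prop where
  odd : Odd n
  three_le : 3 ≤ n
  mem : ∀ i, e i ∈ R
  edge_inj : Function.Injective e
  ends_eq : ∀ i, ends (e i) = s(p i, p (i + 1))
  vertex_inj : Function.Injective p
  inc : ∀ i, ∀ g ∈ R, p i ∈ ends g → g = e i ∨ g = e (i - 1)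

variable {R : Set β} {ends : β → Sym2 α}

/-- In a multigraph of maximum degree `2`, a cyclic sequence of an odd number of edges that meet
consecutively is an odd component. -/
theorem exists_isOddComponent (hdeg : ∀ x, ∀ g₁ ∈ R, ∀ g₂ ∈ R, ∀ g₃ ∈ R, x ∈ ends g₁ → x ∈ ends g₂ →
    x ∈ ends g₃ → g₁ = g₂ ∨ g₁ = g₃ ∨ g₂ = g₃) {n : ℕ} (hodd : Odd n) (hn : 3 ≤ n) {e : ZMod n → β}
    (hmem : ∀ i, e i ∈ R) (hinj : Function.Injective e)
    (hadj : ∀ i, ∃ x, x ∈ ends (e i) ∧ x ∈ ends (e (i + 1))) : ∃ p, IsOddComponent R ends n e p := by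
  choose q hq using hadj
  have h1 : (1 : ZMod n) ≠ 0 := by simpa using ZMod.natCast_ne_zero_of_lt (n := n) (k := 1) (by omega) (by omega)
  have h2 : (2 : ZMod n) ≠ 0 := by simpa using ZMod.natCast_ne_zero_of_lt (n := n) (k := 2) (by omega) (by omega)
  have hq' : ∀ i, q (i - 1) ∈ ends (e (i - 1)) ∧ q (i - 1) ∈ ends (e i) := fun i => by
    simpa using hq (i - 1)
  have hpre : ∀ i, e (i - 1) ≠ e i := fun i h => h1 (by linear_combination -hinj h)
  have hinc : ∀ i, ∀ g ∈ R, q (i - 1) ∈ ends g → g = e i ∨ g = e (i - 1) := fun i g hg hx => by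
    rcases hdeg _ g hg _ (hmem i) _ (hmem (i - 1)) hx (hq' i).2 (hq' i).1 with h | h | h
    · exact Or.inl h
    · exact Or.inr h
    · exact absurd h.symm (hpre i)
  have hvinj : ∀ i j, q (i - 1) = q (j - 1) → i = j := by
    intro i j hij
    rcases hinc j _ (hmem i) (hij ▸ (hq' i).2) with h | h
    · exact hinj h
    · rcases hinc j _ (hmem (i - 1)) (hij ▸ (hq' i).1) with h' | h'
      · have a := hinj h
        have b := hinj h'
        exact absurd (show (2 : ZMod n) = 0 by linear_combination a - b) h2
      · exact absurd (h'.trans h.symm) (hpre i)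
  refine ⟨fun i => q (i - 1), hodd, hn, hmem, hinj, fun i => ?_, hvinj, hinc⟩
  rw [← (Sym2.mem_and_mem_iff fun h => h1 (by linear_combination -hvinj _ _ h))]
  refine ⟨(hq' i).2, ?_⟩
  rw [add_sub_cancel_right]
  exact (hq i).1

/-- A multigraph of maximum degree `2` is `2`-edge-colourable apart from its odd components. -/
theorem exists_oddComponents.{u, v} {α : Type v} {β : Type u} {R : Set β} {ends : β → Sym2 α} [Finite β]
    (hdeg : ∀ x, ∀ g₁ ∈ R, ∀ g₂ ∈ R, ∀ g₃ ∈ R, x ∈ ends g₁ → x ∈ ends g₂ →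
      x ∈ ends g₃ → g₁ = g₂ ∨ g₁ = g₃ ∨ g₂ = g₃) :
    ∃ (κ : Type u) (_ : Finite κ) (n : κ → ℕ) (e : ∀ c, ZMod (n c) → β) (p : ∀ c, ZMod (n c) → α)
      (f : β → Bool), (∀ c, IsOddComponent R ends (n c) (e c) (p c)) ∧
      (∀ c c' i j, p c i = p c' j → c = c') ∧
      ∀ g ∈ R, ∀ g' ∈ R, g ≠ g' → ∀ x, x ∈ ends g → x ∈ ends g' → (∃ c i, x = p c i) ∨ f g ≠ f g' := by
  classical
  let L : SimpleGraph β :=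
    { Adj := fun g g' => g ≠ g' ∧ g ∈ R ∧ g' ∈ R ∧ ∃ x, x ∈ ends g ∧ x ∈ ends g'
      symm := ⟨fun g g' h => ⟨h.1.symm, h.2.2.1, h.2.1, h.2.2.2.imp fun x hx => hx.symm⟩⟩
      loopless := ⟨fun g h => h.1 rfl⟩ }
  let part : L.ConnectedComponent → SimpleGraph β := fun c =>
    { Adj := fun g g' => L.Adj g g' ∧ L.connectedComponentMk g = c
      symm := ⟨fun g g' h => ⟨h.1.symm, by
        rw [← SimpleGraph.ConnectedComponent.connectedComponentMk_eq_of_adj h.1, h.2]⟩⟩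
      loopless := ⟨fun g h => h.1.ne rfl⟩ }
  let κ := {c : L.ConnectedComponent // ¬ (part c).Colorable 2}
  have hcyc : ∀ c : κ, ∃ n, ∃ (e : ZMod n → β) (p : ZMod n → α), IsOddComponent R ends n e p ∧
      ∀ i, L.connectedComponentMk (e i) = c.1 := by
    intro c
    obtain ⟨n, hodd, hn, e, hinj, hadj⟩ := SimpleGraph.exists_odd_cycle c.2
    obtain ⟨p, hp⟩ := exists_isOddComponent hdeg hodd hn (fun i => (hadj i).1.2.1) hinj
      (fun i => (hadj i).1.2.2.2)
    exact ⟨n, e, p, hp, fun i => (hadj i).2⟩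
  choose n e p hp hc using hcyc
  have hcol : ∀ c : L.ConnectedComponent, ∃ f : β → Bool, (part c).Colorable 2 →
      ∀ g g', (part c).Adj g g' → f g ≠ f g' := by
    intro c
    by_cases h : (part c).Colorable 2
    · obtain ⟨f⟩ := h
      refine ⟨fun g => decide (f g = 0), fun _ g g' hg => ?_⟩
      have := f.valid hg
      simp only [ne_eq, decide_eq_decide]
      omega
    · exact ⟨fun _ => true, fun h' => absurd h' h⟩
  choose f hf using hcol
  refine ⟨κ, inferInstance, n, e, p, fun g => f (L.connectedComponentMk g) g, hp, ?_, ?_⟩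
  · intro c c' i j hij
    have h1 : p c i ∈ ends (e c i) := by rw [(hp c).ends_eq]; simp
    rcases (hp c').inc j _ ((hp c).mem i) (hij ▸ h1) with h | h
    · exact Subtype.ext (by rw [← hc c i, h, hc])
    · exact Subtype.ext (by rw [← hc c i, h, hc])
  · intro g hg g' hg' hne x hx hx'
    have hL : L.Adj g g' := ⟨hne, hg, hg', x, hx, hx'⟩
    by_cases hk : (part (L.connectedComponentMk g)).Colorable 2
    · right
      have := hf _ hk g g' ⟨hL, rfl⟩
      simp only
      rwa [SimpleGraph.ConnectedComponent.connectedComponentMk_eq_of_adj hL] at this ⊢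
    · left
      -- The odd cycle exhausts its component.
      let c : κ := ⟨L.connectedComponentMk g, hk⟩
      have hreach : L.Reachable (e c 0) g := SimpleGraph.ConnectedComponent.exact (hc c 0)
      have hrange : ∀ g', Relation.ReflTransGen L.Adj (e c 0) g' → ∃ i, g' = e c i := by
        intro g' h
        induction h with
        | refl => exact ⟨0, rfl⟩
        | tail _ h ih =>
          obtain ⟨i, rfl⟩ := ih
          obtain ⟨-, -, hr, y, hy, hy'⟩ := h
          rw [(hp c).ends_eq, Sym2.mem_iff] at hy
          rcases hy with rfl | rfl <;> rcases (hp c).inc _ _ hr hy' with h | h <;> exact ⟨_, h⟩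
      obtain ⟨i, hi⟩ := hrange g ((SimpleGraph.reachable_iff_reflTransGen _ _).1 hreach)
      rw [hi, (hp c).ends_eq, Sym2.mem_iff] at hx
      rcases hx with rfl | rfl <;> exact ⟨c, _, rfl⟩

end Multigraph

/-! ### Colouring from a matching -/

section Multigraph

variable {α β : Type*}

/-- The edges of a multigraph at a vertex. -/
def edgesAt (E : Set β) (ends : β → Sym2 α) (x : α) : Set β := {e ∈ E | x ∈ ends e}

/-- The edge `e` joins the set `A` to its complement. -/
def Crosses (ends : β → Sym2 α) (A : Set α) (e : β) : Prop :=
  (∃ x ∈ ends e, x ∈ A) ∧ ∃ x ∈ ends e, x ∉ A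

/-- The multigraph with edge set `E` has no loops, maximum degree at most `3`, and is
`2`-edge-connected apart from isolated vertices. -/
structure IsSubcubic (E : Set β) (ends : β → Sym2 α) : Prop where
  loopless : ∀ e ∈ E, ¬ (ends e).IsDiag
  degree_le : ∀ x, (edgesAt E ends x).ncard ≤ 3
  cut : ∀ A : Set α, (∃ e ∈ E, ∃ x ∈ ends e, x ∈ A) → (∃ e ∈ E, ∃ x ∈ ends e, x ∉ A) →
    ∃ e ∈ E, ∃ e' ∈ E, e ≠ e' ∧ Crosses ends A e ∧ Crosses ends A e'

/-- The edges in `E` can be coloured such that adjacent edges have circular distance at least `3`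
modulo `11`. -/
def HasColoring (E : Set β) (ends : β → Sym2 α) : Prop :=
  ∃ f : β → ZMod 11, ∀ e ∈ E, ∀ e' ∈ E, e ≠ e' → ∀ x, x ∈ ends e → x ∈ ends e' →
    ColorsApart (f e) (f e')

/-- The multigraph with edge set `E` is isomorphic to the one given by a table of edges. -/
def Models (E : Set β) (ends : β → Sym2 α) {k m : ℕ} (table : Fin m → Sym2 (Fin k)) : Prop :=
  ∃ (idx : Fin m → β) (vtx : Fin k → α), Function.Injective idx ∧ Function.Injective vtx ∧
    Set.range idx = E ∧ ∀ i, ends (idx i) = (table i).map vtx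

/-- The edges of the graph `H₁`. -/
def tableH₁ : Fin 4 → Sym2 (Fin 3) := ![s(0, 1), s(0, 1), s(0, 2), s(2, 1)]

/-- The edges of the graph `H₂`. -/
def tableH₂ : Fin 7 → Sym2 (Fin 5) := ![s(0, 1), s(0, 2), s(0, 3), s(1, 2), s(1, 3), s(2, 4), s(4, 3)]

/-- A triangle whose vertices have degree `3`. -/
structure IsCubicTriangle (E : Set β) (ends : β → Sym2 α) (a b c : α) (t₁ t₂ t₃ : β) : Prop where
  ab : a ≠ b
  ac : a ≠ c
  bc : b ≠ c
  mem₁ : t₁ ∈ E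
  mem₂ : t₂ ∈ E
  mem₃ : t₃ ∈ E
  ends₁ : ends t₁ = s(b, c)
  ends₂ : ends t₂ = s(a, c)
  ends₃ : ends t₃ = s(a, b)
  deg_a : (edgesAt E ends a).ncard = 3
  deg_b : (edgesAt E ends b).ncard = 3
  deg_c : (edgesAt E ends c).ncard = 3

variable {E : Set β} {ends : β → Sym2 α}

theorem vecCons_injective_iff {γ : Type*} {k : ℕ} {a : γ} {v : Fin k → γ} :
    Function.Injective (Matrix.vecCons a v) ↔ a ∉ Set.range v ∧ Function.Injective v :=
  Fin.cons_injective_iff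

/-- Two vertices `u` and `v` with two parallel edges, and joined by a path of length `2` through `z`. -/
theorem models_tableH₁ {u v z : α} {a b c d : β} (hab : a ≠ b) (hac : a ≠ c) (had : a ≠ d)
    (hbc : b ≠ c) (hbd : b ≠ d) (hcd : c ≠ d) (huv : u ≠ v) (huz : u ≠ z) (hvz : v ≠ z)
    (hE : ∀ e, e ∈ E ↔ e = a ∨ e = b ∨ e = c ∨ e = d) (ha : ends a = s(u, v)) (hb : ends b = s(u, v))
    (hc : ends c = s(u, z)) (hd : ends d = s(z, v)) : Models E ends tableH₁ := by
  refine ⟨![a, b, c, d], ![u, v, z], ?_, ?_, ?_, fun i => ?_⟩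
  · simp [vecCons_injective_iff, hab, hac, had, hbc, hbd, hcd, Function.injective_of_subsingleton]
  · simp [vecCons_injective_iff, huv, huz, hvz, Function.injective_of_subsingleton]
  · ext e
    simp only [Set.mem_range, hE, Fin.exists_fin_succ, Matrix.cons_val_zero, Matrix.cons_val_succ,
      IsEmpty.exists_iff, or_false, @eq_comm _ e]
  · fin_cases i
    exacts [ha, hb, hc, hd]

theorem IsSubcubic.ncard_eq_three [Finite β] (h : IsSubcubic E ends) {x : α} {e₁ e₂ e₃ : β}
    (h₁ : e₁ ∈ edgesAt E ends x) (h₂ : e₂ ∈ edgesAt E ends x) (h₃ : e₃ ∈ edgesAt E ends x)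
    (h12 : e₁ ≠ e₂) (h13 : e₁ ≠ e₃) (h23 : e₂ ≠ e₃) :
    (edgesAt E ends x).ncard = 3 ∧ ∀ e ∈ edgesAt E ends x, e = e₁ ∨ e = e₂ ∨ e = e₃ := by
  have h3 : ({e₁, e₂, e₃} : Set β).ncard = 3 := Set.ncard_eq_three.2 ⟨_, _, _, h12, h13, h23, rfl⟩
  have hsub : {e₁, e₂, e₃} ⊆ edgesAt E ends x := by
    rintro e (rfl | rfl | rfl) <;> assumption
  have heq := Set.eq_of_subset_of_ncard_le hsub (by rw [h3]; exact h.degree_le x)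
  rw [← heq]
  exact ⟨h3, fun e he => by simpa using he⟩

/-- Removing a matching that covers all vertices of degree `3` leaves a multigraph of maximum degree
`2`. Its odd components form a cycle system, whose labels give the colours `-1`, `0`, `1` of the matching
edges. The odd components are coloured according to the labels, and the rest by `4` and `7`. -/
theorem IsSubcubic.hasColoring_of_matching [Finite β] (h : IsSubcubic E ends) {M : Set β}
    (hME : M ⊆ E) (hM : ∀ m ∈ M, ∀ m' ∈ M, ∀ x, x ∈ ends m → x ∈ ends m' → m = m')
    (hcov : ∀ x, (edgesAt E ends x).ncard = 3 → ∃ m ∈ M, x ∈ ends m)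
    (htri : ∀ a b c t₁ t₂ t₃, ¬ IsCubicTriangle E ends a b c t₁ t₂ t₃)
    (hH : ¬ Models E ends tableH₁) : HasColoring E ends := by
  classical
  obtain ⟨κ, hκ, n, e, p, f, hp, hpc, hf⟩ := exists_oddComponents (R := E \ M) (ends := ends)
    fun x g₁ h₁ g₂ h₂ g₃ h₃ x₁ x₂ x₃ => by
      by_contra! hne
      obtain ⟨h3, hall⟩ := h.ncard_eq_three (x := x) ⟨h₁.1, x₁⟩ ⟨h₂.1, x₂⟩ ⟨h₃.1, x₃⟩ hne.1 hne.2.1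
        hne.2.2
      obtain ⟨m, hm, hx⟩ := hcov x h3
      rcases hall m ⟨hME hm, hx⟩ with rfl | rfl | rfl
      exacts [h₁.2 hm, h₂.2 hm, h₃.2 hm]
  have hpinj : ∀ x y : (Σ c, ZMod (n c)), p x.1 x.2 = p y.1 y.2 → x = y := by
    rintro ⟨c, i⟩ ⟨c', j⟩ hxy
    obtain rfl := hpc _ _ _ _ hxy
    exact congrArg _ ((hp c).vertex_inj hxy)
  have hpmem : ∀ c i, p c i ∈ ends (e c i) ∧ p c (i + 1) ∈ ends (e c i) := fun c i => by
    rw [(hp c).ends_eq]; simp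
  have hpmem' : ∀ c i, p c i ∈ ends (e c (i - 1)) := fun c i => by
    simpa using (hpmem c (i - 1)).2
  have hcard : ∀ c (k : ℕ), 0 < k → k < n c → (k : ZMod (n c)) ≠ 0 := fun c k =>
    ZMod.natCast_ne_zero_of_lt
  have hone : ∀ c, (1 : ZMod (n c)) ≠ 0 ∧ (2 : ZMod (n c)) ≠ 0 := fun c => by
    have := (hp c).three_le
    exact ⟨by simpa using hcard c 1 (by omega) (by omega), by simpa using hcard c 2 (by omega) (by omega)⟩
  -- A vertex of an odd component with a matching edge has degree `3`.
  have hdeg3 : ∀ c i, (∃ m ∈ M, p c i ∈ ends m) → (edgesAt E ends (p c i)).ncard = 3 := by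
    rintro c i ⟨m, hm, hx⟩
    refine (h.ncard_eq_three (e₁ := e c i) (e₂ := e c (i - 1)) (e₃ := m) ⟨((hp c).mem i).1, (hpmem c i).1⟩
      ⟨((hp c).mem _).1, hpmem' c i⟩ ⟨hME hm, hx⟩ (fun he => ?_) ?_ ?_).1
    · exact (hone c).1 (by linear_combination (hp c).edge_inj he)
    · rintro rfl; exact ((hp c).mem i).2 hm
    · rintro rfl; exact ((hp c).mem _).2 hm
  let Mt : (Σ c, ZMod (n c)) → (Σ c, ZMod (n c)) → Prop := fun x y =>
    ∃ m ∈ M, ends m = s(p x.1 x.2, p y.1 y.2)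
  have hMt : ∀ x y y', Mt x y → Mt x y' → y = y' := by
    rintro x y y' ⟨m, hm, hs⟩ ⟨m', hm', hs'⟩
    obtain rfl := hM m hm m' hm' (p x.1 x.2) (by rw [hs]; simp) (by rw [hs']; simp)
    rw [hs, Sym2.congr_right] at hs'
    exact hpinj _ _ hs'
  let mate : (Σ c, ZMod (n c)) → Option (Σ c, ZMod (n c)) := fun x =>
    if h : ∃ y, Mt x y then some h.choose else none
  have hmate : ∀ x y, mate x = some y ↔ Mt x y := by
    intro x y
    by_cases hx : ∃ y, Mt x y
    · simp only [mate, dif_pos hx, Option.some.injEq]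
      exact ⟨fun he => he ▸ hx.choose_spec, fun he => hMt _ _ _ hx.choose_spec he⟩
    · simp only [mate, dif_neg hx, reduceCtorEq, false_iff]
      exact fun he => hx ⟨y, he⟩
  have hvirt_of : ∀ x y, mate x = some y → ∃ m ∈ M, p x.1 x.2 ∈ ends m := fun x y hxy => by
    obtain ⟨m, hm, hs⟩ := (hmate _ _).1 hxy
    exact ⟨m, hm, by rw [hs]; simp⟩
  have hsymm : ∀ x y, mate x = some y → mate y = some x := fun x y hxy => by
    obtain ⟨m, hm, hs⟩ := (hmate _ _).1 hxy
    exact (hmate _ _).2 ⟨m, hm, by rw [hs, Sym2.eq_swap]⟩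
  let S : CycleSystem κ :=
    { n := n
      odd := fun c => (hp c).odd
      three_le := fun c => (hp c).three_le
      mate := mate
      mate_symm := hsymm
      mate_ne := by
        rintro x hx
        obtain ⟨m, hm, hs⟩ := (hmate _ _).1 hx
        exact h.loopless m (hME hm) (by rw [hs]; simp)
      virt := fun x => ¬ ∃ m ∈ M, p x.1 x.2 ∈ ends m
      mate_of_virt := by
        intro x hx
        cases hy : mate x with
        | none => rfl
        | some y => exact absurd (hvirt_of x y hy) hx
      triangle := by
        intro c hc
        have h3 : (3 : ZMod (n c)) = 0 := by rw [hc]; rfl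
        by_cases hv : ∃ i, ¬ ∃ m ∈ M, p c i ∈ ends m
        · obtain ⟨i, hi⟩ := hv
          refine ⟨i, hi, fun hm => hH ?_⟩
          obtain ⟨m, hm, hs⟩ := (hmate _ _).1 hm
          have hX : ∀ j, j = i ∨ j = i + 1 ∨ j = i + 2 := by
            have key : ∀ (n : ℕ), n = 3 → ∀ i j : ZMod n, j = i ∨ j = i + 1 ∨ j = i + 2 := by
              rintro _ rfl; decide
            exact key _ hc i
          have hat : ∀ j, ∀ g ∈ E, p c j ∈ ends g → g = e c j ∨ g = e c (j - 1) ∨ g = m := by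
            intro j g hg hx
            by_cases hgM : g ∈ M
            · rcases hX j with rfl | rfl | rfl
              · exact absurd ⟨g, hgM, hx⟩ hi
              · exact Or.inr (Or.inr (hM g hgM m hm _ hx (by rw [hs]; simp)))
              · exact Or.inr (Or.inr (hM g hgM m hm _ hx (by rw [hs]; simp)))
            · rcases (hp c).inc j g ⟨hg, hgM⟩ hx with h | h
              · exact Or.inl h
              · exact Or.inr (Or.inl h)
          have e0 : ends (e c i) = s(p c i, p c (i + 1)) := (hp c).ends_eq i
          have e1 : ends (e c (i + 1)) = s(p c (i + 1), p c (i + 2)) := by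
            rw [(hp c).ends_eq, add_assoc, one_add_one_eq_two]
          have e2 : ends (e c (i + 2)) = s(p c (i + 2), p c i) := by
            rw [(hp c).ends_eq]
            congr 3
            linear_combination h3
          have hgE : ∀ g ∈ E, g = m ∨ ∃ j, g = e c j := by
            by_contra! hcon
            obtain ⟨g, hg, hgm, hgc⟩ := hcon
            have hcr : ∀ g ∈ E, ¬ Crosses ends (Set.range (p c)) g := by
              rintro g hg ⟨⟨x, hx, j, rfl⟩, y, hy, hyn⟩
              rcases hat j g hg hx with rfl | rfl | rfl
              · rw [(hp c).ends_eq, Sym2.mem_iff] at hy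
                rcases hy with rfl | rfl <;> exact hyn ⟨_, rfl⟩
              · rw [(hp c).ends_eq, Sym2.mem_iff] at hy
                rcases hy with rfl | rfl <;> exact hyn ⟨_, rfl⟩
              · rw [hs, Sym2.mem_iff] at hy
                rcases hy with rfl | rfl <;> exact hyn ⟨_, rfl⟩
            obtain ⟨x, hx⟩ : ∃ x, x ∈ ends g := by
              induction ends g with
              | h x y => exact ⟨x, by simp⟩
            obtain ⟨g', hg', -, -, -, hc', -⟩ := h.cut (Set.range (p c))
              ⟨_, ((hp c).mem i).1, _, (hpmem c i).1, _, rfl⟩ ⟨g, hg, x, hx, by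
                rintro ⟨j, rfl⟩
                rcases hat j g hg hx with h | h | h
                exacts [hgc _ h, hgc _ h, hgm h]⟩
            exact hcr g' hg' hc'
          have n1 := (hone c).1
          have n2 := (hone c).2
          have hem : ∀ j, e c j ≠ m := by rintro j rfl; exact ((hp c).mem j).2 hm
          refine models_tableH₁ (a := e c (i + 1)) (b := m) (c := e c i) (d := e c (i + 2))
            (u := p c (i + 1)) (v := p c (i + 2)) (z := p c i) (hem _)
            (fun h => n1 (by linear_combination (hp c).edge_inj h))
            (fun h => n1 (by linear_combination -(hp c).edge_inj h)) (hem _).symm (hem _).symm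
            (fun h => n2 (by linear_combination -(hp c).edge_inj h))
            (fun h => n1 (by linear_combination -(hp c).vertex_inj h))
            (fun h => n1 (by linear_combination (hp c).vertex_inj h))
            (fun h => n2 (by linear_combination (hp c).vertex_inj h)) (fun g => ⟨fun hg => ?_, ?_⟩)
            e1 hs (e0.trans Sym2.eq_swap) (e2.trans Sym2.eq_swap)
          · rcases hgE g hg with rfl | ⟨j, rfl⟩
            · exact Or.inr (Or.inl rfl)
            · rcases hX j with rfl | rfl | rfl
              exacts [Or.inr (Or.inr (Or.inl rfl)), Or.inl rfl, Or.inr (Or.inr (Or.inr rfl))]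
          · rintro (rfl | rfl | rfl | rfl)
            exacts [((hp c).mem _).1, hME hm, ((hp c).mem _).1, ((hp c).mem _).1]
        · push Not at hv
          exfalso
          have n1 := (hone c).1
          have n2 := (hone c).2
          refine htri (p c 0) (p c 1) (p c 2) (e c 1) (e c 2) (e c 0) ⟨?_, ?_, ?_, ((hp c).mem _).1,
            ((hp c).mem _).1, ((hp c).mem _).1, ?_, ?_, ?_, hdeg3 _ _ (hv _), hdeg3 _ _ (hv _),
            hdeg3 _ _ (hv _)⟩
          · exact fun h => n1 ((hp c).vertex_inj h).symm
          · exact fun h => n2 ((hp c).vertex_inj h).symm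
          · exact fun h => n1 (by linear_combination -(hp c).vertex_inj h)
          · rw [(hp c).ends_eq, one_add_one_eq_two]
          · rw [(hp c).ends_eq, Sym2.eq_swap, show (2 : ZMod (n c)) + 1 = 0 by linear_combination h3]
          · rw [(hp c).ends_eq, zero_add]
      chord_two := by
        intro c i h5 hm
        by_contra hne
        obtain ⟨y, hy⟩ := Option.ne_none_iff_exists'.1 hne
        have a1 := hvirt_of _ _ hm
        have a2 := hvirt_of _ _ hy
        have a3 := hvirt_of _ _ (hsymm _ _ hm)
        obtain ⟨m, hm, hs⟩ := (hmate _ _).1 hm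
        have n1 := (hone c).1
        have n2 := (hone c).2
        refine htri (p c i) (p c (i + 1)) (p c (i + 2)) (e c (i + 1)) m (e c i) ⟨?_, ?_, ?_,
          ((hp c).mem _).1, hME hm, ((hp c).mem _).1, ?_, hs, ?_, hdeg3 _ _ a1, hdeg3 _ _ a2,
          hdeg3 _ _ a3⟩
        · exact fun h => n1 (by linear_combination -(hp c).vertex_inj h)
        · exact fun h => n2 (by linear_combination -(hp c).vertex_inj h)
        · exact fun h => n1 (by linear_combination -(hp c).vertex_inj h)
        · rw [(hp c).ends_eq, add_assoc, one_add_one_eq_two]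
        · rw [(hp c).ends_eq]
      connected := by
        intro A hA hcl
        by_contra hne
        obtain ⟨c', hc'⟩ := (Set.ne_univ_iff_exists_notMem A).1 hne
        obtain ⟨c, hcA⟩ := hA
        obtain ⟨g, hg, -, -, -, ⟨⟨x, hx, y, hyA, rfl⟩, z, hz, hzn⟩, -⟩ := h.cut
          {x | ∃ y : (Σ c, ZMod (n c)), y.1 ∈ A ∧ p y.1 y.2 = x}
          ⟨_, ((hp c).mem 0).1, _, (hpmem c 0).1, ⟨c, 0⟩, hcA, rfl⟩
          ⟨_, ((hp c').mem 0).1, _, (hpmem c' 0).1, fun ⟨y, hy, hyp⟩ => hc' (by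
            rw [hpinj y ⟨c', 0⟩ hyp] at hy; exact hy)⟩
        have hin : ∀ c i, c ∈ A → p c i ∈ {x | ∃ y : (Σ c, ZMod (n c)), y.1 ∈ A ∧ p y.1 y.2 = x} :=
          fun c i hc => ⟨⟨c, i⟩, hc, rfl⟩
        apply hzn
        by_cases hgM : g ∈ M
        · obtain ⟨y', hy', hyA'⟩ := hcl y hyA
          obtain ⟨m, hm, hs⟩ := (hmate _ _).1 hy'
          obtain rfl := hM g hgM m hm _ hx (by rw [hs]; simp)
          rw [hs, Sym2.mem_iff] at hz
          rcases hz with rfl | rfl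
          exacts [⟨y, hyA, rfl⟩, ⟨y', hyA', rfl⟩]
        · rcases (hp y.1).inc y.2 g ⟨hg, hgM⟩ hx with rfl | rfl <;>
            rw [(hp y.1).ends_eq, Sym2.mem_iff] at hz <;> rcases hz with hz | hz <;>
            rw [hz] <;> exact hin _ _ hyA }
  obtain ⟨w, hwm, hgood⟩ := S.hasLabels
  have hcol : ∀ c, ∃ γ : ZMod (n c) → ZMod 11, IsCycleColoring (n c)
      (fun i => ¬ ∃ m ∈ M, p c i ∈ ends m) (fun i => w ⟨c, i⟩) γ := fun c =>
    (hgood c).exists_isCycleColoring (hp c).odd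
  choose γ hγ using hcol
  let F : β → ZMod 11 := fun g =>
    if g ∈ M then if h : ∃ x : (Σ c, ZMod (n c)), p x.1 x.2 ∈ ends g then labelColor (w h.choose) else 0
    else if h : ∃ x : (Σ c, ZMod (n c)), g = e x.1 x.2 then γ h.choose.1 h.choose.2
    else if f g then 4 else 7
  have hF_M : ∀ m ∈ M, ∃ l, F m = labelColor l := by
    intro m hm
    simp only [F, if_pos hm]
    split_ifs
    · exact ⟨_, rfl⟩
    · exact ⟨none, rfl⟩
  have hF_Mp : ∀ m ∈ M, ∀ c i, p c i ∈ ends m → F m = labelColor (w ⟨c, i⟩) := by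
    intro m hm c i hx
    have hex : ∃ x : (Σ c, ZMod (n c)), p x.1 x.2 ∈ ends m := ⟨⟨c, i⟩, hx⟩
    simp only [F, if_pos hm, dif_pos hex]
    by_cases hne : hex.choose = ⟨c, i⟩
    · rw [hne]
    · refine congrArg _ (hwm _ _ ((hmate _ _).2 ⟨m, hm, ?_⟩))
      exact (Sym2.mem_and_mem_iff fun he => hne (hpinj _ _ he)).1 ⟨hex.choose_spec, hx⟩
  have heinj : ∀ x y : (Σ c, ZMod (n c)), e x.1 x.2 = e y.1 y.2 → x = y := by
    rintro ⟨c, i⟩ ⟨c', j⟩ hxy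
    have h1 := (hpmem c i).1
    rw [hxy, (hp c').ends_eq, Sym2.mem_iff] at h1
    obtain rfl : c = c' := by rcases h1 with h1 | h1 <;> exact hpc _ _ _ _ h1
    exact congrArg _ ((hp c).edge_inj hxy)
  have hF_e : ∀ c i, F (e c i) = γ c i := by
    intro c i
    have hex : ∃ x : (Σ c, ZMod (n c)), e c i = e x.1 x.2 := ⟨⟨c, i⟩, rfl⟩
    simp only [F, if_neg ((hp c).mem i).2, dif_pos hex]
    rw [← heinj ⟨c, i⟩ _ hex.choose_spec]
  have hF_f : ∀ g ∈ E \ M, (¬ ∃ x : (Σ c, ZMod (n c)), g = e x.1 x.2) → F g = if f g then 4 else 7 := by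
    intro g hg hno
    simp only [F, if_neg hg.2, dif_neg hno]
  have hRM : ∀ g ∈ E, g ∉ M → ∀ m ∈ M, ∀ x, x ∈ ends g → x ∈ ends m → ColorsApart (F g) (F m) := by
    intro g hg hgM m hm x hx hx'
    by_cases hex : ∃ x : (Σ c, ZMod (n c)), g = e x.1 x.2
    · obtain ⟨⟨c, i⟩, rfl⟩ := hex
      rw [hF_e]
      rw [(hp c).ends_eq, Sym2.mem_iff] at hx
      rcases hx with rfl | rfl
      · rw [hF_Mp m hm _ _ hx']
        exact ((hγ c i).2 (not_not.2 ⟨m, hm, hx'⟩)).1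
      · rw [hF_Mp m hm _ _ hx']
        have := ((hγ c (i + 1)).2 (not_not.2 ⟨m, hm, hx'⟩)).2
        rwa [add_sub_cancel_right] at this
    · obtain ⟨l, hl⟩ := hF_M m hm
      rw [hF_f g ⟨hg, hgM⟩ hex, hl]
      split_ifs
      exacts [(colorsApart_labelColor l).1, (colorsApart_labelColor l).2]
  refine ⟨F, fun g hg g' hg' hne x hx hx' => ?_⟩
  by_cases hgM : g ∈ M <;> by_cases hgM' : g' ∈ M
  · exact absurd (hM g hgM g' hgM' x hx hx') hne
  · exact (hRM g' hg' hgM' g hgM x hx' hx).symm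
  · exact hRM g hg hgM g' hgM' x hx hx'
  · by_cases hex : ∃ c i, x = p c i
    · obtain ⟨c, i, rfl⟩ := hex
      have hstep : ColorsApart (γ c (i - 1)) (γ c i) := by simpa using (hγ c (i - 1)).1
      rcases (hp c).inc i g ⟨hg, hgM⟩ hx with rfl | rfl <;>
        rcases (hp c).inc i g' ⟨hg', hgM'⟩ hx' with rfl | rfl
      · exact absurd rfl hne
      · rw [hF_e, hF_e]; exact hstep.symm
      · rw [hF_e, hF_e]; exact hstep
      · exact absurd rfl hne
    · have hno : ∀ g, x ∈ ends g → ¬ ∃ y : (Σ c, ZMod (n c)), g = e y.1 y.2 := by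
        rintro g hx ⟨y, rfl⟩
        rw [(hp y.1).ends_eq, Sym2.mem_iff] at hx
        rcases hx with hx | hx <;> exact hex ⟨_, _, hx⟩
      have := (hf g ⟨hg, hgM⟩ g' ⟨hg', hgM'⟩ hne x hx hx').resolve_left hex
      rw [hF_f g ⟨hg, hgM⟩ (hno g hx), hF_f g' ⟨hg', hgM'⟩ (hno g' hx')]
      revert this
      generalize f g = a, f g' = b
      revert a b; decide

end Multigraph

/-! ### A matching that covers the vertices of degree `3` -/

section Multigraph

variable {α β : Type*} {E : Set β} {ends : β → Sym2 α}

/-- The handshake lemma for an odd set of vertices of degree `3`: an odd number of edges leaves it. -/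
theorem odd_ncard_crosses [Finite α] [Finite β] (hl : ∀ e ∈ E, ¬ (ends e).IsDiag) {X : Set α}
    (hX : ∀ x ∈ X, (edgesAt E ends x).ncard = 3) (hodd : Odd X.ncard) :
    Odd {e ∈ E | Crosses ends X e}.ncard := by
  classical
  have := Fintype.ofFinite α
  have := Fintype.ofFinite β
  have h1 : ∑ x ∈ X.toFinset, (E.toFinset.filter fun e => x ∈ ends e).card =
      ∑ e ∈ E.toFinset, (X.toFinset.filter fun x => x ∈ ends e).card :=
    Finset.sum_card_bipartiteAbove_eq_sum_card_bipartiteBelow _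
  have h2 : ∑ x ∈ X.toFinset, (E.toFinset.filter fun e => x ∈ ends e).card = X.ncard * 3 := by
    rw [Finset.sum_const_nat (m := 3), Set.ncard_eq_toFinset_card']
    intro x hx
    rw [← hX x (by simpa using hx), Set.ncard_eq_toFinset_card']
    congr 1
    ext e
    rw [Set.mem_toFinset, Finset.mem_filter, Set.mem_toFinset]
    rfl
  have h3 : Odd (∑ e ∈ E.toFinset, (X.toFinset.filter fun x => x ∈ ends e).card) := by
    rw [← h1, h2]
    exact hodd.mul (by decide)
  rw [Finset.odd_sum_iff_odd_card_odd] at h3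
  convert h3
  rw [Set.ncard_eq_toFinset_card']
  congr 1
  ext e
  simp only [Set.mem_toFinset, Set.mem_ofPred_eq, Finset.mem_filter]
  refine and_congr_right fun he => ?_
  have hd := hl e he
  unfold Crosses
  revert hd
  induction ends e with
  | h u v =>
    intro hd
    have huv : u ≠ v := by simpa using hd
    have hf : (X.toFinset.filter fun x => x ∈ s(u, v)) =
        (if u ∈ X then {u} else ∅) ∪ (if v ∈ X then {v} else ∅) := by
      ext x
      by_cases hu : u ∈ X <;> by_cases hv : v ∈ X <;> simp [hu, hv] <;> aesop
    rw [hf]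
    by_cases hu : u ∈ X <;> by_cases hv : v ∈ X <;> simp [hu, hv, huv]

/-- In a subcubic `2`-edge-connected multigraph some matching covers all vertices of degree `3`. By
Tutte's theorem this follows from the fact that at least three edges leave an odd set of such
vertices; all other vertices, and one more vertex if their number is odd, are made
pairwise adjacent. -/
theorem IsSubcubic.exists_matching [Finite α] [Finite β] (h : IsSubcubic E ends) :
    ∃ M ⊆ E, (∀ m ∈ M, ∀ m' ∈ M, ∀ x, x ∈ ends m → x ∈ ends m' → m = m') ∧
      ∀ x, (edgesAt E ends x).ncard = 3 → ∃ m ∈ M, x ∈ ends m := by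
  classical
  have := Fintype.ofFinite α
  have := Fintype.ofFinite β
  let W := α ⊕ Fin (Nat.card α % 2)
  let Free : W → Prop := fun u => ∀ x, u = Sum.inl x → (edgesAt E ends x).ncard ≠ 3
  let G : SimpleGraph W :=
    { Adj := fun u v => u ≠ v ∧ ((Free u ∧ Free v) ∨
        ∃ e ∈ E, ∃ x y, u = Sum.inl x ∧ v = Sum.inl y ∧ ends e = s(x, y))
      symm := ⟨by
        rintro u v ⟨hne, ⟨h1, h2⟩ | ⟨e, he, x, y, rfl, rfl, hs⟩⟩
        · exact ⟨hne.symm, Or.inl ⟨h2, h1⟩⟩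
        · exact ⟨hne.symm, Or.inr ⟨e, he, y, x, rfl, rfl, hs.trans Sym2.eq_swap⟩⟩⟩
      loopless := ⟨fun u h => h.1 rfl⟩ }
  have hW : Even (Nat.card W) := by
    rw [Nat.card_sum, Nat.card_fin, Nat.even_iff]
    omega
  have hmatch : ∃ M : G.Subgraph, M.IsPerfectMatching := by
    rw [SimpleGraph.tutte]
    intro U hU
    unfold SimpleGraph.IsTutteViolator at hU
    let D := (⊤ : G.Subgraph).deleteVerts U
    have hDv : D.verts = Uᶜ := by
      simp [D, Set.compl_eq_univ_sdiff]
    have hDadj : ∀ u v : D.verts, D.coe.Adj u v ↔ G.Adj u v := by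
      rintro ⟨u, hu⟩ ⟨v, hv⟩
      rw [hDv] at hu hv
      simp only [D, SimpleGraph.Subgraph.coe_adj, SimpleGraph.Subgraph.deleteVerts_adj,
        SimpleGraph.Subgraph.verts_top, Set.mem_univ, true_and, SimpleGraph.Subgraph.top_adj]
      exact ⟨fun h => h.2.2, fun h => ⟨hu, hv, h⟩⟩
    have hpar : U.ncard + 2 ≤ D.coe.oddComponents.ncard := by
      have h1 : Odd D.coe.oddComponents.ncard ↔ Odd (Nat.card D.verts) :=
        SimpleGraph.odd_ncard_oddComponents _
      have h2 : Nat.card D.verts + U.ncard = Nat.card W := by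
        rw [Nat.card_coe_set_eq, hDv, add_comm, Set.ncard_add_ncard_compl]
      have h3 : U.ncard < D.coe.oddComponents.ncard := hU
      rw [Nat.even_iff] at hW
      rw [Nat.odd_iff, Nat.odd_iff] at h1
      omega
    -- Free vertices are adjacent to each other, so at most one odd component has one.
    let C : Set D.coe.ConnectedComponent := {c ∈ D.coe.oddComponents | ∀ u ∈ c.supp, ¬ Free u.1}
    have hC : U.ncard + 1 ≤ C.ncard := by
      have hsub : (D.coe.oddComponents \ C).ncard ≤ 1 := by
        rw [Set.ncard_le_one]
        rintro c ⟨hc, hcC⟩ c' ⟨hc', hcC'⟩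
        obtain ⟨u, hu, hfu⟩ : ∃ u ∈ c.supp, Free u.1 := by
          by_contra! hcon
          exact hcC ⟨hc, hcon⟩
        obtain ⟨u', hu', hfu'⟩ : ∃ u ∈ c'.supp, Free u.1 := by
          by_contra! hcon
          exact hcC' ⟨hc', hcon⟩
        rw [SimpleGraph.ConnectedComponent.mem_supp_iff] at hu hu'
        rw [← hu, ← hu']
        by_cases he : u = u'
        · rw [he]
        · exact SimpleGraph.ConnectedComponent.connectedComponentMk_eq_of_adj
            ((hDadj _ _).2 ⟨fun h => he (Subtype.ext h), Or.inl ⟨hfu, hfu'⟩⟩)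
      have := Set.ncard_sdiff_add_ncard_of_subset (s := C) (t := D.coe.oddComponents) fun c hc => hc.1
      omega
    let X : D.coe.ConnectedComponent → Set α := fun c => {x | ∃ hx, (⟨Sum.inl x, hx⟩ : D.verts) ∈ c.supp}
    let B : D.coe.ConnectedComponent → Set β := fun c => {e ∈ E | Crosses ends (X c) e}
    have hB : ∀ c, ∀ e ∈ B c, ∃ x y, ends e = s(x, y) ∧ x ∈ X c ∧ Sum.inl y ∈ U := by
      rintro c e ⟨he, ⟨x, hx, hxX⟩, y, hy, hyX⟩
      have hs : ends e = s(x, y) := ((Sym2.mem_and_mem_iff (by rintro rfl; exact hyX hxX)).1 ⟨hx, hy⟩)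
      refine ⟨x, y, hs, hxX, ?_⟩
      by_contra hyU
      obtain ⟨hxD, hxc⟩ := hxX
      have hyD : Sum.inl y ∈ D.verts := by rw [hDv]; exact hyU
      refine hyX ⟨hyD, ?_⟩
      rw [SimpleGraph.ConnectedComponent.mem_supp_iff] at hxc ⊢
      rw [← hxc]
      refine SimpleGraph.ConnectedComponent.connectedComponentMk_eq_of_adj ((hDadj _ _).2 ⟨?_, Or.inr
        ⟨e, he, y, x, rfl, rfl, hs.trans Sym2.eq_swap⟩⟩)
      intro hyx
      refine h.loopless e he ?_
      rw [hs, Sym2.mk_isDiag_iff, Sum.inl_injective hyx]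
    have hB3 : ∀ c ∈ C, 3 ≤ (B c).ncard := by
      rintro c ⟨hc, hcf⟩
      have hdeg : ∀ x ∈ X c, (edgesAt E ends x).ncard = 3 := by
        rintro x ⟨hx, hxc⟩
        by_contra hne
        exact hcf _ hxc fun y hy => by
          rw [← Sum.inl_injective hy]
          exact hne
      have hXodd : Odd (X c).ncard := by
        have : (X c).ncard = c.supp.ncard := by
          refine Set.ncard_congr (fun x hx => ⟨Sum.inl x, hx.1⟩) (fun x hx => hx.2) ?_ ?_
          · intro x y hx hy hxy
            exact Sum.inl_injective (congrArg Subtype.val hxy)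
          · rintro ⟨u | u, hu⟩ huc
            · exact ⟨u, ⟨hu, huc⟩, rfl⟩
            · exact absurd (fun x hx => by cases hx) (hcf _ huc)
        rw [this]
        exact hc
      have hodd : Odd (B c).ncard := odd_ncard_crosses h.loopless hdeg hXodd
      obtain ⟨e, he⟩ : (B c).Nonempty := Set.nonempty_of_ncard_ne_zero hodd.pos.ne'
      obtain ⟨e₁, h1, e₂, h2, hne, hc1, hc2⟩ := h.cut (X c) ⟨e, he.1, he.2.1⟩ ⟨e, he.1, he.2.2⟩
      have : 1 < (B c).ncard := (Set.one_lt_ncard).2 ⟨e₁, ⟨h1, hc1⟩, e₂, ⟨h2, hc2⟩, hne⟩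
      obtain ⟨r, hr⟩ := hodd
      omega
    have hdisj : ∀ c c', ∀ e ∈ B c, e ∈ B c' → c = c' := by
      intro c c' e he he'
      obtain ⟨x, y, hs, ⟨hxD, hx⟩, hy⟩ := hB c e he
      obtain ⟨x', y', hs', ⟨hxD', hx'⟩, hy'⟩ := hB c' e he'
      rw [hs, Sym2.eq_iff] at hs'
      rcases hs' with ⟨rfl, rfl⟩ | ⟨rfl, rfl⟩
      · rw [SimpleGraph.ConnectedComponent.mem_supp_iff] at hx hx'
        rw [← hx, ← hx']
      · rw [hDv] at hxD
        exact absurd hy' hxD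
    let Uα : Set α := {x | Sum.inl x ∈ U}
    have hUα : Uα.ncard ≤ U.ncard :=
      Set.ncard_le_ncard_of_injOn Sum.inl (fun x hx => hx) (Sum.inl_injective.injOn)
    have c1 : C.toFinset.card * 3 ≤ ∑ c ∈ C.toFinset, (B c).toFinset.card := by
      rw [← smul_eq_mul]
      refine Finset.card_nsmul_le_sum _ _ _ fun c hc => ?_
      rw [← Set.ncard_eq_toFinset_card']
      exact hB3 c (by simpa using hc)
    have c2 : ∑ c ∈ C.toFinset, (B c).toFinset.card = (C.toFinset.biUnion fun c => (B c).toFinset).card := by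
      refine (Finset.card_biUnion fun c _ c' _ hne => ?_).symm
      refine Finset.disjoint_left.2 fun e he he' => ?_
      exact hne (hdisj c c' e (by simpa using he) (by simpa using he'))
    have c3 : (C.toFinset.biUnion fun c => (B c).toFinset).card ≤
        (Uα.toFinset.biUnion fun x => (edgesAt E ends x).toFinset).card := by
      refine Finset.card_le_card fun e he => ?_
      simp only [Finset.mem_biUnion, Set.mem_toFinset] at he ⊢
      obtain ⟨c, -, he⟩ := he
      obtain ⟨x, y, hs, -, hy⟩ := hB c e he
      exact ⟨y, hy, he.1, by rw [hs]; simp⟩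
    have c4 : (Uα.toFinset.biUnion fun x => (edgesAt E ends x).toFinset).card ≤ Uα.toFinset.card * 3 := by
      refine Finset.card_biUnion_le_card_mul _ _ _ fun x _ => ?_
      rw [← Set.ncard_eq_toFinset_card']
      exact h.degree_le x
    rw [← Set.ncard_eq_toFinset_card'] at c1 c4
    omega
  obtain ⟨M, hM, hspan⟩ := hmatch
  let m : Set β := {e | ∃ x y, (edgesAt E ends x).ncard = 3 ∧ M.Adj (Sum.inl x) (Sum.inl y) ∧
    ∃ hex : ∃ e ∈ E, ends e = s(x, y), e = hex.choose}
  refine ⟨m, ?_, ?_, ?_⟩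
  · rintro e ⟨x, y, -, -, hex, rfl⟩
    exact hex.choose_spec.1
  · rintro e ⟨x, y, -, hadj, hex, rfl⟩ e' ⟨x', y', -, hadj', hex', rfl⟩ z hz hz'
    have huniq : ∀ a b c, M.Adj (Sum.inl a) (Sum.inl b) → M.Adj (Sum.inl a) (Sum.inl c) → b = c :=
      fun a b c hb hc => Sum.inl_injective
        ((hM (M.edge_vert hb)).unique hb hc)
    rw [hex.choose_spec.2, Sym2.mem_iff] at hz
    rw [hex'.choose_spec.2, Sym2.mem_iff] at hz'
    have hs : s(x, y) = s(x', y') := by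
      rcases hz with rfl | rfl <;> rcases hz' with rfl | rfl
      · rw [huniq _ _ _ hadj hadj']
      · rw [huniq _ _ _ hadj hadj'.symm, Sym2.eq_swap]
      · rw [huniq _ _ _ hadj.symm hadj', Sym2.eq_swap]
      · rw [huniq _ _ _ hadj.symm hadj'.symm]
    simp only [hs]
  · intro x hx
    obtain ⟨w, hw, -⟩ := hM (hspan (Sum.inl x))
    obtain ⟨-, ⟨hf, -⟩ | ⟨e, he, x', y, hx', rfl, hs⟩⟩ := M.adj_sub hw
    · exact absurd hx (hf x rfl)
    · obtain rfl := Sum.inl_injective hx'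
      have hex : ∃ e ∈ E, ends e = s(x, y) := ⟨e, he, hs⟩
      exact ⟨_, ⟨x, y, hx, hw, hex, rfl⟩, by rw [hex.choose_spec.2]; simp⟩

end Multigraph

/-! ### Contracting triangles -/

section Multigraph

variable {α β : Type*} {E : Set β} {ends : β → Sym2 α}

/-- Renumbering the vertices by `σ` and the edges by `τ`. -/
theorem Models.reindex {k m : ℕ} {table table' : Fin m → Sym2 (Fin k)} {idx : Fin m → β}
    {vtx : Fin k → α} (hidx : Function.Injective idx) (hvtx : Function.Injective vtx)
    (hE : Set.range idx = E) (hends : ∀ i, ends (idx i) = (table i).map vtx) {τ : Fin m → Fin m}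
    {σ : Fin k → Fin k} (hτ : Function.Injective τ) (hσ : Function.Injective σ)
    (h : ∀ i, table (τ i) = (table' i).map σ) :
    Function.Injective (idx ∘ τ) ∧ Function.Injective (vtx ∘ σ) ∧ Set.range (idx ∘ τ) = E ∧
      ∀ i, ends ((idx ∘ τ) i) = (table' i).map (vtx ∘ σ) := by
  refine ⟨hidx.comp hτ, hvtx.comp hσ, ?_, fun i => ?_⟩
  · rw [(Finite.injective_iff_surjective.1 hτ).range_comp, hE]
  · rw [Function.comp_apply, hends, h, Sym2.map_map]

/-- A colouring can be given by its values in a table. -/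
theorem Models.hasColoring {k m : ℕ} {table : Fin m → Sym2 (Fin k)} (h : Models E ends table)
    (col : Fin m → ZMod 11) (hcol : ∀ i j, i ≠ j → (∃ x, x ∈ table i ∧ x ∈ table j) →
      ColorsApart (col i) (col j)) : HasColoring E ends := by
  obtain ⟨idx, vtx, hidx, hvtx, rfl, hends⟩ := h
  refine ⟨Function.extend idx col 0, ?_⟩
  rintro _ ⟨i, rfl⟩ _ ⟨j, rfl⟩ hne x hx hx'
  rw [hidx.extend_apply, hidx.extend_apply]
  refine hcol i j (fun h => hne (h ▸ rfl)) ?_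
  rw [hends, Sym2.mem_map] at hx hx'
  obtain ⟨y, hy, rfl⟩ := hx
  obtain ⟨z, hz, he⟩ := hx'
  exact ⟨y, hy, hvtx he ▸ hz⟩

/-- The map that contracts the vertices `a`, `b`, `c` to `a`. -/
noncomputable def contract (a b c x : α) : α :=
  open Classical in if x = b ∨ x = c then a else x

theorem contract_of_mem {a b c x : α} (hx : x ∈ ({a, b, c} : Set α)) : contract a b c x = a := by
  unfold contract
  rcases hx with rfl | rfl | rfl <;> simp

theorem contract_of_notMem {a b c x : α} (hx : x ∉ ({a, b, c} : Set α)) : contract a b c x = x := by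
  simp only [Set.mem_insert_iff, Set.mem_singleton_iff, not_or] at hx
  simp [contract, hx.2]

theorem contract_eq_iff {a b c x : α} : contract a b c x = a ↔ x ∈ ({a, b, c} : Set α) := by
  refine ⟨fun h => ?_, contract_of_mem⟩
  by_contra hx
  rw [contract_of_notMem hx] at h
  exact hx (by simp [h])

namespace IsCubicTriangle

variable {a b c : α} {t₁ t₂ t₃ : β} (T : IsCubicTriangle E ends a b c t₁ t₂ t₃)
include T

theorem t_ne : t₁ ≠ t₂ ∧ t₁ ≠ t₃ ∧ t₂ ≠ t₃ := by
  have h1 := T.ends₁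
  have h2 := T.ends₂
  have h3 := T.ends₃
  have := T.ab
  have := T.ac
  have := T.bc
  refine ⟨?_, ?_, ?_⟩ <;> rintro rfl
  · rw [h1, Sym2.eq_iff] at h2; tauto
  · rw [h1, Sym2.eq_iff] at h3; tauto
  · rw [h2, Sym2.eq_iff] at h3; tauto

theorem mem_of_mem_ends {t : β} (ht : t ∈ ({t₁, t₂, t₃} : Set β)) {x : α} (hx : x ∈ ends t) :
    x ∈ ({a, b, c} : Set α) := by
  rcases ht with rfl | rfl | rfl
  · rw [T.ends₁, Sym2.mem_iff] at hx; simp; tauto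
  · rw [T.ends₂, Sym2.mem_iff] at hx; simp; tauto
  · rw [T.ends₃, Sym2.mem_iff] at hx; simp; tauto

/-- Each vertex of the triangle has one more edge. -/
theorem exists_third {x : α} (hx : x ∈ ({a, b, c} : Set α)) : ∃ g ∈ E \ {t₁, t₂, t₃}, x ∈ ends g ∧
    ∀ e ∈ E \ {t₁, t₂, t₃}, x ∈ ends e → e = g := by
  have key : ∀ (x : α) (t t' t'' : β), (edgesAt E ends x).ncard = 3 → t ≠ t' → t ∈ edgesAt E ends x →
      t' ∈ edgesAt E ends x → x ∉ ends t'' → ({t₁, t₂, t₃} : Set β) = {t, t', t''} →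
      ∃ g ∈ E \ {t₁, t₂, t₃}, x ∈ ends g ∧ ∀ e ∈ E \ {t₁, t₂, t₃}, x ∈ ends e → e = g := by
    intro x t t' t'' h3 hne ht ht' hx hset
    rw [hset]
    have hcard : (edgesAt E ends x \ {t, t'}).ncard = 1 := by
      have hfin := Set.finite_of_ncard_ne_zero (s := edgesAt E ends x) (by omega)
      have := Set.ncard_sdiff_add_ncard_of_subset (s := {t, t'}) (t := edgesAt E ends x)
        (by rintro e (rfl | rfl) <;> assumption) hfin
      rw [Set.ncard_pair hne] at this
      omega
    obtain ⟨g, hg⟩ := Set.ncard_eq_one.1 hcard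
    have hgm : g ∈ edgesAt E ends x \ {t, t'} := by rw [hg]; rfl
    refine ⟨g, ⟨hgm.1.1, ?_⟩, hgm.1.2, fun e he hxe => ?_⟩
    · rintro (rfl | rfl | rfl)
      exacts [hgm.2 (by simp), hgm.2 (by simp), hx hgm.1.2]
    · have : e ∈ edgesAt E ends x \ {t, t'} := ⟨⟨he.1, hxe⟩, fun h => he.2 (by
        rcases h with rfl | rfl <;> simp)⟩
      rw [hg] at this
      exact this
  have hab := T.ab
  have hac := T.ac
  have hbc := T.bc
  obtain ⟨n12, n13, n23⟩ := T.t_ne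
  rcases hx with rfl | rfl | rfl
  · refine key _ t₂ t₃ t₁ T.deg_a n23 ⟨T.mem₂, by simp [T.ends₂]⟩ ⟨T.mem₃, by simp [T.ends₃]⟩ ?_ ?_
    · simp [T.ends₁, hab, hac]
    · ext; simp; tauto
  · refine key _ t₁ t₃ t₂ T.deg_b n13 ⟨T.mem₁, by simp [T.ends₁]⟩ ⟨T.mem₃, by simp [T.ends₃]⟩ ?_ ?_
    · simp [T.ends₂, hab.symm, hbc]
    · ext; simp; tauto
  · refine key _ t₁ t₂ t₃ T.deg_c n12 ⟨T.mem₁, by simp [T.ends₁]⟩ ⟨T.mem₂, by simp [T.ends₂]⟩ ?_ ?_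
    · simp [T.ends₃, hac.symm, hbc.symm]
    · ext; simp

/-- The other edges at the vertices of the triangle lead out of the triangle, since two edges leave it. -/
theorem exists_out (h : IsSubcubic E ends) {e : β} (he : e ∈ E \ {t₁, t₂, t₃}) {x : α} (hx : x ∈ ends e)
    (hxA : x ∈ ({a, b, c} : Set α)) : ∃ y, ends e = s(x, y) ∧ y ∉ ({a, b, c} : Set α) := by
  obtain ⟨y, hy⟩ := Sym2.mem_iff_exists.1 hx
  refine ⟨y, hy, fun hyA => ?_⟩
  have hxy : x ≠ y := by
    rintro rfl
    exact h.loopless e he.1 (by simp [hy])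
  obtain ⟨z, hzA, hzx, hzy, hall⟩ : ∃ z ∈ ({a, b, c} : Set α), z ≠ x ∧ z ≠ y ∧
      ∀ u ∈ ({a, b, c} : Set α), u = x ∨ u = y ∨ u = z := by
    have hab := T.ab
    have hac := T.ac
    have hbc := T.bc
    simp only [Set.mem_insert_iff, Set.mem_singleton_iff] at hxA hyA ⊢
    rcases hxA with rfl | rfl | rfl <;> rcases hyA with rfl | rfl | rfl
    · exact absurd rfl hxy
    · exact ⟨c, by tauto, hac.symm, hbc.symm, by tauto⟩
    · exact ⟨b, by tauto, hab.symm, hbc, by tauto⟩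
    · exact ⟨c, by tauto, hbc.symm, hac.symm, by tauto⟩
    · exact absurd rfl hxy
    · exact ⟨a, by tauto, hab, hac, by tauto⟩
    · exact ⟨b, by tauto, hbc, hab.symm, by tauto⟩
    · exact ⟨a, by tauto, hac, hab, by tauto⟩
    · exact absurd rfl hxy
  have honly : ∀ e' ∈ E \ {t₁, t₂, t₃}, ∀ u, (u = x ∨ u = y) → u ∈ ends e' → e' = e := by
    intro e' he' u hu hue'
    obtain ⟨g, -, -, hg⟩ := T.exists_third (x := u) (by rcases hu with rfl | rfl <;> assumption)
    rw [hg e' he' hue', hg e he (by rcases hu with rfl | rfl <;> simp [hy])]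
  obtain ⟨g, hgE, hzg, hg⟩ := T.exists_third hzA
  obtain ⟨y', hy'⟩ := Sym2.mem_iff_exists.1 hzg
  have hze : z ∉ ends e := by simp [hy, hzx, hzy]
  have hy'A : y' ∉ ({a, b, c} : Set α) := by
    intro hy'A
    rcases hall y' hy'A with hu | hu | hu
    · exact hze (honly g hgE y' (Or.inl hu) (by simp [hy']) ▸ hzg)
    · exact hze (honly g hgE y' (Or.inr hu) (by simp [hy']) ▸ hzg)
    · exact h.loopless g hgE.1 (by simp [hy', hu])
  obtain ⟨e₁, h1, e₂, h2, hne, c1, c2⟩ := h.cut {a, b, c} ⟨e, he.1, x, hx, hxA⟩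
    ⟨g, hgE.1, y', by simp [hy'], hy'A⟩
  have hcr : ∀ e' ∈ E, Crosses ends {a, b, c} e' → e' = g := by
    rintro e' he' ⟨⟨u, hu, huA⟩, v, hv, hvA⟩
    have he'T : e' ∈ E \ {t₁, t₂, t₃} := ⟨he', fun ht => hvA (T.mem_of_mem_ends ht hv)⟩
    rcases hall u huA with hux | hux | hux
    · have := honly e' he'T u (Or.inl hux) hu
      rw [this, hy, Sym2.mem_iff] at hv
      rcases hv with rfl | rfl
      exacts [absurd hxA hvA, absurd hyA hvA]
    · have := honly e' he'T u (Or.inr hux) hu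
      rw [this, hy, Sym2.mem_iff] at hv
      rcases hv with rfl | rfl
      exacts [absurd hxA hvA, absurd hyA hvA]
    · exact hg e' he'T (hux ▸ hu)
  exact hne ((hcr _ h1 c1).trans (hcr _ h2 c2).symm)

/-- Contracting a triangle preserves the assumptions on the multigraph. -/
theorem isSubcubic_contract [Finite β] (h : IsSubcubic E ends) :
    IsSubcubic (E \ {t₁, t₂, t₃}) (fun e => (ends e).map (contract a b c)) where
  loopless e he := by
    obtain ⟨u, v, huv⟩ : ∃ u v, ends e = s(u, v) := by
      induction ends e with
      | h u v => exact ⟨u, v, rfl⟩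
    have hne : u ≠ v := by
      rintro rfl
      exact h.loopless e he.1 (by simp [huv])
    simp only [huv, Sym2.map_mk, Sym2.mk_isDiag_iff]
    intro heq
    by_cases hu : u ∈ ({a, b, c} : Set α)
    · obtain ⟨y, hy, hyA⟩ := T.exists_out h he (by simp [huv]) hu
      rw [huv, Sym2.congr_right] at hy
      rw [contract_of_mem hu] at heq
      exact hyA (hy ▸ contract_eq_iff.1 heq.symm)
    · by_cases hv : v ∈ ({a, b, c} : Set α)
      · rw [contract_of_mem hv] at heq
        exact hu (contract_eq_iff.1 heq)
      · rw [contract_of_notMem hu, contract_of_notMem hv] at heq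
        exact hne heq
  degree_le y := by
    by_cases hy : y ∈ ({a, b, c} : Set α)
    · obtain ⟨ga, -, -, ha⟩ := T.exists_third (x := a) (by simp)
      obtain ⟨gb, -, -, hb⟩ := T.exists_third (x := b) (by simp)
      obtain ⟨gc, -, -, hc⟩ := T.exists_third (x := c) (by simp)
      refine le_trans (Set.ncard_le_ncard (t := {ga, gb, gc}) ?_) ((Set.ncard_insert_le _ _).trans
        (Nat.succ_le_succ ((Set.ncard_insert_le _ _).trans (by rw [Set.ncard_singleton]))))
      rintro e ⟨he, hye⟩
      obtain ⟨x, hx, rfl⟩ := Sym2.mem_map.1 hye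
      have hxA : x ∈ ({a, b, c} : Set α) := by
        by_contra hxA
        rw [contract_of_notMem hxA] at hy
        exact hxA hy
      rcases hxA with rfl | rfl | rfl
      · simp [ha e he hx]
      · simp [hb e he hx]
      · simp [hc e he hx]
    · refine le_trans (Set.ncard_le_ncard ?_) (h.degree_le y)
      rintro e ⟨he, hye⟩
      obtain ⟨x, hx, rfl⟩ := Sym2.mem_map.1 hye
      have hxA : x ∉ ({a, b, c} : Set α) := fun hxA => hy (by rw [contract_of_mem hxA]; simp)
      exact ⟨he.1, by rwa [contract_of_notMem hxA]⟩
  cut A h1 h2 := by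
    obtain ⟨e, he, x', hx', hxA⟩ := h1
    obtain ⟨x, hx, rfl⟩ := Sym2.mem_map.1 hx'
    obtain ⟨e', he', y', hy', hyA⟩ := h2
    obtain ⟨y, hy, rfl⟩ := Sym2.mem_map.1 hy'
    obtain ⟨e₁, h1, e₂, h2, hne, c1, c2⟩ := h.cut {z | contract a b c z ∈ A} ⟨e, he.1, x, hx, hxA⟩
      ⟨e', he'.1, y, hy, hyA⟩
    have key : ∀ e ∈ E, Crosses ends {z | contract a b c z ∈ A} e → e ∈ E \ {t₁, t₂, t₃} ∧
        Crosses (fun e => (ends e).map (contract a b c)) A e := by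
      rintro e he ⟨⟨u, hu, huA⟩, v, hv, hvA⟩
      refine ⟨⟨he, fun ht => hvA ?_⟩, ⟨_, Sym2.mem_map.2 ⟨u, hu, rfl⟩, huA⟩,
        _, Sym2.mem_map.2 ⟨v, hv, rfl⟩, hvA⟩
      have huA' : contract a b c u ∈ A := huA
      rw [contract_of_mem (T.mem_of_mem_ends ht hu)] at huA'
      change contract a b c v ∈ A
      rwa [contract_of_mem (T.mem_of_mem_ends ht hv)]
    exact ⟨e₁, (key _ h1 c1).1, e₂, (key _ h2 c2).1, hne, (key _ h1 c1).2, (key _ h2 c2).2⟩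

/-- A colouring of the contracted multigraph extends: an edge of the triangle gets the colour of the
third edge at the opposite vertex. -/
theorem hasColoring_of_contract (h : IsSubcubic E ends)
    (hcol : HasColoring (E \ {t₁, t₂, t₃}) (fun e => (ends e).map (contract a b c))) :
    HasColoring E ends := by
  classical
  obtain ⟨f, hf⟩ := hcol
  obtain ⟨n12, n13, n23⟩ := T.t_ne
  obtain ⟨ga, hga, haga, ha⟩ := T.exists_third (x := a) (by simp)
  obtain ⟨gb, hgb, hbgb, hb⟩ := T.exists_third (x := b) (by simp)
  obtain ⟨gc, hgc, hcgc, hc⟩ := T.exists_third (x := c) (by simp)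
  have hunique : ∀ g ∈ E \ {t₁, t₂, t₃}, ∀ x y, x ∈ ({a, b, c} : Set α) → y ∈ ({a, b, c} : Set α) →
      x ∈ ends g → y ∈ ends g → x = y := by
    intro g hg x y hxA hyA hx hy
    obtain ⟨z, hz, hzA⟩ := T.exists_out h hg hx hxA
    rw [hz, Sym2.mem_iff] at hy
    rcases hy with rfl | rfl
    exacts [rfl, absurd hyA hzA]
  have hab : ga ≠ gb := by
    rintro rfl
    exact T.ab (hunique ga hga a b (by simp) (by simp) haga hbgb)
  have hac : ga ≠ gc := by
    rintro rfl
    exact T.ac (hunique ga hga a c (by simp) (by simp) haga hcgc)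
  have hbc : gb ≠ gc := by
    rintro rfl
    exact T.bc (hunique gb hgb b c (by simp) (by simp) hbgb hcgc)
  have hshare : ∀ g ∈ E \ {t₁, t₂, t₃}, ∀ g' ∈ E \ {t₁, t₂, t₃}, g ≠ g' → ∀ x y,
      x ∈ ({a, b, c} : Set α) → y ∈ ({a, b, c} : Set α) → x ∈ ends g → y ∈ ends g' →
      ColorsApart (f g) (f g') := by
    intro g hg g' hg' hne x y hxA hyA hx hy
    exact hf g hg g' hg' hne a (Sym2.mem_map.2 ⟨x, hx, contract_of_mem hxA⟩)
      (Sym2.mem_map.2 ⟨y, hy, contract_of_mem hyA⟩)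
  let r : β → β := fun e => if e = t₁ then ga else if e = t₂ then gb else if e = t₃ then gc else e
  have r1 : r t₁ = ga := by simp [r]
  have r2 : r t₂ = gb := by simp [r, n12.symm]
  have r3 : r t₃ = gc := by simp [r, n13.symm, n23.symm]
  have rE : ∀ e ∈ E \ {t₁, t₂, t₃}, r e = e := fun e he => by
    have := he.2
    simp only [Set.mem_insert_iff, Set.mem_singleton_iff, not_or] at this
    simp [r, this]
  have hgg : ∀ t ∈ ({t₁, t₂, t₃} : Set β), r t ∈ E \ {t₁, t₂, t₃} ∧
      ∃ x ∈ ({a, b, c} : Set α), x ∈ ends (r t) ∧ x ∉ ends t := by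
    have hab := T.ab
    have hac := T.ac
    have hbc := T.bc
    rintro t (rfl | rfl | rfl)
    · rw [r1]; exact ⟨hga, a, by simp, haga, by simp [T.ends₁, hab, hac]⟩
    · rw [r2]; exact ⟨hgb, b, by simp, hbgb, by simp [T.ends₂, hab.symm, hbc]⟩
    · rw [r3]; exact ⟨hgc, c, by simp, hcgc, by simp [T.ends₃, hac.symm, hbc.symm]⟩
  have hrinj : ∀ t ∈ ({t₁, t₂, t₃} : Set β), ∀ t' ∈ ({t₁, t₂, t₃} : Set β), t ≠ t' → r t ≠ r t' := by
    rintro t (rfl | rfl | rfl) t' (rfl | rfl | rfl) hne <;>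
      first | exact absurd rfl hne | (simp only [r1, r2, r3]; first | assumption | exact Ne.symm ‹_›)
  have hmix : ∀ t ∈ ({t₁, t₂, t₃} : Set β), ∀ e ∈ E \ {t₁, t₂, t₃}, ∀ x, x ∈ ends t → x ∈ ends e →
      ColorsApart (f (r t)) (f (r e)) := by
    intro t ht e he x hx hx'
    obtain ⟨hr, y, hyA, hy, hyt⟩ := hgg t ht
    have hxA := T.mem_of_mem_ends ht hx
    rw [rE e he]
    refine hshare _ hr e he ?_ y x hyA hxA hy hx'
    intro hre
    rw [← hre] at hx'
    exact hyt (hunique _ hr x y hxA hyA hx' hy ▸ hx)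
  refine ⟨fun e => f (r e), fun e he e' he' hne x hx hx' => ?_⟩
  by_cases ht : e ∈ ({t₁, t₂, t₃} : Set β) <;> by_cases ht' : e' ∈ ({t₁, t₂, t₃} : Set β)
  · obtain ⟨hr, y, hyA, hy, -⟩ := hgg e ht
    obtain ⟨hr', y', hyA', hy', -⟩ := hgg e' ht'
    exact hshare _ hr _ hr' (hrinj e ht e' ht' hne) y y' hyA hyA' hy hy'
  · exact hmix e ht e' ⟨he', ht'⟩ x hx hx'
  · exact (hmix e' ht' e ⟨he, ht⟩ x hx' hx).symm
  · simp only [rE e ⟨he, ht⟩, rE e' ⟨he', ht'⟩]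
    exact hf e ⟨he, ht⟩ e' ⟨he', ht'⟩ hne _ (Sym2.mem_map.2 ⟨x, hx, rfl⟩) (Sym2.mem_map.2 ⟨x, hx', rfl⟩)

end IsCubicTriangle

end Multigraph

/-! ### Triangles whose contraction is exceptional -/

section Multigraph

variable {α β : Type*} {E : Set β} {ends : β → Sym2 α}

namespace IsCubicTriangle

variable {a b c : α} {t₁ t₂ t₃ : β} (T : IsCubicTriangle E ends a b c t₁ t₂ t₃)
include T

/-- For any numbering of the vertices of the triangle the edges can be numbered by the opposite vertices. -/
theorem exists_opposite {u : Fin 3 → α} (hu : Function.Injective u)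
    (huA : ∀ j, u j ∈ ({a, b, c} : Set α)) : ∃ s : Fin 3 → β, Function.Injective s ∧
      (∀ j, s j ∈ ({t₁, t₂, t₃} : Set β)) ∧ (∀ t ∈ ({t₁, t₂, t₃} : Set β), ∃ j, s j = t) ∧
      ends (s 0) = s(u 1, u 2) ∧ ends (s 1) = s(u 0, u 2) ∧ ends (s 2) = s(u 0, u 1) := by
  obtain ⟨n12, n13, n23⟩ := T.t_ne
  have e1 := T.ends₁
  have e2 := T.ends₂
  have e3 := T.ends₃
  have e1' := e1.trans Sym2.eq_swap
  have e2' := e2.trans Sym2.eq_swap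
  have e3' := e3.trans Sym2.eq_swap
  have key : ∀ x y z : β, x ≠ y → x ≠ z → y ≠ z → ({t₁, t₂, t₃} : Set β) = {x, y, z} →
      ends x = s(u 1, u 2) → ends y = s(u 0, u 2) → ends z = s(u 0, u 1) → ∃ s : Fin 3 → β,
      Function.Injective s ∧
      (∀ j, s j ∈ ({t₁, t₂, t₃} : Set β)) ∧ (∀ t ∈ ({t₁, t₂, t₃} : Set β), ∃ j, s j = t) ∧
      ends (s 0) = s(u 1, u 2) ∧ ends (s 1) = s(u 0, u 2) ∧ ends (s 2) = s(u 0, u 1) := by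
    intro x y z hxy hxz hyz hset hx hy hz
    rw [hset]
    refine ⟨![x, y, z], ?_, ?_, ?_, hx, hy, hz⟩
    · simp [vecCons_injective_iff, hxy, hxz, hyz, Function.injective_of_subsingleton]
    · intro j; fin_cases j <;> simp
    · rintro t (rfl | rfl | rfl)
      exacts [⟨0, rfl⟩, ⟨1, rfl⟩, ⟨2, rfl⟩]
  have n01 : u 0 ≠ u 1 := fun h => absurd (hu h) (by decide)
  have n02 : u 0 ≠ u 2 := fun h => absurd (hu h) (by decide)
  have n12' : u 1 ≠ u 2 := fun h => absurd (hu h) (by decide)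
  have m0 := huA 0
  have m1 := huA 1
  have m2 := huA 2
  simp only [Set.mem_insert_iff, Set.mem_singleton_iff] at m0 m1 m2
  rcases m0 with m0 | m0 | m0 <;> rcases m1 with m1 | m1 | m1 <;> rcases m2 with m2 | m2 | m2 <;>
    first
    | exact absurd (m0.trans m1.symm) n01
    | exact absurd (m0.trans m2.symm) n02
    | exact absurd (m1.trans m2.symm) n12'
    | (rw [m0, m1, m2] at key ⊢)
  · exact key t₁ t₂ t₃ n12 n13 n23 rfl e1 e2 e3
  · exact key t₁ t₃ t₂ n13 n12 n23.symm (by ext; simp; tauto) e1' e3 e2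
  · exact key t₂ t₁ t₃ n12.symm n23 n13 (by ext; simp; tauto) e2 e1 e3'
  · exact key t₂ t₃ t₁ n23 n12.symm n13.symm (by ext; simp; tauto) e2' e3' e1
  · exact key t₃ t₁ t₂ n13.symm n23.symm n12 (by ext; simp; tauto) e3 e1' e2'
  · exact key t₃ t₂ t₁ n23.symm n13.symm n12.symm (by ext; simp; tauto) e3' e2' e1'

/-- If the contracted multigraph is given by a table, where the new vertex has the number `k₀` and
the edges `i 0`, `i 1`, `i 2`, then the multigraph itself is given by a table with two more vertices and
three more edges. -/
theorem models_of_contract (h : IsSubcubic E ends) {k m : ℕ} {table : Fin m → Sym2 (Fin k)}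
    {idx : Fin m → β} {vtx : Fin k → α} (hidx : Function.Injective idx) (hvtx : Function.Injective vtx)
    (hE : Set.range idx = E \ {t₁, t₂, t₃})
    (hends : ∀ i, (ends (idx i)).map (contract a b c) = (table i).map vtx)
    {k₀ : Fin k} (hk₀ : vtx k₀ = a) (hall : ∀ l, ∃ x, l ∈ table x) (i : Fin 3 → Fin m)
    (l : Fin 3 → Fin k) (hi : Function.Injective i) (hil : ∀ j, table (i j) = s(k₀, l j))
    (hl : ∀ j, l j ≠ k₀) (table' : Fin (m + 3) → Sym2 (Fin (k + 2)))
    (h₁ : ∀ j, table' (Fin.castAdd 3 (i j)) =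
      s(![Fin.castAdd 2 k₀, Fin.natAdd k 0, Fin.natAdd k 1] j, Fin.castAdd 2 (l j)))
    (h₂ : ∀ x, (∀ j, x ≠ i j) → k₀ ∉ table x ∧ table' (Fin.castAdd 3 x) = (table x).map (Fin.castAdd 2))
    (h₃ : table' (Fin.natAdd m 0) = s(Fin.natAdd k 0, Fin.natAdd k 1))
    (h₄ : table' (Fin.natAdd m 1) = s(Fin.castAdd 2 k₀, Fin.natAdd k 1))
    (h₅ : table' (Fin.natAdd m 2) = s(Fin.castAdd 2 k₀, Fin.natAdd k 0)) : Models E ends table' := by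
  classical
  have hmem : ∀ x, idx x ∈ E \ {t₁, t₂, t₃} := fun x => hE ▸ ⟨x, rfl⟩
  have hpair : ∀ e : β, ∃ u v, ends e = s(u, v) := fun e => by
    induction ends e with
    | h u v => exact ⟨u, v, rfl⟩
  have hvA : ∀ l, l ≠ k₀ → vtx l ∉ ({a, b, c} : Set α) := by
    intro l hl hlA
    obtain ⟨x, hx⟩ := hall l
    have : vtx l ∈ (ends (idx x)).map (contract a b c) := by
      rw [hends]; exact Sym2.mem_map.2 ⟨l, hx, rfl⟩
    obtain ⟨y, -, hy⟩ := Sym2.mem_map.1 this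
    by_cases hyA : y ∈ ({a, b, c} : Set α)
    · rw [contract_of_mem hyA, ← hk₀] at hy
      exact hl (hvtx hy).symm
    · rw [contract_of_notMem hyA] at hy
      exact hyA (hy ▸ hlA)
  have hu : ∀ j, ∃ u ∈ ({a, b, c} : Set α), ends (idx (i j)) = s(u, vtx (l j)) := by
    intro j
    have ha : a ∈ (ends (idx (i j))).map (contract a b c) := by
      rw [hends, hil, ← hk₀]; simp
    obtain ⟨u, hu, hua⟩ := Sym2.mem_map.1 ha
    have huA := contract_eq_iff.1 hua
    obtain ⟨y, hy, hyA⟩ := T.exists_out h (hmem _) hu huA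
    refine ⟨u, huA, ?_⟩
    have := hends (i j)
    rw [hy, hil, Sym2.map_mk, Sym2.map_mk, contract_of_mem huA, contract_of_notMem hyA, hk₀,
      Sym2.congr_right] at this
    rw [hy, this]
  choose u huA hue using hu
  have huinj : Function.Injective u := by
    intro j j' hjj
    obtain ⟨g, -, -, hg⟩ := T.exists_third (huA j)
    refine hi (hidx ?_)
    rw [hg _ (hmem (i j)) (by simp [hue]), hg _ (hmem (i j')) (by simp [hue, hjj])]
  obtain ⟨s, hsinj, hst, hts, s0, s1, s2⟩ := T.exists_opposite huinj huA
  have hrest : ∀ x, (∀ j, x ≠ i j) → ends (idx x) = (table x).map vtx := by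
    intro x hx
    rw [← hends]
    have hno : ∀ y ∈ ends (idx x), y ∉ ({a, b, c} : Set α) := fun y hy hyA => by
      have : a ∈ (ends (idx x)).map (contract a b c) :=
        Sym2.mem_map.2 ⟨y, hy, contract_of_mem hyA⟩
      rw [hends] at this
      obtain ⟨l, hl, hla⟩ := Sym2.mem_map.1 this
      rw [← hk₀] at hla
      exact (h₂ x hx).1 (hvtx hla ▸ hl)
    obtain ⟨p, q, hpq⟩ := hpair (idx x)
    rw [hpq, Sym2.map_mk, contract_of_notMem (hno p (by simp [hpq])),
      contract_of_notMem (hno q (by simp [hpq]))]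
  let V : Fin (k + 2) → α := Fin.append (Function.update vtx k₀ (u 0)) ![u 1, u 2]
  have V0 : V (Fin.castAdd 2 k₀) = u 0 := by simp [V, Fin.append_left]
  have V1 : V (Fin.natAdd k 0) = u 1 := by simp [V, Fin.append_right]
  have V2 : V (Fin.natAdd k 1) = u 2 := by simp [V, Fin.append_right]
  have Vl : ∀ l, l ≠ k₀ → V (Fin.castAdd 2 l) = vtx l := fun l hl => by
    simp [V, Fin.append_left, hl]
  refine ⟨Fin.append idx s, V, ?_, ?_, ?_, ?_⟩
  · rw [Fin.append_injective_iff]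
    refine ⟨hidx, hsinj, fun x j hx => ?_⟩
    exact (hmem x).2 (hx ▸ hst j)
  · rw [Fin.append_injective_iff]
    have hup : ∀ l, Function.update vtx k₀ (u 0) l = if l = k₀ then u 0 else vtx l := fun l => by
      simp [Function.update_apply]
    have hne : ∀ j, j ≠ 0 → ∀ l, Function.update vtx k₀ (u 0) l ≠ u j := by
      intro j hj l hlj
      rw [hup] at hlj
      split_ifs at hlj with hlk
      · exact hj (huinj hlj).symm
      · exact hvA l hlk (hlj ▸ huA j)
    refine ⟨?_, ?_, ?_⟩
    · intro x y hxy
      rw [hup, hup] at hxy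
      split_ifs at hxy with hx hy hy
      · rw [hx, hy]
      · exact absurd (hxy ▸ huA 0) (hvA y hy)
      · exact absurd (hxy ▸ huA 0) (hvA x hx)
      · exact hvtx hxy
    · have : u 1 ≠ u 2 := fun h => absurd (huinj h) (by decide)
      simp [vecCons_injective_iff, this, Function.injective_of_subsingleton]
    · intro l j
      fin_cases j
      · exact hne 1 (by decide) l
      · exact hne 2 (by decide) l
  · ext e
    constructor
    · rintro ⟨x, rfl⟩
      induction x using Fin.addCases with
      | left x => rw [Fin.append_left]; exact (hmem x).1
      | right j =>
        rw [Fin.append_right]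
        rcases hst j with h | h | h <;> rw [h]
        exacts [T.mem₁, T.mem₂, T.mem₃]
    · intro he
      by_cases ht : e ∈ ({t₁, t₂, t₃} : Set β)
      · obtain ⟨j, rfl⟩ := hts e ht
        exact ⟨Fin.natAdd m j, by rw [Fin.append_right]⟩
      · have : e ∈ Set.range idx := hE ▸ ⟨he, ht⟩
        obtain ⟨x, rfl⟩ := this
        exact ⟨Fin.castAdd 3 x, by rw [Fin.append_left]⟩
  · intro x
    induction x using Fin.addCases with
    | left x =>
      rw [Fin.append_left]
      by_cases hx : ∃ j, x = i j
      · obtain ⟨j, rfl⟩ := hx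
        rw [hue, h₁, Sym2.map_mk, Vl _ (hl j)]
        fin_cases j
        · exact congrArg (s(·, _)) V0.symm
        · exact congrArg (s(·, _)) V1.symm
        · exact congrArg (s(·, _)) V2.symm
      · push Not at hx
        rw [hrest x hx, (h₂ x hx).2, Sym2.map_map]
        refine Sym2.map_congr fun l' hl' => (Vl l' ?_).symm
        rintro rfl
        exact (h₂ x hx).1 hl'
    | right j =>
      rw [Fin.append_right]
      fin_cases j
      · exact s0.trans (by rw [Fin.zero_eta, h₃, Sym2.map_mk, V1, V2])
      · exact s1.trans (by rw [Fin.mk_one, h₄, Sym2.map_mk, V0, V2])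
      · exact s2.trans (by rw [show (⟨2, by decide⟩ : Fin 3) = 2 from rfl, h₅, Sym2.map_mk, V0, V1])

/-- The contracted vertex has degree `3`. -/
theorem exists_vtx_eq (h : IsSubcubic E ends) {k m : ℕ} {table : Fin m → Sym2 (Fin k)}
    {idx : Fin m → β} {vtx : Fin k → α} (hvtx : Function.Injective vtx)
    (hE : Set.range idx = E \ {t₁, t₂, t₃})
    (hends : ∀ i, (ends (idx i)).map (contract a b c) = (table i).map vtx) :
    ∃ k₀, vtx k₀ = a ∧ ∃ x y z, x ≠ y ∧ x ≠ z ∧ y ≠ z ∧ k₀ ∈ table x ∧ k₀ ∈ table y ∧ k₀ ∈ table z := by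
  have hx : ∀ u ∈ ({a, b, c} : Set α), ∃ x k₀, u ∈ ends (idx x) ∧ k₀ ∈ table x ∧ vtx k₀ = a := by
    intro u hu
    obtain ⟨g, hg, hug, -⟩ := T.exists_third hu
    rw [← hE] at hg
    obtain ⟨x, rfl⟩ := hg
    have : a ∈ (ends (idx x)).map (contract a b c) := Sym2.mem_map.2 ⟨u, hug, contract_of_mem hu⟩
    rw [hends] at this
    obtain ⟨k₀, hk, hka⟩ := Sym2.mem_map.1 this
    exact ⟨x, k₀, hug, hk, hka⟩
  obtain ⟨x, k₀, xa, hx1, hx2⟩ := hx a (by simp)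
  obtain ⟨y, k₁, yb, hy1, hy2⟩ := hx b (by simp)
  obtain ⟨z, k₂, zc, hz1, hz2⟩ := hx c (by simp)
  obtain rfl : k₀ = k₁ := hvtx (hx2.trans hy2.symm)
  obtain rfl : k₀ = k₂ := hvtx (hx2.trans hz2.symm)
  have hne : ∀ x u v, u ∈ ({a, b, c} : Set α) → v ∈ ({a, b, c} : Set α) → u ≠ v → u ∈ ends (idx x) →
      v ∉ ends (idx x) := by
    intro x u v hu hv huv hux hvx
    obtain ⟨w, hw, hwA⟩ := T.exists_out h (hE ▸ ⟨x, rfl⟩) hux hu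
    rw [hw, Sym2.mem_iff] at hvx
    rcases hvx with rfl | rfl
    exacts [huv rfl, hwA hv]
  refine ⟨k₀, hx2, x, y, z, ?_, ?_, ?_, hx1, hy1, hz1⟩
  · rintro rfl; exact hne x a b (by simp) (by simp) T.ab xa yb
  · rintro rfl; exact hne x a c (by simp) (by simp) T.ac xa zc
  · rintro rfl; exact hne y b c (by simp) (by simp) T.bc yb zc

/-- If contracting the triangle gives `H₁`, then the new vertex is one of the two vertices of degree `3`,
which are exchanged by a symmetry, so the multigraph is `H₂`. -/
theorem models_tableH₂ (h : IsSubcubic E ends)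
    (hM : Models (E \ {t₁, t₂, t₃}) (fun e => (ends e).map (contract a b c)) tableH₁) :
    Models E ends tableH₂ := by
  have main : ∀ (idx : Fin 4 → β) (vtx : Fin 3 → α), Function.Injective idx → Function.Injective vtx →
      Set.range idx = E \ {t₁, t₂, t₃} →
      (∀ i, (ends (idx i)).map (contract a b c) = (tableH₁ i).map vtx) → vtx 0 = a →
      Models E ends tableH₂ := by
    intro idx vtx hidx hvtx hE hends hk
    obtain ⟨idx', vtx', a1, a2, a3, a4⟩ := T.models_of_contract h hidx hvtx hE hends hk (by decide)
      ![0, 1, 2] ![1, 1, 2] (by decide) (by decide) (by decide)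
      ![s(0, 1), s(3, 1), s(4, 2), s(2, 1), s(3, 4), s(0, 4), s(0, 3)] (by decide) (by decide)
      (by decide) (by decide) (by decide)
    exact ⟨_, _, Models.reindex a1 a2 a3 a4 (τ := ![6, 0, 5, 1, 4, 3, 2]) (σ := ![0, 3, 1, 4, 2])
      (by decide) (by decide) (by decide)⟩
  obtain ⟨idx, vtx, hidx, hvtx, hE, hends⟩ := hM
  obtain ⟨k₀, hk, hdeg⟩ := T.exists_vtx_eq h hvtx hE hends
  have hk01 : k₀ = 0 ∨ k₀ = 1 := by
    clear hk; revert k₀; decide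
  rcases hk01 with rfl | rfl
  · exact main idx vtx hidx hvtx hE hends hk
  · obtain ⟨b1, b2, b3, b4⟩ := Models.reindex (table := tableH₁)
      (table' := tableH₁) (ends := fun e => (ends e).map (contract a b c)) hidx hvtx hE hends
      (τ := ![0, 1, 3, 2]) (σ := ![1, 0, 2]) (by decide) (by decide) (by decide)
    exact main _ _ b1 b2 b3 b4 hk

/-- If contracting the triangle gives `H₂`, then up to symmetry there are two choices of the new vertex.
Both multigraphs are coloured explicitly. -/
theorem hasColoring_of_models_tableH₂ (h : IsSubcubic E ends)
    (hM : Models (E \ {t₁, t₂, t₃}) (fun e => (ends e).map (contract a b c)) tableH₂) :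
    HasColoring E ends := by
  have main : ∀ (idx : Fin 7 → β) (vtx : Fin 5 → α), Function.Injective idx → Function.Injective vtx →
      Set.range idx = E \ {t₁, t₂, t₃} →
      (∀ i, (ends (idx i)).map (contract a b c) = (tableH₂ i).map vtx) → vtx 0 = a ∨ vtx 2 = a →
      HasColoring E ends := by
    rintro idx vtx hidx hvtx hE hends (hk | hk)
    · refine (T.models_of_contract h hidx hvtx hE hends hk (by decide)
        ![0, 1, 2] ![1, 2, 3] (by decide) (by decide) (by decide)
        ![s(0, 1), s(5, 2), s(6, 3), s(1, 2), s(1, 3), s(2, 4), s(4, 3), s(5, 6), s(0, 6), s(0, 5)]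
        (by decide) (by decide) (by decide) (by decide) (by decide)).hasColoring
        ![0, 1, 6, 7, 3, 4, 0, 9, 3, 6] (by decide)
    · refine (T.models_of_contract h hidx hvtx hE hends hk (by decide)
        ![1, 3, 5] ![0, 1, 4] (by decide) (by decide) (by decide)
        ![s(0, 1), s(2, 0), s(0, 3), s(5, 1), s(1, 3), s(6, 4), s(4, 3), s(5, 6), s(2, 6), s(2, 5)]
        (by decide) (by decide) (by decide) (by decide) (by decide)).hasColoring
        ![0, 3, 6, 7, 3, 1, 9, 4, 7, 0] (by decide)
  obtain ⟨idx, vtx, hidx, hvtx, hE, hends⟩ := hM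
  obtain ⟨k₀, hk, hdeg⟩ := T.exists_vtx_eq h hvtx hE hends
  have hk03 : k₀ = 0 ∨ k₀ = 1 ∨ k₀ = 2 ∨ k₀ = 3 := by
    clear hk; revert k₀; decide
  rcases hk03 with rfl | rfl | rfl | rfl
  · exact main idx vtx hidx hvtx hE hends (Or.inl hk)
  · obtain ⟨b1, b2, b3, b4⟩ := Models.reindex (table := tableH₂)
      (table' := tableH₂) (ends := fun e => (ends e).map (contract a b c)) hidx hvtx hE hends
      (τ := ![0, 3, 4, 1, 2, 5, 6]) (σ := ![1, 0, 2, 3, 4]) (by decide) (by decide) (by decide)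
    exact main _ _ b1 b2 b3 b4 (Or.inl hk)
  · exact main idx vtx hidx hvtx hE hends (Or.inr hk)
  · obtain ⟨b1, b2, b3, b4⟩ := Models.reindex (table := tableH₂)
      (table' := tableH₂) (ends := fun e => (ends e).map (contract a b c)) hidx hvtx hE hends
      (τ := ![0, 2, 1, 4, 3, 6, 5]) (σ := ![0, 1, 3, 2, 4]) (by decide) (by decide) (by decide)
    exact main _ _ b1 b2 b3 b4 (Or.inr hk)

end IsCubicTriangle

/-- The colouring theorem for subcubic multigraphs, by induction on the number of edges. -/
theorem IsSubcubic.hasColoring [Finite α] [Finite β] (h : IsSubcubic E ends)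
    (hH₁ : ¬ Models E ends tableH₁) (hH₂ : ¬ Models E ends tableH₂) : HasColoring E ends := by
  induction hn : E.ncard using Nat.strong_induction_on generalizing E ends with
  | _ n ih =>
    by_cases htri : ∃ a b c t₁ t₂ t₃, IsCubicTriangle E ends a b c t₁ t₂ t₃
    · obtain ⟨a, b, c, t₁, t₂, t₃, T⟩ := htri
      by_cases h2 : Models (E \ {t₁, t₂, t₃}) (fun e => (ends e).map (contract a b c)) tableH₂
      · exact T.hasColoring_of_models_tableH₂ h h2
      refine T.hasColoring_of_contract h (ih _ ?_ (T.isSubcubic_contract h)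
        (fun h1 => hH₂ (T.models_tableH₂ h h1)) h2 rfl)
      rw [← hn]
      exact Set.ncard_lt_ncard ⟨Set.sdiff_subset, fun hsub => (hsub T.mem₁).2 (by simp)⟩
    · push Not at htri
      obtain ⟨M, hME, hM, hcov⟩ := h.exists_matching
      exact h.hasColoring_of_matching hME hM hcov htri hH₁

end Multigraph

/-! ### From multigraphs given by ends to `Graph` -/

namespace Graph

variable {α β : Type*} {G : Graph α β}

/-- Choosing the unordered pair of ends of each edge. -/
theorem exists_ends (G : Graph α β) : ∃ ends : E(G) → Sym2 V(G), ∀ (e : E(G)) (x y : V(G)),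
    G.IsLink e x y ↔ ends e = s(x, y) := by
  have h : ∀ e : E(G), ∃ p : Sym2 V(G), ∀ x y : V(G), G.IsLink e x y ↔ p = s(x, y) := by
    intro e
    obtain ⟨x, y, hxy⟩ := G.edge_mem_iff_exists_isLink e.1 |>.1 e.2
    refine ⟨s(⟨x, hxy.left_mem⟩, ⟨y, hxy.right_mem⟩), fun u v => ?_⟩
    rw [hxy.isLink_iff, Sym2.eq_iff, Subtype.ext_iff, Subtype.ext_iff, Subtype.ext_iff, Subtype.ext_iff]
  choose ends h using h
  exact ⟨ends, h⟩

theorem mem_ends_iff {ends : E(G) → Sym2 V(G)} (hends : ∀ (e : E(G)) (x y : V(G)),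
    G.IsLink e x y ↔ ends e = s(x, y)) (e : E(G)) (x : V(G)) : x ∈ ends e ↔ G.Inc e x := by
  constructor
  · intro hx
    obtain ⟨y, hy⟩ := Sym2.mem_iff_exists.1 hx
    exact ⟨y, (hends e x y).2 hy⟩
  · rintro ⟨y, hy⟩
    rw [(hends e x ⟨y, hy.right_mem⟩).1 hy]
    simp

/-- In a connected graph some edge joins a set of vertices to its complement. -/
theorem IsConnected.exists_isLink (h : G.IsConnected) {A : Set α} {x y : α} (hx : x ∈ V(G))
    (hy : y ∈ V(G)) (hxA : x ∈ A) (hyA : y ∉ A) : ∃ e u v, G.IsLink e u v ∧ u ∈ A ∧ v ∉ A := by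
  have hr := h.2 x hx y hy
  induction hr with
  | refl => exact absurd hxA hyA
  | @tail b c _ hbc ih =>
    by_cases hb : b ∈ A
    · obtain ⟨e, he⟩ := hbc
      exact ⟨e, b, c, he, hb, hyA⟩
    · obtain ⟨e, he⟩ := hbc
      exact ih he.left_mem hb

theorem IsTwoEdgeConnected.isSubcubic [G.Loopless] (h : G.IsTwoEdgeConnected) (hdeg : G.maxEDegree ≤ 3)
    {ends : E(G) → Sym2 V(G)} (hends : ∀ (e : E(G)) (x y : V(G)), G.IsLink e x y ↔ ends e = s(x, y)) :
    IsSubcubic Set.univ ends where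
  loopless e _ := by
    obtain ⟨u, v, huv⟩ : ∃ u v, ends e = s(u, v) := by
      induction ends e with
      | h u v => exact ⟨u, v, rfl⟩
    rw [huv, Sym2.mk_isDiag_iff]
    rintro rfl
    exact ((hends e u u).2 huv).ne rfl
  degree_le x := by
    have h1 : (Subtype.val '' edgesAt Set.univ ends x).encard ≤ 3 := by
      refine le_trans (Set.encard_le_encard (t := G.incidenceSet x) ?_) (le_trans le_self_add
        (le_trans (le_iSup₂ (f := fun y (_ : y ∈ V(G)) => G.edegree y) x.1 x.2) hdeg))
      rintro _ ⟨e, ⟨-, he⟩, rfl⟩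
      exact (mem_ends_iff hends e x).1 he
    rw [Subtype.val_injective.encard_image] at h1
    exact (Set.encard_le_coe_iff_finite_ncard_le.1 h1).2
  cut A h1 h2 := by
    obtain ⟨-, -, x, -, hx⟩ := h1
    obtain ⟨-, -, y, -, hy⟩ := h2
    have key : ∀ e u v, G.IsLink e u v → u ∈ Subtype.val '' A → v ∉ Subtype.val '' A →
        ∃ he : e ∈ E(G), Crosses ends A ⟨e, he⟩ := by
      rintro e _ v he ⟨u, hu, rfl⟩ hv
      refine ⟨he.edge_mem, ⟨u, ?_, hu⟩, ⟨v, he.right_mem⟩, ?_, fun hvA => hv ⟨_, hvA, rfl⟩⟩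
      · exact (mem_ends_iff hends ⟨e, he.edge_mem⟩ u).2 ⟨v, he⟩
      · exact (mem_ends_iff hends ⟨e, he.edge_mem⟩ ⟨v, he.right_mem⟩).2 ⟨u, he.symm⟩
    have hxA : x.1 ∈ Subtype.val '' A := ⟨x, hx, rfl⟩
    have hyA : y.1 ∉ Subtype.val '' A := fun ⟨z, hz, hzy⟩ => hy (Subtype.ext hzy ▸ hz)
    obtain ⟨e, u, v, he, hu, hv⟩ := h.2.1.exists_isLink x.2 y.2 hxA hyA
    obtain ⟨heG, hc⟩ := key e u v he hu hv
    obtain ⟨e', u', v', he', hu', hv'⟩ := (h.2.2 e heG).exists_isLink (by simp)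
      (by simp) hxA hyA
    rw [deleteEdges_isLink] at he'
    obtain ⟨heG', hc'⟩ := key e' u' v' he'.1 hu' hv'
    refine ⟨⟨e, heG⟩, trivial, ⟨e', heG'⟩, trivial, fun heq => he'.2 ?_, hc, hc'⟩
    exact (congrArg Subtype.val heq).symm

/-- A `2`-edge-connected multigraph has no isolated vertices, so a table of edges determines it. -/
theorem IsTwoEdgeConnected.isIsomorphic_ofEnds (h : G.IsTwoEdgeConnected) {ends : E(G) → Sym2 V(G)}
    (hends : ∀ (e : E(G)) (x y : V(G)), G.IsLink e x y ↔ ends e = s(x, y)) {k m : ℕ}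
    {table : Fin m → Sym2 (Fin k)} (hM : Models Set.univ ends table) :
    G.IsIsomorphic (ofEnds table) := by
  obtain ⟨idx, vtx, hidx, hvtx, hE, hi⟩ := hM
  have hsurj : Function.Surjective vtx := by
    intro x
    obtain ⟨y, hy, hne⟩ := h.1.exists_ne x.1
    rcases Relation.ReflTransGen.cases_head (h.2.1.2 x x.2 y hy) with rfl | ⟨z, ⟨e, he⟩, -⟩
    · exact absurd rfl hne
    · obtain ⟨i, hie⟩ : (⟨e, he.edge_mem⟩ : E(G)) ∈ Set.range idx := hE ▸ trivial
      have hx := (mem_ends_iff hends ⟨e, he.edge_mem⟩ x).2 ⟨z, he⟩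
      rw [← hie, hi] at hx
      obtain ⟨l, -, hl⟩ := Sym2.mem_map.1 hx
      exact ⟨l, hl⟩
  let φ := Equiv.ofBijective vtx ⟨hvtx, hsurj⟩
  let ψ := Equiv.ofBijective idx ⟨hidx, Set.range_eq_univ.1 hE⟩
  refine ⟨φ.symm.trans (Equiv.Set.univ _).symm, ψ.symm.trans (Equiv.Set.univ _).symm, fun e x y => ?_⟩
  obtain ⟨i, rfl⟩ := ψ.surjective e
  obtain ⟨a, rfl⟩ := φ.surjective x
  obtain ⟨b, rfl⟩ := φ.surjective y
  rw [hends]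
  change ends (idx i) = s(vtx a, vtx b) ↔ table (ψ.symm (ψ i)) = s(φ.symm (φ a), φ.symm (φ b))
  rw [hi, ← Sym2.map_mk, (Sym2.map.injective hvtx).eq_iff, Equiv.symm_apply_apply,
    Equiv.symm_apply_apply, Equiv.symm_apply_apply]

theorem circularChromaticIndex_le_of_hasColoring {ends : E(G) → Sym2 V(G)}
    (hends : ∀ (e : E(G)) (x y : V(G)), G.IsLink e x y ↔ ends e = s(x, y))
    (h : HasColoring Set.univ ends) : G.circularChromaticIndex ≤ 11 / 3 := by
  obtain ⟨f, hf⟩ := h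
  have key : ∀ a b : ZMod 11, ColorsApart a b → 3 ≤ |(a.val : ℤ) - (b.val : ℤ)| ∧
      |(a.val : ℤ) - (b.val : ℤ)| ≤ 11 - 3 := by decide
  refine sInf_le ⟨11, 3, by norm_num, by norm_num, ⟨f, fun e e' hadj => ?_⟩, by norm_num⟩
  obtain ⟨hne, x, hx, hx'⟩ := hadj
  exact key (f e) (f e') (hf e trivial e' trivial hne ⟨x, hx.vertex_mem⟩ ((mem_ends_iff hends e _).2 hx)
    ((mem_ends_iff hends e' _).2 hx'))

end Graph

theorem theorem1p7 {α β : Type*} (G : Graph α β) [G.Loopless]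
    (hV : G.vertexSet.Finite) (hE : G.edgeSet.Finite)
    (hconn : G.IsTwoEdgeConnected) (hdeg : G.maxEDegree = 3)
    (hH₁ : ¬ G.IsIsomorphic Graph.H₁) (hH₂ : ¬ G.IsIsomorphic Graph.H₂) :
    G.circularChromaticIndex ≤ 11 / 3 := by
  have := hV.to_subtype
  have := hE.to_subtype
  obtain ⟨ends, hends⟩ := G.exists_ends
  exact Graph.circularChromaticIndex_le_of_hasColoring hends
    ((hconn.isSubcubic hdeg.le hends).hasColoring
      (fun h => hH₁ (hconn.isIsomorphic_ofEnds hends h))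
      (fun h => hH₂ (hconn.isIsomorphic_ofEnds hends h)))
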